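/- Let $F$ be a countable field of characteristic zero, and let $(T_n)_{n\in F}$ be an ergodic measure-preserving action of the additive group $(F,+)$ on a probability space $(X,\mathcal B,\mu)$: each $T_n\colon X\to X$ is an invertible measurable map preserving $\mu$, $T_m\circ T_n=T_{m+n}$ for all $m,n\in F$, and every $A\in\mathcal B$ with $\mu(T_n^{-1}A\,\triangle\, A)=0$ for all $n\in F$ has $\mu(A)\in\{0,1\}$. Let $(\Phi_N)_{N}$ be a Følner sequence in $(F,+)$, that is, a sequence of nonempty finite subsets of $F$ such that $$\lim_{N\to\infty}\frac{|\Phi_N\,\triangle\,(g+\Phi_N)|}{|\Phi_N|}=0\qquad\text{for every } g\in F.$$ Let $k\in\mathbb N$ and let $p_1,\dots,p_k\in F[x]$ be independent polynomials, meaning that for every $(b_1,\dots,b_k)\in F^k\setminus\{0\}$ the polynomial $\sum_{i=1}^k b_ip_i$ is not constant. Then for all $f_1,\dots,f_k\in L^\infty(\mu)$ (complex-valued), writing $T_nf=f\circ T_n$, $$\lim_{N\to\infty}\frac1{|\Phi_N|}\sum_{n\in\Phi_N}T_{p_1(n)}f_1\cdots T_{p_k(n)}f_k=\prod_{j=1}^k\int_X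 f_j\,d\mu\qquad\text{in }L^2(\mu).$$ -/

import Mathlib

/-- A sequence `Φ` of nonempty finite subsets of an abelian group `G` is a Følner sequence if
`|Φ N ∆ (g + Φ N)| / |Φ N| → 0` as `N → ∞` for every `g : G`. -/
structure IsFolnerSequence {G : Type*} [AddCommGroup G] [DecidableEq G]
    (Φ : ℕ → Finset G) : Prop where
  nonempty : ∀ N, (Φ N).Nonempty
  tendsto_symmDiff : ∀ g : G,
    Filter.Tendsto
      (fun N => ((symmDiff (Φ N) ((Φ N).image fun x => g + x)).card : ℝ) / ((Φ N).card : ℝ))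
      Filter.atTop (nhds 0)

/-- A family `p_1, …, p_k` of polynomials over `R` is independent if, for every nonzero vector
`(b_1, …, b_k)` of elements of `R`, the polynomial `∑ b_i p_i` is not constant. -/
def IndependentPolynomials {R : Type*} [CommRing R] {k : ℕ}
    (p : Fin k → Polynomial R) : Prop :=
  ∀ b : Fin k → R, b ≠ 0 →
    ∀ c : R, ∑ i, Polynomial.C (b i) * p i ≠ Polynomial.C c

/-! If every `f j` is an eigenfunction of the action, then `T_{p_j(n)} f_j` is `f_j` times a
character evaluated at `p_j(n)`, and the claim is Weyl equidistribution for independent polynomials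
(`multiConv_of_eig`, resting on `tendsto_avg_prod_addChar`). The general case is an induction on the
set `T` of slots whose functions are not known to be eigenfunctions (`multiConv_of_contr`). By
linearity the functions in those slots may be assumed to have integral zero, and the averages `V N`
must then be shown to tend to zero. Let `m ∈ T` have a polynomial of maximal degree among the slots
in `T`.

Polynomial exhaustion: iterated van der Corput estimates (`tendsto_avg_polyProd`) show that the
averages vanish in the limit as soon as all Gowers–Host–Kra seminorms of the function in slot `m`
vanish. The estimates tolerate arbitrary bounded weights, which is how the characters coming from
the eigenfunction slots are carried along.

Dual function: if `V N` does not tend to zero, let `f₀` be a weak limit, along an ultrafilter, of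
the averages of `τ (-p_m(n)) (star (V N) * ∏_{j ≠ m} τ (p_j(n)) f_j)`. Then `Λ (f₀ * f m)` is a
limit of `‖V N‖²` and is not zero, so `f₀` is nonzero in `L²`. Putting `star f₀` into slot `m`
leaves averages that do not vanish, so some seminorm of `f₀` is nonzero.

Degree lowering (`G_ne_zero_of_G_succ_ne_zero`): a nonzero seminorm of `f₀` of one order forces the
next lower one to be nonzero, down to `Λ f₀ ≠ 0`. Large higher-order seminorms mean that cube
products of `f₀` correlate with eigenfunctions. Because `f₀` is a dual function,
Gowers–Cauchy–Schwarz compares these eigenfunctions at different vertices. Nontrivial combinations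
of them drop out, since averages with an eigenfunction in slot `m` are covered by the induction
hypothesis; the trivial ones are scalars, and removing them leaves a lower-order norm of `f₀`.

Contradiction: the induction hypothesis with the constant `1` in slot `m` also evaluates `Λ f₀`
directly, and gives zero (`multiConv_of_Λ_eq_zero`).

The link between second-order seminorms and eigenfunctions is spectral. The second-order seminorm is
a quadratic form of a compact self-adjoint operator commuting with the action, and a
finite-dimensional eigenspace of that operator contains joint eigenvectors
(`IsFolnerSequence.exists_eigenvector`). The argument up to the conclusion is run in an abstract
`*`-algebra, `KoopmanSystem`, so that identities hold exactly and not merely almost everywhere. -/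

open Filter Topology MeasureTheory

/-! ### Averages over finite sets -/

section Averages

/-- The average of `f` over the finite set `H`. -/
noncomputable def avg (𝕜 : Type*) {ι E : Type*} [Field 𝕜] [AddCommMonoid E] [Module 𝕜 E]
    (H : Finset ι) (f : ι → E) : E :=
  (H.card : 𝕜)⁻¹ • ∑ i ∈ H, f i

variable {𝕜 ι κ E E' : Type*}

section Algebra

variable [Field 𝕜] [AddCommGroup E] [Module 𝕜 E] [AddCommGroup E'] [Module 𝕜 E']

theorem avg_add (H : Finset ι) (f g : ι → E) :
    avg 𝕜 H (fun i => f i + g i) = avg 𝕜 H f + avg 𝕜 H g := by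
  simp [avg, Finset.sum_add_distrib]

theorem avg_sub (H : Finset ι) (f g : ι → E) :
    avg 𝕜 H (fun i => f i - g i) = avg 𝕜 H f - avg 𝕜 H g := by
  simp [avg, Finset.sum_sub_distrib, smul_sub]

theorem avg_smul (H : Finset ι) (c : 𝕜) (f : ι → E) :
    avg 𝕜 H (fun i => c • f i) = c • avg 𝕜 H f := by
  simp only [avg, ← Finset.smul_sum, smul_comm c]

theorem avg_mul_left (H : Finset ι) (c : 𝕜) (f : ι → 𝕜) :
    avg 𝕜 H (fun i => c * f i) = c * avg 𝕜 H f := avg_smul H c f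

theorem avg_sum (H : Finset ι) (T : Finset κ) (f : κ → ι → E) :
    avg 𝕜 H (fun i => ∑ j ∈ T, f j i) = ∑ j ∈ T, avg 𝕜 H (f j) := by
  simp only [avg, ← Finset.smul_sum]
  rw [Finset.sum_comm]

theorem avg_comm (H : Finset ι) (T : Finset κ) (f : ι → κ → E) :
    avg 𝕜 H (fun i => avg 𝕜 T (f i)) = avg 𝕜 T (fun j => avg 𝕜 H (fun i => f i j)) := by
  simp only [avg, ← Finset.smul_sum]
  rw [Finset.sum_comm, smul_comm]

theorem map_avg {L : Type*} [FunLike L E E'] [LinearMapClass L 𝕜 E E'] (T : L)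
    (H : Finset ι) (f : ι → E) : T (avg 𝕜 H f) = avg 𝕜 H (fun i => T (f i)) := by
  simp [avg, map_smul, map_sum]

theorem avg_const [CharZero 𝕜] {H : Finset ι} (hH : H.Nonempty) (c : E) :
    avg 𝕜 H (fun _ => c) = c := by
  have : (H.card : 𝕜) ≠ 0 := by exact_mod_cast hH.card_pos.ne'
  rw [avg, Finset.sum_const, ← Nat.cast_smul_eq_nsmul 𝕜, smul_smul, inv_mul_cancel₀ this, one_smul]

theorem avg_congr {H : Finset ι} {f g : ι → E} (h : ∀ i ∈ H, f i = g i) :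
    avg 𝕜 H f = avg 𝕜 H g := by
  rw [avg, avg, Finset.sum_congr rfl h]

theorem avg_image [DecidableEq κ] (H : Finset ι) {e : ι → κ} (he : Function.Injective e)
    (f : κ → E) : avg 𝕜 (H.image e) f = avg 𝕜 H (fun i => f (e i)) := by
  rw [avg, avg, Finset.card_image_of_injective _ he, Finset.sum_image he.injOn]

end Algebra

section Real

variable {H : Finset ι} {f g : ι → ℝ}

theorem avg_le_avg (h : ∀ i ∈ H, f i ≤ g i) : avg ℝ H f ≤ avg ℝ H g := by
  simp only [avg, smul_eq_mul]
  have := Finset.sum_le_sum h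
  gcongr

theorem avg_nonneg (h : ∀ i ∈ H, 0 ≤ f i) : 0 ≤ avg ℝ H f := by
  simp only [avg, smul_eq_mul]
  have := Finset.sum_nonneg h
  positivity

theorem avg_le_of_le {c : ℝ} (hH : H.Nonempty) (h : ∀ i ∈ H, f i ≤ c) : avg ℝ H f ≤ c :=
  (avg_le_avg h).trans_eq (avg_const hH c)

theorem exists_le_of_le_avg {c : ℝ} (hH : H.Nonempty) (h : c ≤ avg ℝ H f) :
    ∃ i ∈ H, c ≤ f i := by
  by_contra! hc
  have h1 : ∑ i ∈ H, f i < ∑ _i ∈ H, c := Finset.sum_lt_sum_of_nonempty hH hc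
  have h2 : (0 : ℝ) < H.card := by exact_mod_cast hH.card_pos
  have h3 : avg ℝ H f < c := by
    rw [← avg_const (𝕜 := ℝ) hH c]
    simp only [avg, smul_eq_mul]
    gcongr
  linarith

theorem pow_avg_le_avg_pow (h : ∀ i ∈ H, 0 ≤ f i) {n : ℕ} (hn : n ≠ 0) :
    avg ℝ H f ^ n ≤ avg ℝ H (fun i => f i ^ n) := by
  rcases H.eq_empty_or_nonempty with rfl | hH
  · simp [avg, hn]
  have h2 : (H.card : ℝ) ≠ 0 := by exact_mod_cast hH.card_pos.ne'
  have := Real.pow_arith_mean_le_arith_mean_pow H (fun _ => (H.card : ℝ)⁻¹) f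
    (fun _ _ => by positivity) (by simp [h2]) h n
  simpa [avg, Finset.mul_sum] using this

theorem norm_avg_le [RCLike 𝕜] [SeminormedAddCommGroup E] [NormedSpace 𝕜 E] (H : Finset ι)
    (f : ι → E) : ‖avg 𝕜 H f‖ ≤ avg ℝ H (fun i => ‖f i‖) := by
  simp only [avg, norm_smul, norm_inv, RCLike.norm_natCast, smul_eq_mul]
  gcongr
  exact norm_sum_le _ _

theorem norm_avg_le_of_le [RCLike 𝕜] [SeminormedAddCommGroup E] [NormedSpace 𝕜 E] {H : Finset ι}
    {f : ι → E} {c : ℝ} (hc : 0 ≤ c) (h : ∀ i ∈ H, ‖f i‖ ≤ c) : ‖avg 𝕜 H f‖ ≤ c := by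
  rcases H.eq_empty_or_nonempty with rfl | hH
  · simpa [avg] using hc
  exact (norm_avg_le H f).trans (avg_le_of_le hH h)

theorem re_avg [RCLike 𝕜] (H : Finset ι) (f : ι → 𝕜) :
    RCLike.re (avg 𝕜 H f) = avg ℝ H (fun i => RCLike.re (f i)) := by
  simp only [avg, smul_eq_mul]
  rw [← map_sum, show ((H.card : 𝕜)⁻¹) = (((H.card : ℝ)⁻¹ : ℝ) : 𝕜) by simp, RCLike.re_ofReal_mul]

end Real

end Averages

/-! ### Upper bounds on limits superior -/

section LimLe

/-- `limsup a ≤ c`, phrased without boundedness conditions. -/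
def LimLe (a : ℕ → ℝ) (c : ℝ) : Prop := ∀ ε > 0, ∀ᶠ N in atTop, a N ≤ c + ε

variable {a b : ℕ → ℝ} {c d : ℝ}

theorem LimLe.mono (h : LimLe a c) (hab : ∀ N, b N ≤ a N) (hcd : c ≤ d) : LimLe b d :=
  fun ε hε => (h ε hε).mono fun N hN => by linarith [hab N]

theorem LimLe.of_le (h : ∀ N, a N ≤ c) : LimLe a c :=
  fun ε hε => Eventually.of_forall fun N => by linarith [h N]

theorem LimLe.add (ha : LimLe a c) (hb : LimLe b d) : LimLe (fun N => a N + b N) (c + d) :=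
  fun ε hε => ((ha (ε / 2) (by positivity)).and (hb (ε / 2) (by positivity))).mono
    fun N hN => by linarith [hN.1, hN.2]

theorem LimLe.of_tendsto (h : Tendsto a atTop (𝓝 c)) : LimLe a c :=
  fun ε hε => (h.eventually_lt_const (show c < c + ε by linarith)).mono fun _ h => h.le

theorem LimLe.const_mul (ha : LimLe a c) {r : ℝ} (hr : 0 ≤ r) :
    LimLe (fun N => r * a N) (r * c) := by
  intro ε hε
  refine (ha (ε / (r + 1)) (by positivity)).mono fun N hN => ?_
  have : r * (ε / (r + 1)) ≤ ε := by
    rw [mul_div_assoc', div_le_iff₀ (by positivity)]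
    nlinarith
  nlinarith [mul_le_mul_of_nonneg_left hN hr]

theorem LimLe.sum {ι : Type*} (H : Finset ι) {a : ι → ℕ → ℝ} {c : ι → ℝ}
    (h : ∀ i ∈ H, LimLe (a i) (c i)) : LimLe (fun N => ∑ i ∈ H, a i N) (∑ i ∈ H, c i) := by
  classical
  induction H using Finset.induction_on with
  | empty => exact LimLe.of_le (by simp)
  | insert i H hi ih =>
    simp only [Finset.sum_insert hi]
    exact (h i (by simp)).add (ih fun j hj => h j (by simp [hj]))

theorem LimLe.of_forall_pos (h : ∀ ε > 0, LimLe a (c + ε)) : LimLe a c := by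
  intro ε hε
  exact (h (ε / 2) (by positivity) (ε / 2) (by positivity)).mono fun N hN => by linarith

theorem LimLe.pow (ha : LimLe a c) (h0 : ∀ N, 0 ≤ a N) (n : ℕ) :
    LimLe (fun N => a N ^ n) (c ^ n) := by
  have hc : 0 ≤ c := by
    by_contra! hc
    obtain ⟨N, hN⟩ := (ha (-c / 2) (by linarith)).exists
    linarith [h0 N]
  intro ε hε
  have : Tendsto (fun δ : ℝ => (c + δ) ^ n) (𝓝[>] 0) (𝓝 ((c + 0) ^ n)) :=
    tendsto_nhdsWithin_of_tendsto_nhds ((by fun_prop : Continuous fun δ : ℝ => (c + δ) ^ n).tendsto 0)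
  rw [add_zero] at this
  obtain ⟨δ, h1, h2⟩ := ((this.eventually_lt_const (show c ^ n < c ^ n + ε by linarith)).and
    self_mem_nhdsWithin).exists
  exact (ha δ h2).mono fun N hN => (pow_le_pow_left₀ (h0 N) hN n).trans h1.le

theorem LimLe.tendsto_zero (ha : LimLe a 0) (h0 : ∀ N, 0 ≤ a N) : Tendsto a atTop (𝓝 0) := by
  rw [Metric.tendsto_atTop']
  intro ε hε
  obtain ⟨N, hN⟩ := eventually_atTop.1 (ha (ε / 2) (by positivity))
  refine ⟨N, fun n hn => ?_⟩
  rw [Real.dist_eq, sub_zero, abs_of_nonneg (h0 n)]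
  linarith [hN n hn.le]

end LimLe

/-! ### Følner averages and van der Corput's inequality -/

section Folner

variable {F : Type*} [AddCommGroup F] [DecidableEq F] {Φ : ℕ → Finset F}
variable {𝕜 E : Type*} [RCLike 𝕜]

/-- The two sums cancel on the intersection of the set with its translate, so only the symmetric
difference contributes. -/
theorem IsFolnerSequence.norm_avg_shift_sub_le [SeminormedAddCommGroup E] [NormedSpace 𝕜 E]
    (H : Finset F) {v : F → E} {C : ℝ} (hv : ∀ n, ‖v n‖ ≤ C) (g : F) :
    ‖avg 𝕜 H (fun n => v (n + g)) - avg 𝕜 H v‖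
      ≤ C * (((symmDiff H (H.image fun x => g + x)).card : ℝ) / (H.card : ℝ)) := by
  have h1 : ∑ n ∈ H, v (n + g) = ∑ n ∈ H.image (fun x => g + x), v n := by
    rw [Finset.sum_image (add_right_injective g).injOn]
    simp [add_comm]
  set H' := H.image (fun x => g + x)
  have h2 : ∑ n ∈ H', v n - ∑ n ∈ H, v n = ∑ n ∈ H' \ H, v n - ∑ n ∈ H \ H', v n := by
    rw [← Finset.sum_sdiff (Finset.inter_subset_left : H' ∩ H ⊆ H'),
      ← Finset.sum_sdiff (Finset.inter_subset_right : H' ∩ H ⊆ H)]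
    simp only [Finset.sdiff_inter_self_left, Finset.sdiff_inter_self_right]
    abel
  have h3 : ‖∑ n ∈ H', v n - ∑ n ∈ H, v n‖ ≤ C * (symmDiff H H').card := by
    rw [h2]
    have hd : Disjoint (H \ H') (H' \ H) := disjoint_sdiff_sdiff
    have hc : (symmDiff H H').card = (H \ H').card + (H' \ H).card := by
      rw [symmDiff_def, Finset.sup_eq_union, Finset.card_union_of_disjoint hd]
    calc _ ≤ ‖∑ n ∈ H' \ H, v n‖ + ‖∑ n ∈ H \ H', v n‖ := norm_sub_le _ _
      _ ≤ (H' \ H).card * C + (H \ H').card * C := by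
        gcongr
        · exact (norm_sum_le_of_le _ fun i _ => hv i).trans (by simp)
        · exact (norm_sum_le_of_le _ fun i _ => hv i).trans (by simp)
      _ = _ := by rw [hc]; push_cast; ring
  rw [avg, avg, h1, ← smul_sub, norm_smul, norm_inv, RCLike.norm_natCast]
  calc _ ≤ (H.card : ℝ)⁻¹ * (C * (symmDiff H H').card) := by gcongr
    _ = _ := by ring

theorem IsFolnerSequence.tendsto_avg_shift_sub [SeminormedAddCommGroup E] [NormedSpace 𝕜 E]
    (hΦ : IsFolnerSequence Φ) {v : F → E} {C : ℝ} (hv : ∀ n, ‖v n‖ ≤ C) (g : F) :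
    Tendsto (fun N => avg 𝕜 (Φ N) (fun n => v (n + g)) - avg 𝕜 (Φ N) v) atTop (𝓝 0) := by
  refine squeeze_zero_norm (fun N => norm_avg_shift_sub_le (Φ N) hv g) ?_
  simpa using (hΦ.tendsto_symmDiff g).const_mul C

variable [NormedAddCommGroup E] [InnerProductSpace 𝕜 E]

/-- The van der Corput inequality with weights. -/
theorem IsFolnerSequence.vanDerCorput_weighted (hΦ : IsFolnerSequence Φ) {v : F → E} {C : ℝ}
    (hv : ∀ n, ‖v n‖ ≤ C) (H : Finset F) (c : F → ℝ) (hc : ∑ h ∈ H, c h = 1) (a : F → F → ℝ)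
    (ha : ∀ h ∈ H, ∀ h' ∈ H, LimLe (fun N => c h * c h' *
      RCLike.re (avg 𝕜 (Φ N) fun n => inner 𝕜 (v (n + h)) (v (n + h')))) (a h h')) :
    LimLe (fun N => ‖avg 𝕜 (Φ N) v‖ ^ 2) (∑ h ∈ H, ∑ h' ∈ H, a h h') := by
  have hC : 0 ≤ C := (norm_nonneg _).trans (hv 0)
  -- As the weights sum to one, replacing `v` by its smoothed version `w` changes Følner averages by
  -- `o(1)`. Convexity then moves the square inside the average, and expanding `‖w n‖²` produces the
  -- correlations.
  let w : F → E := fun n => ∑ h ∈ H, (c h : 𝕜) • v (n + h)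
  have hw : ∀ N, avg 𝕜 (Φ N) w = ∑ h ∈ H, (c h : 𝕜) • avg 𝕜 (Φ N) (fun n => v (n + h)) := by
    intro N
    simp only [w, avg_sum, avg_smul]
  have hwv : Tendsto (fun N => avg 𝕜 (Φ N) w - avg 𝕜 (Φ N) v) atTop (𝓝 0) := by
    have h1 : ∀ N, avg 𝕜 (Φ N) w - avg 𝕜 (Φ N) v
        = ∑ h ∈ H, (c h : 𝕜) • (avg 𝕜 (Φ N) (fun n => v (n + h)) - avg 𝕜 (Φ N) v) := by
      intro N
      simp only [hw, smul_sub, Finset.sum_sub_distrib, ← Finset.sum_smul]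
      rw [← RCLike.ofReal_sum, hc, RCLike.ofReal_one, one_smul]
    simp only [h1]
    rw [show (0 : E) = ∑ h ∈ H, (c h : 𝕜) • (0 : E) by simp]
    exact tendsto_finsetSum _ fun h _ => (hΦ.tendsto_avg_shift_sub hv h).const_smul _
  have hwb : ∀ n, ‖w n‖ ≤ (∑ h ∈ H, |c h|) * C := by
    intro n
    rw [Finset.sum_mul]
    refine norm_sum_le_of_le _ fun h _ => ?_
    rw [norm_smul, RCLike.norm_ofReal]
    gcongr
    exact hv _
  have hsq : ∀ N, ‖avg 𝕜 (Φ N) w‖ ^ 2 ≤ ∑ h ∈ H, ∑ h' ∈ H, c h * c h' *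
      RCLike.re (avg 𝕜 (Φ N) fun n => inner 𝕜 (v (n + h)) (v (n + h'))) := by
    intro N
    have h1 : avg ℝ (Φ N) (fun n => ‖w n‖ ^ 2) = ∑ h ∈ H, ∑ h' ∈ H, c h * c h' *
        RCLike.re (avg 𝕜 (Φ N) fun n => inner 𝕜 (v (n + h)) (v (n + h'))) := by
      simp only [re_avg, ← avg_mul_left, ← avg_sum]
      refine avg_congr fun n _ => ?_
      rw [← inner_self_eq_norm_sq (𝕜 := 𝕜)]
      simp only [w, sum_inner, inner_sum, inner_smul_left, inner_smul_right, map_sum,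
        RCLike.conj_ofReal, RCLike.re_ofReal_mul]
      simp only [Finset.mul_sum, mul_assoc]
      rw [Finset.sum_comm]
      exact Finset.sum_congr rfl fun i _ => Finset.sum_congr rfl fun j _ => by ring
    rw [← h1]
    calc _ ≤ (avg ℝ (Φ N) fun n => ‖w n‖) ^ 2 := by
          gcongr
          exact norm_avg_le _ _
      _ ≤ _ := pow_avg_le_avg_pow (fun _ _ => norm_nonneg _) two_ne_zero
  have hdiff : Tendsto (fun N => ‖avg 𝕜 (Φ N) v‖ ^ 2 - ‖avg 𝕜 (Φ N) w‖ ^ 2) atTop (𝓝 0) := by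
    set D := (∑ h ∈ H, |c h|) * C
    have hD : 0 ≤ D := by positivity
    refine squeeze_zero_norm (a := fun N => ‖avg 𝕜 (Φ N) w - avg 𝕜 (Φ N) v‖ * (C + D))
      (fun N => ?_) ?_
    · rw [sq_sub_sq, norm_mul, mul_comm]
      gcongr
      · rw [Real.norm_eq_abs, abs_sub_comm]
        exact abs_norm_sub_norm_le _ _
      · rw [Real.norm_eq_abs, abs_of_nonneg (by positivity)]
        exact add_le_add (norm_avg_le_of_le hC fun n _ => hv n)
          (norm_avg_le_of_le hD fun n _ => hwb n)
    · simpa using hwv.norm.mul_const (C + D)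
  have := (LimLe.of_tendsto hdiff).add (LimLe.sum H fun h hh => LimLe.sum H fun h' hh' =>
    ha h hh h' hh')
  refine this.mono (fun N => ?_) (by simp)
  linarith [hsq N]

/-- The van der Corput inequality. -/
theorem IsFolnerSequence.vanDerCorput (hΦ : IsFolnerSequence Φ) {v : F → E} {C : ℝ}
    (hv : ∀ n, ‖v n‖ ≤ C) {H : Finset F} (hH : H.Nonempty) (a : F → F → ℝ)
    (ha : ∀ h ∈ H, ∀ h' ∈ H, LimLe (fun N =>
      ‖avg 𝕜 (Φ N) fun n => inner 𝕜 (v (n + h)) (v (n + h'))‖) (a h h')) :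
    LimLe (fun N => ‖avg 𝕜 (Φ N) v‖ ^ 2) (avg ℝ H fun h => avg ℝ H fun h' => a h h') := by
  have hc : (H.card : ℝ) ≠ 0 := by exact_mod_cast hH.card_pos.ne'
  have := hΦ.vanDerCorput_weighted hv H (fun _ => (H.card : ℝ)⁻¹) (by simp [hc])
    (fun h h' => (H.card : ℝ)⁻¹ * (H.card : ℝ)⁻¹ * a h h') (fun h hh h' hh' =>
      ((ha h hh h' hh').mono (b := fun N => RCLike.re
        (avg 𝕜 (Φ N) fun n => inner 𝕜 (v (n + h)) (v (n + h'))))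
        (fun N => RCLike.re_le_norm _) le_rfl).const_mul (by positivity))
  refine this.mono (fun _ => le_rfl) (le_of_eq ?_)
  simp only [avg, smul_eq_mul, Finset.mul_sum, mul_assoc]

end Folner

/-! ### Invariant positive semidefinite kernels on the group -/

section PositiveDefinite

/-- A real positive semidefinite kernel is a Gram kernel. -/
theorem Matrix.PosSemidef.exists_feature_map.{u} {ι : Type u} {K : Matrix ι ι ℝ}
    (hK : K.PosSemidef) : ∃ (E : Type u) (_ : NormedAddCommGroup E) (_ : InnerProductSpace ℝ E) (v : ι → E),
      ∀ i j, inner ℝ (v i) (v j) = K i j := by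
  -- Reproducing kernel Hilbert spaces take operator-valued kernels, so each scalar is read as an
  -- operator on `ℝ`.
  let K' : Matrix ι ι (ℝ →L[ℝ] ℝ) := Matrix.of fun i j => K i j • ContinuousLinearMap.id ℝ ℝ
  have hK' : K'.PosSemidef := by
    have h := (RKHS.posSemidef_tfae (K := K')).out 0 2
    refine h.2 ⟨?_, fun vv => ?_⟩
    · ext i j
      have := hK.1.apply i j
      simp only [star_trivial] at this
      simp [K', Matrix.conjTranspose_apply, this, ContinuousLinearMap.star_eq_adjoint,
        ContinuousLinearMap.adjoint_id]
    · have := hK.2 vv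
      simp only [star_trivial] at this
      rw [Finsupp.sum_comm]
      simpa [K', mul_assoc, mul_comm, mul_left_comm] using this
  have : Fact K'.PosSemidef := ⟨hK'⟩
  refine ⟨RKHS.OfKernel K', inferInstance, inferInstance,
    fun i => RKHS.kerFun (RKHS.OfKernel K') i 1, fun i j => ?_⟩
  rw [← RKHS.kernel_inner, RKHS.OfKernel.kernel_ofKernel]
  simp [K']
  simpa using hK.1.apply i j

variable {F : Type*} [AddCommGroup F] [DecidableEq F] {Φ : ℕ → Finset F}

/-- Write `K h h'` as an inner product of vectors `v h`, `v h'`. The double average is then the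
squared norm of an average of `v`, and by invariance the correlations in van der Corput's inequality
do not depend on `n`. Consequently every finite set bounds the limit superior. -/
theorem IsFolnerSequence.limLe_avg_kernel (hΦ : IsFolnerSequence Φ) {K : Matrix F F ℝ}
    (hK : K.PosSemidef) (hinv : ∀ g h h', K (g + h) (g + h') = K h h')
    (H : Finset F) (c : F → ℝ) (hc : ∑ h ∈ H, c h = 1) :
    LimLe (fun N => avg ℝ (Φ N) fun h => avg ℝ (Φ N) fun h' => K h h')
      (∑ h ∈ H, ∑ h' ∈ H, c h * c h' * K h h') := by
  obtain ⟨E, _, _, v, hv⟩ := hK.exists_feature_map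
  have hvC : ∀ n, ‖v n‖ ≤ ‖v 0‖ := by
    intro n
    rw [← sq_le_sq₀ (norm_nonneg _) (norm_nonneg _), ← real_inner_self_eq_norm_sq,
      ← real_inner_self_eq_norm_sq, hv, hv]
    simpa using (hinv n 0 0).le
  have := hΦ.vanDerCorput_weighted (𝕜 := ℝ) hvC H c hc (fun h h' => c h * c h' * K h h')
    (fun h _ h' _ => by
      refine LimLe.of_le fun N => le_of_eq ?_
      simp only [hv, hinv]
      rw [avg_const (hΦ.nonempty N)]
      rfl)
  refine this.mono (fun N => le_of_eq ?_) le_rfl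
  rw [← real_inner_self_eq_norm_sq]
  simp only [← hv, avg, sum_inner, inner_sum, inner_smul_left, inner_smul_right, smul_eq_mul,
    Finset.mul_sum, map_inv₀, conj_trivial]
  rw [Finset.sum_comm]

/-- Averages of an invariant positive semidefinite kernel converge along any Følner sequence, to
the infimum over all finite sets. -/
theorem IsFolnerSequence.tendsto_avg_kernel (hΦ : IsFolnerSequence Φ) {K : Matrix F F ℝ}
    (hK : K.PosSemidef) (hinv : ∀ g h h', K (g + h) (g + h') = K h h')
    (hnn : BddBelow (Set.range fun H : {H : Finset F // H.Nonempty} =>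
      avg ℝ H.1 fun h => avg ℝ H.1 fun h' => K h h')) :
    Tendsto (fun N => avg ℝ (Φ N) fun h => avg ℝ (Φ N) fun h' => K h h') atTop
      (𝓝 (⨅ H : {H : Finset F // H.Nonempty}, avg ℝ H.1 fun h => avg ℝ H.1 fun h' => K h h')) := by
  set ℓ := ⨅ H : {H : Finset F // H.Nonempty}, avg ℝ H.1 fun h => avg ℝ H.1 fun h' => K h h'
  have h1 : ∀ N, ℓ ≤ avg ℝ (Φ N) fun h => avg ℝ (Φ N) fun h' => K h h' :=
    fun N => ciInf_le hnn ⟨Φ N, hΦ.nonempty N⟩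
  have : Nonempty {H : Finset F // H.Nonempty} := ⟨⟨Φ 0, hΦ.nonempty 0⟩⟩
  have h2 : LimLe (fun N => avg ℝ (Φ N) fun h => avg ℝ (Φ N) fun h' => K h h') ℓ := by
    refine LimLe.of_forall_pos fun ε hε => ?_
    obtain ⟨⟨H, hH⟩, hlt⟩ := exists_lt_of_ciInf_lt (show ℓ < ℓ + ε by linarith)
    have hc : (H.card : ℝ) ≠ 0 := by exact_mod_cast hH.card_pos.ne'
    refine (hΦ.limLe_avg_kernel hK hinv H (fun _ => (H.card : ℝ)⁻¹) (by simp [hc])).mono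
      (fun _ => le_rfl) (le_trans (le_of_eq ?_) hlt.le)
    simp only [avg, smul_eq_mul, Finset.mul_sum, mul_assoc]
  have h3 : Tendsto (fun N => (avg ℝ (Φ N) fun h => avg ℝ (Φ N) fun h' => K h h') - ℓ) atTop
      (𝓝 0) := by
    refine LimLe.tendsto_zero ?_ fun N => by linarith [h1 N]
    intro ε hε
    exact (h2 ε hε).mono fun N hN => by linarith
  simpa using h3.add_const ℓ

end PositiveDefinite

/-! ### Koopman systems and the uniformity seminorms -/

/-- A `*`-algebraic model of a measure preserving action of `F`: a commutative `*`-algebra `A` of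
bounded functions with an action `τ`, an invariant integral `Λ`, and a map `ι` to an `L²` space. -/
structure KoopmanSystem (F A E : Type*) [AddCommGroup F] [CommRing A] [StarRing A] [Algebra ℂ A]
    [StarModule ℂ A] [NormedAddCommGroup E] [InnerProductSpace ℂ E] where
  τ : F → A →⋆ₐ[ℂ] A
  Λ : A →ₗ[ℂ] ℂ
  ι : A →ₗ[ℂ] E
  inner_ι : ∀ a b, inner ℂ (ι a) (ι b) = Λ (star a * b)
  τ_add : ∀ g h a, τ (g + h) a = τ g (τ h a)
  τ_zero : ∀ a, τ 0 a = a
  Λ_τ : ∀ g a, Λ (τ g a) = Λ a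
  Λ_star : ∀ a, Λ (star a) = star (Λ a)
  Λ_one : Λ 1 = 1

namespace KoopmanSystem

variable {F A E : Type*} [AddCommGroup F] [CommRing A] [StarRing A] [Algebra ℂ A]
    [StarModule ℂ A] [NormedAddCommGroup E] [InnerProductSpace ℂ E] (S : KoopmanSystem F A E)

theorem τ_comm (g h : F) (a : A) : S.τ g (S.τ h a) = S.τ h (S.τ g a) := by
  rw [← S.τ_add, ← S.τ_add, add_comm]

theorem τ_neg_τ (g : F) (a : A) : S.τ (-g) (S.τ g a) = a := by
  rw [← S.τ_add, neg_add_cancel, S.τ_zero]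

theorem τ_τ_neg (g : F) (a : A) : S.τ g (S.τ (-g) a) = a := by
  rw [← S.τ_add, add_neg_cancel, S.τ_zero]

theorem norm_ι_sq (a : A) : (‖S.ι a‖ : ℂ) ^ 2 = S.Λ (star a * a) := by
  rw [← S.inner_ι, inner_self_eq_norm_sq_to_K]
  rfl

theorem norm_ι_eq {a b : A} (h : star a * a = star b * b) : ‖S.ι a‖ = ‖S.ι b‖ := by
  have : (‖S.ι a‖ : ℂ) ^ 2 = (‖S.ι b‖ : ℂ) ^ 2 := by rw [norm_ι_sq, norm_ι_sq, h]
  exact (sq_eq_sq₀ (norm_nonneg _) (norm_nonneg _)).1 (by exact_mod_cast this)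

theorem norm_ι_τ (g : F) (a : A) : ‖S.ι (S.τ g a)‖ = ‖S.ι a‖ := by
  have : (‖S.ι (S.τ g a)‖ : ℂ) ^ 2 = (‖S.ι a‖ : ℂ) ^ 2 := by
    rw [norm_ι_sq, norm_ι_sq, ← map_star, ← map_mul, S.Λ_τ]
  exact (sq_eq_sq₀ (norm_nonneg _) (norm_nonneg _)).1 (by exact_mod_cast this)

theorem norm_ι_star (a : A) : ‖S.ι (star a)‖ = ‖S.ι a‖ :=
  S.norm_ι_eq (by rw [star_star, mul_comm])

theorem norm_ι_one : ‖S.ι 1‖ = 1 := by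
  have : (‖S.ι 1‖ : ℂ) ^ 2 = 1 := by rw [norm_ι_sq, star_one, one_mul, S.Λ_one]
  have h : ‖S.ι 1‖ ^ 2 = 1 := by exact_mod_cast this
  exact (sq_eq_sq₀ (norm_nonneg _) zero_le_one).1 (by rw [h, one_pow])

/-- Multiplication by `a` does not increase `L²` norms. -/
def Contr (a : A) : Prop := ∀ b, ‖S.ι (a * b)‖ ≤ ‖S.ι b‖

namespace Contr

variable {S} {a b : A}

theorem one : S.Contr 1 := fun b => by rw [one_mul]

theorem mul (ha : S.Contr a) (hb : S.Contr b) : S.Contr (a * b) := fun c => by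
  rw [mul_assoc]
  exact (ha _).trans (hb c)

theorem star (ha : S.Contr a) : S.Contr (star a) := fun c => by
  refine le_trans (le_of_eq (S.norm_ι_eq ?_)) (ha c)
  simp only [star_mul, star_star]
  ring

theorem τ (ha : S.Contr a) (g : F) : S.Contr (S.τ g a) := fun c => by
  rw [← S.τ_τ_neg g c, ← map_mul, norm_ι_τ, norm_ι_τ]
  exact ha _

theorem smul (ha : S.Contr a) {c : ℂ} (hc : ‖c‖ ≤ 1) : S.Contr (c • a) := fun b => by
  rw [smul_mul_assoc, map_smul, norm_smul]
  calc _ ≤ 1 * ‖S.ι b‖ := by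
        gcongr
        exact ha b
    _ = _ := one_mul _

theorem multiset_prod {s : Multiset A} (h : ∀ a ∈ s, S.Contr a) : S.Contr s.prod := by
  induction s using Multiset.induction_on with
  | empty => simpa using one
  | cons a s ih =>
    rw [Multiset.prod_cons]
    exact (h a (by simp)).mul (ih fun b hb => h b (by simp [hb]))

theorem prod {κ : Type*} {s : Finset κ} {f : κ → A} (h : ∀ i ∈ s, S.Contr (f i)) :
    S.Contr (∏ i ∈ s, f i) :=
  multiset_prod (by simpa using h)

theorem norm_ι_le (ha : S.Contr a) : ‖S.ι a‖ ≤ 1 := by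
  simpa [S.norm_ι_one] using ha 1

/-- Cauchy–Schwarz. This is how integrals against a bounded factor are replaced by `L²` norms
throughout. -/
theorem norm_Λ_mul_le (ha : S.Contr a) (b : A) : ‖S.Λ (a * b)‖ ≤ ‖S.ι b‖ := by
  have : S.Λ (a * b) = inner ℂ (S.ι (Star.star a)) (S.ι b) := by rw [S.inner_ι, star_star]
  rw [this]
  calc _ ≤ ‖S.ι (Star.star a)‖ * ‖S.ι b‖ := norm_inner_le_norm _ _
    _ ≤ 1 * ‖S.ι b‖ := by
      gcongr
      exact ha.star.norm_ι_le
    _ = _ := one_mul _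

theorem norm_Λ_le (ha : S.Contr a) : ‖S.Λ a‖ ≤ 1 := by
  simpa [S.norm_ι_one] using ha.norm_Λ_mul_le 1

end Contr

/-- `G s f` is the `2 ^ (s + 1)`-th power of the Gowers–Host–Kra seminorm of `f` of order `s + 1`. -/
noncomputable def G : ℕ → A → ℝ
  | 0, f => ‖S.Λ f‖ ^ 2
  -- The infimum requires no choice of Følner sequence and bounds every finite average from below;
  -- `tendsto_avg_G` identifies it with the limit along any Følner sequence.
  | s + 1, f => ⨅ H : {H : Finset F // H.Nonempty},
      avg ℝ H.1 fun h => avg ℝ H.1 fun h' => G s (S.τ h f * star (S.τ h' f))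

theorem G_nonneg (s : ℕ) (f : A) : 0 ≤ S.G s f := by
  induction s generalizing f with
  | zero => exact sq_nonneg _
  | succ s ih => exact Real.iInf_nonneg fun H => avg_nonneg fun _ _ => avg_nonneg fun _ _ => ih _

theorem bddBelow_avg_G (s : ℕ) (f : A) :
    BddBelow (Set.range fun H : {H : Finset F // H.Nonempty} =>
      avg ℝ H.1 fun h => avg ℝ H.1 fun h' => S.G s (S.τ h f * star (S.τ h' f))) :=
  ⟨0, by
    rintro _ ⟨H, rfl⟩
    exact avg_nonneg fun _ _ => avg_nonneg fun _ _ => S.G_nonneg _ _⟩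

theorem G_succ_le (s : ℕ) (f : A) {H : Finset F} (hH : H.Nonempty) :
    S.G (s + 1) f ≤ avg ℝ H fun h => avg ℝ H fun h' => S.G s (S.τ h f * star (S.τ h' f)) :=
  ciInf_le (S.bddBelow_avg_G s f) ⟨H, hH⟩

theorem exists_avg_G_lt (s : ℕ) (f : A) {c : ℝ} (hc : S.G (s + 1) f < c) :
    ∃ H : Finset F, H.Nonempty ∧
      (avg ℝ H fun h => avg ℝ H fun h' => S.G s (S.τ h f * star (S.τ h' f))) < c := by
  have : Nonempty {H : Finset F // H.Nonempty} := ⟨⟨{0}, by simp⟩⟩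
  obtain ⟨⟨H, hH⟩, hlt⟩ := exists_lt_of_ciInf_lt hc
  exact ⟨H, hH, hlt⟩

theorem G_τ (s : ℕ) (g : F) (f : A) : S.G s (S.τ g f) = S.G s f := by
  induction s generalizing f with
  | zero => simp only [G, S.Λ_τ]
  | succ s ih =>
    simp only [G]
    refine iInf_congr fun H => avg_congr fun h _ => avg_congr fun h' _ => ?_
    rw [S.τ_comm h g, S.τ_comm h' g, ← map_star, ← map_mul, ih]

theorem G_star (s : ℕ) (f : A) : S.G s (star f) = S.G s f := by
  induction s generalizing f with
  | zero => simp only [G, S.Λ_star, norm_star]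
  | succ s ih =>
    simp only [G]
    refine iInf_congr fun H => avg_congr fun h _ => avg_congr fun h' _ => ?_
    rw [← ih]
    simp [map_star, mul_comm]

-- Schur product theorem: `‖Λ (f * star g)‖²` is the entrywise product of a Gram matrix with its
-- transpose, which is its complex conjugate.
open scoped ComplexOrder in
theorem posSemidef_G_zero : (Matrix.of fun f g : A => S.G 0 (f * star g)).PosSemidef := by
  have h1 : (Matrix.gram ℂ fun f : A => S.ι (star f)).PosSemidef := by
    refine ⟨Matrix.isHermitian_gram _ _, fun x => ?_⟩
    have h : (x.sum fun i xi => x.sum fun j xj =>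
        star xi * Matrix.gram ℂ (fun f : A => S.ι (star f)) i j * xj)
        = inner ℂ (∑ i ∈ x.support, x i • S.ι (star i)) (∑ i ∈ x.support, x i • S.ι (star i)) := by
      simp only [Finsupp.sum, sum_inner, inner_sum, inner_smul_left, inner_smul_right,
        Matrix.gram_apply, RCLike.star_def, Finset.mul_sum]
      rw [Finset.sum_comm]
      exact Finset.sum_congr rfl fun i _ => Finset.sum_congr rfl fun j _ => by ring
    rw [h, inner_self_eq_norm_sq_to_K, ← RCLike.ofReal_pow]
    exact Complex.zero_le_real.2 (sq_nonneg _)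
  have h2 := h1.hadamard h1.transpose
  refine ⟨?_, fun x => ?_⟩
  · ext f g
    simp only [Matrix.conjTranspose_apply, Matrix.of_apply, star_trivial]
    rw [← G_star, star_mul, star_star]
  · have h3 := h2.2 (x.mapRange (fun t : ℝ => (t : ℂ)) (by simp))
    have h4 : ∀ f g : A, (Matrix.gram ℂ (fun f : A => S.ι (star f))).hadamard
        (Matrix.gram ℂ fun f : A => S.ι (star f)).transpose f g = ((S.G 0 (f * star g) : ℝ) : ℂ) := by
      intro f g
      simp only [Matrix.hadamard_apply, Matrix.transpose_apply, Matrix.gram_apply, G]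
      rw [← inner_conj_symm, RCLike.conj_mul, S.inner_ι, star_star, ← norm_star, ← S.Λ_star]
      simp [mul_comm]
    simp only [h4] at h3
    rw [Finsupp.sum_mapRange_index (by simp)] at h3
    simp only [Finsupp.sum_mapRange_index, mul_zero, implies_true,
      RCLike.star_def, Complex.conj_ofReal] at h3
    simp only [Finsupp.sum, ← Complex.ofReal_mul, ← Complex.ofReal_sum, Complex.zero_le_real] at h3
    simpa [Finsupp.sum] using h3

variable [DecidableEq F] {Φ : ℕ → Finset F}

/-- The kernel in `h, h'` is a submatrix of a positive semidefinite one, and it is translation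
invariant because `G s` is invariant under the action. -/
theorem tendsto_avg_G_of_posSemidef (hΦ : IsFolnerSequence Φ) {s : ℕ}
    (hs : (Matrix.of fun f g : A => S.G s (f * star g)).PosSemidef) (f : A) :
    Tendsto (fun N => avg ℝ (Φ N) fun h => avg ℝ (Φ N) fun h' =>
      S.G s (S.τ h f * star (S.τ h' f))) atTop (𝓝 (S.G (s + 1) f)) := by
  refine hΦ.tendsto_avg_kernel (K := Matrix.of fun h h' => S.G s (S.τ h f * star (S.τ h' f)))
    (hs.submatrix fun h => S.τ h f) (fun g h h' => ?_) (S.bddBelow_avg_G s f)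
  simp only [Matrix.of_apply]
  rw [S.τ_add, S.τ_add, ← map_star, ← map_mul, G_τ]

/-- An infimum need not preserve positivity but a limit does, so the induction has to alternate with
`tendsto_avg_G_of_posSemidef`. For fixed `h, h'` the element `τ h (f * star g) * star (τ h' (f *
star g))` factors as `F_f * star F_g` with `F_f = τ h f * star (τ h' f)`, so the previous order
applies before averaging. -/
theorem posSemidef_G (hΦ : IsFolnerSequence Φ) (s : ℕ) :
    (Matrix.of fun f g : A => S.G s (f * star g)).PosSemidef := by
  induction s with
  | zero => exact S.posSemidef_G_zero
  | succ s ih =>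
    refine ⟨?_, fun x => ?_⟩
    · ext f g
      simp only [Matrix.conjTranspose_apply, Matrix.of_apply, star_trivial]
      rw [← G_star, star_mul, star_star]
    · simp only [Finsupp.sum, Matrix.of_apply, star_trivial]
      refine ge_of_tendsto' (tendsto_finsetSum _ fun f _ => tendsto_finsetSum _ fun g _ =>
        ((S.tendsto_avg_G_of_posSemidef hΦ ih (f * star g)).const_mul (x f)).mul_const (x g))
        fun N => ?_
      have key : ∀ h h', 0 ≤ ∑ f ∈ x.support, ∑ g ∈ x.support, x f * S.G s
          (S.τ h (f * star g) * star (S.τ h' (f * star g))) * x g := by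
        intro h h'
        have := (ih.submatrix fun f => S.τ h f * star (S.τ h' f)).2 x
        simp only [Finsupp.sum, Matrix.of_apply, star_trivial, Matrix.submatrix_apply] at this
        refine this.trans_eq (Finset.sum_congr rfl fun f _ => Finset.sum_congr rfl fun g _ => ?_)
        congr 3
        simp only [map_mul, map_star, star_mul, star_star]
        ring
      refine (avg_nonneg (H := Φ N) fun h _ => avg_nonneg (H := Φ N) fun h' _ =>
        key h h').trans_eq ?_
      simp only [avg_sum]
      refine Finset.sum_congr rfl fun f _ => Finset.sum_congr rfl fun g _ => ?_
      simp only [avg_mul_left, mul_comm _ (x g)]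

theorem tendsto_avg_G (hΦ : IsFolnerSequence Φ) (s : ℕ) (f : A) :
    Tendsto (fun N => avg ℝ (Φ N) fun h => avg ℝ (Φ N) fun h' =>
      S.G s (S.τ h f * star (S.τ h' f))) atTop (𝓝 (S.G (s + 1) f)) :=
  S.tendsto_avg_G_of_posSemidef hΦ (S.posSemidef_G hΦ s) f

/-- Iterated averages of `q` over the cubes whose sides are in the finite sets in a list. -/
noncomputable def iterAvg (q : A → ℝ) : List (Finset F) → A → ℝ
  | [], f => q f
  | H :: L, f => avg ℝ H fun h => avg ℝ H fun h' => iterAvg q L (S.τ h f * star (S.τ h' f))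

omit [DecidableEq F] in
theorem G_le_iterAvg (k : ℕ) (L : List (Finset F)) (hL : ∀ H ∈ L, H.Nonempty) (f : A) :
    S.G (L.length + k) f ≤ S.iterAvg (S.G k) L f := by
  induction L generalizing f with
  | nil => simp [iterAvg]
  | cons H L ih =>
    rw [List.length_cons, add_right_comm]
    refine (S.G_succ_le _ f (hL H (by simp))).trans ?_
    exact avg_le_avg fun h _ => avg_le_avg fun h' _ => ih (fun H' hH' => hL H' (by simp [hH'])) _

/-- The sides of the cube must serve all intermediate differences at once. Convergence along `Φ`,
unlike an infimum, allows one index to be chosen for finitely many functions; the differences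
arising from that choice are again finite in number. -/
theorem exists_iterAvg_le (hΦ : IsFolnerSequence Φ) (r : ℕ) {T : Set A} (hT : T.Finite) {ε : ℝ}
    (hε : 0 < ε) : ∃ L : List (Finset F), L.length = r ∧ (∀ H ∈ L, H.Nonempty) ∧
      ∀ f ∈ T, S.iterAvg (S.G 0) L f ≤ S.G r f + ε := by
  induction r generalizing T ε with
  | zero => exact ⟨[], rfl, by simp, fun f _ => by simp [iterAvg, hε.le]⟩
  | succ r ih =>
    have h1 : ∀ f ∈ T, ∀ᶠ N in atTop, (avg ℝ (Φ N) fun h => avg ℝ (Φ N) fun h' =>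
        S.G r (S.τ h f * star (S.τ h' f))) ≤ S.G (r + 1) f + ε / 2 := fun f _ =>
      LimLe.of_tendsto (S.tendsto_avg_G hΦ r f) (ε / 2) (by positivity)
    obtain ⟨N, hN⟩ := ((eventually_all_finite hT).2 h1).exists
    have hT' : ((fun x : (A × F) × F => S.τ x.1.2 x.1.1 * star (S.τ x.2 x.1.1)) ''
        ((T ×ˢ (Φ N : Set F)) ×ˢ (Φ N : Set F))).Finite :=
      (((hT.prod (Φ N).finite_toSet).prod (Φ N).finite_toSet)).image _
    obtain ⟨L, hL1, hL2, hL3⟩ := ih hT' (half_pos hε)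
    refine ⟨Φ N :: L, by simp [hL1], ?_, fun f hf => ?_⟩
    · simpa using ⟨hΦ.nonempty N, hL2⟩
    · calc _ ≤ avg ℝ (Φ N) fun h => avg ℝ (Φ N) fun h' =>
            (S.G r (S.τ h f * star (S.τ h' f)) + ε / 2) := by
            refine avg_le_avg fun h hh => avg_le_avg fun h' hh' => hL3 _ ?_
            exact ⟨((f, h), h'), ⟨⟨hf, hh⟩, hh'⟩, rfl⟩
        _ = (avg ℝ (Φ N) fun h => avg ℝ (Φ N) fun h' =>
            S.G r (S.τ h f * star (S.τ h' f))) + ε / 2 := by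
            simp only [avg_add, avg_const (hΦ.nonempty N)]
        _ ≤ _ := by linarith [hN f hf]

end KoopmanSystem

/-! ### Averages along linear families -/

namespace KoopmanSystem

variable {F A E : Type*} [Field F] [CommRing A] [StarRing A] [Algebra ℂ A]
    [StarModule ℂ A] [NormedAddCommGroup E] [InnerProductSpace ℂ E] (S : KoopmanSystem F A E)

/-- The product of the functions `τ (c n) g` over a family of pairs `(c, g)`. -/
noncomputable def linProd (M : Multiset (F × A)) (n : F) : A :=
  (M.map fun q => S.τ (q.1 * n) q.2).prod

theorem linProd_add (M M' : Multiset (F × A)) (n : F) :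
    S.linProd (M + M') n = S.linProd M n * S.linProd M' n := by
  simp [linProd]

theorem linProd_cons (q : F × A) (M : Multiset (F × A)) (n : F) :
    S.linProd (q ::ₘ M) n = S.τ (q.1 * n) q.2 * S.linProd M n := by
  simp [linProd]

variable {S}

theorem Contr.linProd {M : Multiset (F × A)} (hM : ∀ q ∈ M, S.Contr q.2) (n : F) :
    S.Contr (S.linProd M n) := by
  refine Contr.multiset_prod fun a ha => ?_
  obtain ⟨q, hq, rfl⟩ := Multiset.mem_map.1 ha
  exact (hM q hq).τ _

variable (S)

/-- The linear family arising from a linear family `M` after one application of van der Corput's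
inequality and a change of variables. -/
noncomputable def linDiff (c₁ h h' : F) (M : Multiset (F × A)) : Multiset (F × A) :=
  M.map fun q => (q.1 - c₁, star (S.τ (q.1 * h) q.2) * S.τ (q.1 * h') q.2)

theorem linDiff_cons (c₁ h h' : F) (q : F × A) (M : Multiset (F × A)) :
    S.linDiff c₁ h h' (q ::ₘ M)
      = (q.1 - c₁, star (S.τ (q.1 * h) q.2) * S.τ (q.1 * h') q.2) ::ₘ S.linDiff c₁ h h' M := by
  simp [linDiff]

/-- The common translation by `c₁ * n` disappears under the invariant integral, so one of the
coefficients can be made zero for free. -/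
theorem star_linProd_mul (c₁ h h' : F) (M : Multiset (F × A)) (n : F) :
    star (S.linProd M (n + h)) * S.linProd M (n + h')
      = S.τ (c₁ * n) (S.linProd (S.linDiff c₁ h h' M) n) := by
  induction M using Multiset.induction_on with
  | empty => simp [linProd, linDiff]
  | cons q M ih =>
    rw [linDiff_cons, linProd_cons, linProd_cons, linProd_cons, map_mul, ← ih, map_mul, map_mul,
      map_star, map_star]
    simp only [← S.τ_add, star_mul]
    rw [show c₁ * n + ((q.1 - c₁) * n + q.1 * h) = q.1 * (n + h) by ring,
      show c₁ * n + ((q.1 - c₁) * n + q.1 * h') = q.1 * (n + h') by ring]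
    ring

theorem contr_linDiff {M : Multiset (F × A)} (hM : ∀ q ∈ M, S.Contr q.2) (c₁ h h' : F) :
    ∀ q ∈ S.linDiff c₁ h h' M, S.Contr q.2 := by
  intro q hq
  obtain ⟨q, hq', rfl⟩ := Multiset.mem_map.1 hq
  exact ((hM q hq').τ _).star.mul ((hM q hq').τ _)

theorem inner_smul_linProd (w : F → ℂ) (c₁ h h' : F) (M : Multiset (F × A)) (n : F) :
    inner ℂ (w (n + h) • S.ι (S.linProd M (n + h))) (w (n + h') • S.ι (S.linProd M (n + h')))
      = star (w (n + h)) * w (n + h') * S.Λ (S.linProd (S.linDiff c₁ h h' M) n) := by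
  rw [inner_smul_left, inner_smul_right, S.inner_ι, S.star_linProd_mul c₁, S.Λ_τ, mul_assoc]
  rfl

/-- The factor `b` does not depend on the averaging variable, so it comes out of the average and
Cauchy–Schwarz removes it. -/
theorem norm_avg_mul_Λ_mul_le {ι : Type*} (H : Finset ι) (w : ι → ℂ) {b : A} (hb : S.Contr b)
    (x : ι → A) :
    ‖avg ℂ H fun n => w n * S.Λ (b * x n)‖ ≤ ‖avg ℂ H fun n => w n • S.ι (x n)‖ := by
  have h1 : (avg ℂ H fun n => w n * S.Λ (b * x n)) = S.Λ (b * avg ℂ H fun n => w n • x n) := by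
    rw [show b * avg ℂ H (fun n => w n • x n) = LinearMap.mulLeft ℂ b (avg ℂ H fun n => w n • x n)
      from rfl, map_avg, map_avg]
    simp
  have h2 : (avg ℂ H fun n => w n • S.ι (x n)) = S.ι (avg ℂ H fun n => w n • x n) := by
    rw [map_avg]
    simp
  rw [h1, h2]
  exact hb.norm_Λ_mul_le _

variable [DecidableEq F] {Φ : ℕ → Finset F}

/-- One van der Corput step. A set `H` nearly attaining the infimum in `G (s + 1) f` is rescaled to
`c⁻¹ H`, so that the shifts `c * h` run over `H`. Jensen's inequality passes the power `m` through
both averages. -/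
theorem limLe_linear_aux (hΦ : IsFolnerSequence Φ) {w : F → ℂ} (hw : ∀ n, ‖w n‖ ≤ 1) {c : F}
    (hc : c ≠ 0) {f : A} {M : Multiset (F × A)} (hM : ∀ q ∈ M, S.Contr q.2) {s m : ℕ}
    (hm : m ≠ 0) (B : F → F → ℝ) (hB : ∀ h h', 0 ≤ B h h')
    (hBG : ∀ h h', B h h' ^ m ≤ S.G s (star (S.τ (c * h) f) * S.τ (c * h') f))
    (hlim : ∀ h h', LimLe (fun N => ‖avg ℂ (Φ N) fun n =>
      inner ℂ (w (n + h) • S.ι (S.linProd M (n + h)))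
        (w (n + h') • S.ι (S.linProd M (n + h')))‖) (B h h')) :
    LimLe (fun N => ‖avg ℂ (Φ N) fun n => w n • S.ι (S.linProd M n)‖ ^ (2 * m))
      (S.G (s + 1) f) := by
  refine LimLe.of_forall_pos fun ε hε => ?_
  obtain ⟨H, hH, hlt⟩ := S.exists_avg_G_lt s f (show S.G (s + 1) f < S.G (s + 1) f + ε by linarith)
  have hinj : Function.Injective fun x => c⁻¹ * x := mul_right_injective₀ (inv_ne_zero hc)
  have hv : ∀ n, ‖w n • S.ι (S.linProd M n)‖ ≤ 1 := by
    intro n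
    rw [norm_smul]
    exact mul_le_one₀ (hw n) (norm_nonneg _) (Contr.linProd hM n).norm_ι_le
  have h1 := (hΦ.vanDerCorput (𝕜 := ℂ) hv (hH.image fun x => c⁻¹ * x) B fun h _ h' _ =>
    hlim h h').pow (fun N => sq_nonneg _) m
  refine h1.mono (fun N => by rw [pow_mul]) (le_trans ?_ hlt.le)
  rw [avg_image _ hinj]
  refine (pow_avg_le_avg_pow (fun h _ => avg_nonneg fun h' _ => hB _ _) hm).trans
    (avg_le_avg fun h _ => (pow_avg_le_avg_pow (fun h' _ => hB _ _) hm).trans ?_)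
  rw [avg_image _ hinj]
  refine avg_le_avg fun h' _ => (hBG _ _).trans_eq ?_
  rw [← G_star, star_mul, star_star, mul_inv_cancel_left₀ hc, mul_inv_cancel_left₀ hc, mul_comm]

theorem _root_.LimLe.exists_root {a : ℕ → ℝ} {c : ℝ} {m : ℕ} (hm : m ≠ 0)
    (hc : 0 ≤ c) (h : LimLe (fun N => a N ^ m) c) : ∃ b, 0 ≤ b ∧ b ^ m = c ∧ LimLe a b := by
  refine ⟨c ^ (m : ℝ)⁻¹, by positivity, Real.rpow_inv_natCast_pow hc hm, fun ε hε => ?_⟩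
  set b := c ^ (m : ℝ)⁻¹ with hb
  have hbm : b ^ m = c := Real.rpow_inv_natCast_pow hc hm
  have hb0 : 0 ≤ b := by positivity
  have hlt : b ^ m < (b + ε) ^ m := pow_lt_pow_left₀ (by linarith) hb0 hm
  refine (h ((b + ε) ^ m - b ^ m) (by linarith)).mono fun N hN => ?_
  rw [← hbm] at hN
  exact le_of_pow_le_pow_left₀ hm (by positivity) (by linarith)

/-- Averages along a linear family are controlled by the seminorms, with arbitrary bounded
weights. -/
theorem limLe_linear (hΦ : IsFolnerSequence Φ) (k : ℕ) {w : F → ℂ} (hw : ∀ n, ‖w n‖ ≤ 1) {c : F}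
    (hc : c ≠ 0) {f : A} (hf : S.Contr f) {L : Multiset (F × A)} (hL : ∀ q ∈ L, S.Contr q.2)
    (hLc : ∀ q ∈ L, q.1 ≠ c)
    (hk : (L.map Prod.fst).toFinset.card = k) :
    LimLe (fun N => ‖avg ℂ (Φ N) fun n => w n • S.ι (S.linProd ((c, f) ::ₘ L) n)‖ ^ (2 ^ (k + 2)))
      (S.G (k + 1) f) := by
  induction k generalizing w c f L with
  | zero =>
    have hL' : L = 0 := by
      rw [Finset.card_eq_zero, Multiset.toFinset_eq_empty, Multiset.map_eq_zero] at hk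
      exact hk
    subst hL'
    refine S.limLe_linear_aux hΦ hw hc (m := 2) (by simpa using hf) two_ne_zero
      (fun h h' => ‖S.Λ (star (S.τ (c * h) f) * S.τ (c * h') f)‖) (fun _ _ => norm_nonneg _)
      (fun h h' => le_rfl) fun h h' => ?_
    refine LimLe.of_le fun N => norm_avg_le_of_le (norm_nonneg _) fun n _ => ?_
    rw [S.inner_smul_linProd w c]
    have h1 : S.linProd (S.linDiff c h h' {(c, f)}) n = star (S.τ (c * h) f) * S.τ (c * h') f := by
      simp [linProd, linDiff, S.τ_zero]
    rw [show ((c, f) ::ₘ (0 : Multiset (F × A))) = {(c, f)} from rfl, h1, norm_mul, norm_mul,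
      norm_star]
    calc _ ≤ 1 * 1 * ‖S.Λ (star (S.τ (c * h) f) * S.τ (c * h') f)‖ := by
          gcongr
          · exact hw _
          · exact hw _
      _ = _ := by ring
  | succ k ih =>
    have hne : (L.map Prod.fst).toFinset.Nonempty := by
      rw [← Finset.card_pos, hk]
      omega
    -- Subtracting a coefficient `c₁` of another member reduces the number of distinct nonzero
    -- coefficients by one. Members with coefficient `c₁` become constant in `n` and go to `L₀`; the
    -- rest form `L'`. The distinguished coefficient `c - c₁` stays nonzero and different from the
    -- others.
    obtain ⟨c₁, hc₁⟩ := hne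
    have hM : ∀ q ∈ (c, f) ::ₘ L, S.Contr q.2 := by
      intro q hq
      rcases Multiset.mem_cons.1 hq with rfl | hq
      exacts [hf, hL q hq]
    have hc₁L : ∃ q ∈ L, q.1 = c₁ := by simpa using hc₁
    have hcc : c - c₁ ≠ 0 := by
      obtain ⟨q, hq, rfl⟩ := hc₁L
      exact sub_ne_zero.2 (hLc q hq).symm
    let L' : F → F → Multiset (F × A) := fun h h' =>
      (S.linDiff c₁ h h' L).filter fun q => q.1 ≠ 0
    let L₀ : F → F → Multiset (F × A) := fun h h' =>
      (S.linDiff c₁ h h' L).filter fun q => ¬ q.1 ≠ 0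
    let f' : F → F → A := fun h h' => star (S.τ (c * h) f) * S.τ (c * h') f
    let w' : F → F → F → ℂ := fun h h' n => star (w (n + h)) * w (n + h')
    have hw' : ∀ h h' n, ‖w' h h' n‖ ≤ 1 := fun h h' n => by
      rw [norm_mul, norm_star]
      exact mul_le_one₀ (hw _) (norm_nonneg _) (hw _)
    have hcard : ∀ h h', ((L' h h').map Prod.fst).toFinset.card = k := by
      intro h h'
      have h1 : ((L' h h').map Prod.fst).toFinset
          = ((L.map Prod.fst).toFinset.erase c₁).image fun x => x - c₁ := by
        ext x
        simp only [L', linDiff, Multiset.mem_toFinset, Multiset.mem_map, Multiset.mem_filter,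
          Finset.mem_image, Finset.mem_erase]
        constructor
        · rintro ⟨_, ⟨⟨q, hq, rfl⟩, h0⟩, rfl⟩
          exact ⟨q.1, ⟨sub_ne_zero.1 h0, q, hq, rfl⟩, rfl⟩
        · rintro ⟨_, ⟨h0, q, hq, rfl⟩, rfl⟩
          exact ⟨_, ⟨⟨q, hq, rfl⟩, sub_ne_zero.2 h0⟩, rfl⟩
      rw [h1, Finset.card_image_of_injective _ (sub_left_injective), Finset.card_erase_of_mem hc₁,
        hk, Nat.add_sub_cancel]
    have key : ∀ h h', LimLe (fun N => ‖avg ℂ (Φ N) fun n => w' h h' n •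
        S.ι (S.linProd ((c - c₁, f' h h') ::ₘ L' h h') n)‖ ^ (2 ^ (k + 2)))
        (S.G (k + 1) (f' h h')) := by
      intro h h'
      refine ih (hw' h h') hcc ((hf.τ _).star.mul (hf.τ _)) ?_ ?_ (hcard h h')
      · exact fun q hq => S.contr_linDiff hL c₁ h h' q (Multiset.mem_of_mem_filter hq)
      · intro q hq
        obtain ⟨q, hq', rfl⟩ := Multiset.mem_map.1 (Multiset.mem_of_mem_filter hq)
        simpa using hLc q hq'
    choose B hB0 hBm hB using fun h h' => LimLe.exists_root (pow_ne_zero (k + 2) two_ne_zero)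
      (S.G_nonneg _ _) (key h h')
    rw [show 2 ^ (k + 1 + 2) = 2 * 2 ^ (k + 2) by ring]
    refine S.limLe_linear_aux hΦ hw hc hM (pow_ne_zero (k + 2) two_ne_zero) B hB0
      (fun h h' => (hBm h h').le) fun h h' => (hB h h').mono (fun N => ?_) le_rfl
    have h2 : ∀ n, S.linProd (S.linDiff c₁ h h' ((c, f) ::ₘ L)) n
        = ((L₀ h h').map Prod.snd).prod * S.linProd ((c - c₁, f' h h') ::ₘ L' h h') n := by
      intro n
      have h3 : S.linProd (S.linDiff c₁ h h' L) n
          = S.linProd (L' h h') n * S.linProd (L₀ h h') n := by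
        rw [← linProd_add, Multiset.filter_add_not]
      have h4 : S.linProd (L₀ h h') n = ((L₀ h h').map Prod.snd).prod := by
        rw [linProd]
        congr 1
        refine Multiset.map_congr rfl fun q hq => ?_
        have : q.1 = 0 := by simpa using (Multiset.mem_filter.1 hq).2
        rw [this, zero_mul, S.τ_zero]
      rw [linDiff_cons, linProd_cons, linProd_cons, h3, h4]
      ring
    simp only [S.inner_smul_linProd w c₁, h2]
    refine S.norm_avg_mul_Λ_mul_le _ _ (Contr.multiset_prod fun a ha => ?_) _
    obtain ⟨q, hq, rfl⟩ := Multiset.mem_map.1 ha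
    exact S.contr_linDiff hL c₁ h h' q (Multiset.mem_of_mem_filter hq)

end KoopmanSystem

/-! ### Translates of polynomials and their leading terms -/

section PolynomialLemmas

open Polynomial

variable {F : Type*} [Field F]

theorem Polynomial.natDegree_pos_of_coeff_ne_zero {p : F[X]} {n : ℕ} (hn : 0 < n)
    (h : p.coeff n ≠ 0) : 0 < p.natDegree :=
  hn.trans_le (le_natDegree_of_ne_zero h)

theorem Polynomial.coeff_taylor_of_natDegree_eq {p : F[X]} {d : ℕ} (hp : p.natDegree = d) (h : F) :
    (taylor h p).coeff d = p.leadingCoeff := by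
  rw [← hp, coeff_taylor_natDegree]

/-- The dependence of the subleading coefficient on `h` is what separates translates: its factor `d
+ 1` is invertible in characteristic zero. -/
theorem Polynomial.coeff_taylor_pred_of_le {p : F[X]} {d : ℕ} (hp : p.natDegree ≤ d + 1) (h : F) :
    (taylor h p).coeff d = p.coeff d + (d + 1) * p.coeff (d + 1) * h := by
  have h1 : (hasseDeriv d p).natDegree < 2 := by
    have := natDegree_hasseDeriv_le p d
    omega
  rw [taylor_coeff, eval_eq_sum_range' h1]
  simp only [Finset.sum_range_succ, Finset.sum_range_zero, hasseDeriv_coeff, zero_add,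
    Nat.choose_self, Nat.cast_one, one_mul, pow_zero, mul_one, pow_one]
  rw [add_comm 1 d, Nat.choose_succ_self_right]
  push_cast
  ring

theorem Polynomial.coeff_taylor_pred {p : F[X]} {d : ℕ} (hp : p.natDegree = d + 1) (h : F) :
    (taylor h p).coeff d = p.coeff d + (d + 1) * p.leadingCoeff * h := by
  rw [coeff_taylor_pred_of_le hp.le, leadingCoeff, hp]

theorem Polynomial.natDegree_taylor_sub_taylor_of_lt {p r : F[X]} (hlt : r.natDegree < p.natDegree)
    (h h' : F) : (taylor h p - taylor h' r).natDegree = p.natDegree := by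
  rw [natDegree_sub_eq_left_of_natDegree_lt] <;> simp [natDegree_taylor, hlt]

theorem Polynomial.leadingCoeff_taylor_sub_taylor_of_lt {p r : F[X]}
    (hlt : r.natDegree < p.natDegree) (h h' : F) :
    (taylor h p - taylor h' r).leadingCoeff = p.leadingCoeff := by
  rw [leadingCoeff, natDegree_taylor_sub_taylor_of_lt hlt, coeff_sub, coeff_taylor_natDegree,
    coeff_eq_zero_of_natDegree_lt (by rwa [natDegree_taylor]), sub_zero]

theorem Polynomial.natDegree_taylor_sub_taylor_le {p r : F[X]} {d : ℕ} (hp : p.natDegree ≤ d)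
    (hr : r.natDegree ≤ d) (h h' : F) : (taylor h p - taylor h' r).natDegree ≤ d :=
  (natDegree_sub_le _ _).trans (by simpa [natDegree_taylor] using ⟨hp, hr⟩)

theorem Polynomial.taylor_sub_taylor_eq (p r : F[X]) (h h' : F) :
    taylor h' p - taylor h r = taylor h (taylor (h' - h) p - r) := by
  rw [map_sub, taylor_taylor, add_sub_cancel]

/-- For `p` of degree at least two, only one translate of `p` can differ from `q` by a constant. -/
theorem Polynomial.subsingleton_natDegree_taylor_sub_eq_zero [CharZero F] {p : F[X]}
    (hp : 2 ≤ p.natDegree) (q : F[X]) :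
    {u : F | (taylor u p - q).natDegree = 0}.Subsingleton := by
  intro u hu u' hu'
  simp only [Set.mem_ofPred_eq] at hu hu'
  obtain ⟨d, hd⟩ : ∃ d, p.natDegree = d + 1 := ⟨p.natDegree - 1, by omega⟩
  by_contra hne
  have h1 : 0 < (taylor u p - taylor u' p).natDegree := by
    refine natDegree_pos_of_coeff_ne_zero (n := d) (by omega) ?_
    rw [coeff_sub, coeff_taylor_pred hd, coeff_taylor_pred hd, add_sub_add_left_eq_sub, ← mul_sub]
    refine mul_ne_zero (mul_ne_zero (by exact_mod_cast d.succ_ne_zero) ?_) (sub_ne_zero.2 hne)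
    rw [Ne, leadingCoeff_eq_zero]
    rintro rfl
    simp at hd
  have h2 : taylor u p - taylor u' p = (taylor u p - q) - (taylor u' p - q) := by ring
  have h3 := natDegree_sub_le (taylor u p - q) (taylor u' p - q)
  rw [h2] at h1
  omega

end PolynomialLemmas

/-! ### Polynomial families and the van der Corput operation on them -/

namespace KoopmanSystem

open Polynomial

variable {F A E : Type*} [Field F] [CommRing A] [StarRing A] [Algebra ℂ A]
    [StarModule ℂ A] [NormedAddCommGroup E] [InnerProductSpace ℂ E] (S : KoopmanSystem F A E)

/-- The product of the functions `τ (p n) g` over a family of pairs `(p, g)`. -/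
noncomputable def polyProd (M : Multiset (F[X] × A)) (n : F) : A :=
  (M.map fun q => S.τ (q.1.eval n) q.2).prod

theorem polyProd_add (M M' : Multiset (F[X] × A)) (n : F) :
    S.polyProd (M + M') n = S.polyProd M n * S.polyProd M' n := by
  simp [polyProd]

theorem polyProd_cons (q : F[X] × A) (M : Multiset (F[X] × A)) (n : F) :
    S.polyProd (q ::ₘ M) n = S.τ (q.1.eval n) q.2 * S.polyProd M n := by
  simp [polyProd]

variable {S} in
theorem Contr.polyProd {M : Multiset (F[X] × A)} (hM : ∀ q ∈ M, S.Contr q.2) (n : F) :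
    S.Contr (S.polyProd M n) := by
  refine Contr.multiset_prod fun a ha => ?_
  obtain ⟨q, hq, rfl⟩ := Multiset.mem_map.1 ha
  exact (hM q hq).τ _

/-- Translate the polynomials of a family by `h` and subtract `r`. -/
noncomputable def polyShift (r : F[X]) (h : F) (M : Multiset (F[X] × A)) : Multiset (F[X] × A) :=
  M.map fun q => (taylor h q.1 - r, q.2)

/-- The conjugates of the functions in a family. -/
def polyStar (M : Multiset (F[X] × A)) : Multiset (F[X] × A) :=
  M.map fun q => (q.1, star q.2)

omit [CommRing A] [StarRing A] [Algebra ℂ A] [StarModule ℂ A] in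
theorem mem_polyShift {r : F[X]} {h : F} {M : Multiset (F[X] × A)} {q : F[X] × A} :
    q ∈ polyShift r h M ↔ ∃ q' ∈ M, (taylor h q'.1 - r, q'.2) = q := by
  simp only [polyShift, Multiset.mem_map]

omit [Algebra ℂ A] [StarModule ℂ A] in
theorem mem_polyStar {M : Multiset (F[X] × A)} {q : F[X] × A} :
    q ∈ polyStar M ↔ ∃ q' ∈ M, (q'.1, star q'.2) = q := by
  simp only [polyStar, Multiset.mem_map]

theorem polyProd_polyStar (M : Multiset (F[X] × A)) (n : F) :
    S.polyProd (polyStar M) n = star (S.polyProd M n) := by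
  induction M using Multiset.induction_on with
  | empty => simp [polyProd, polyStar]
  | cons q M ih =>
    rw [show polyStar (q ::ₘ M) = (q.1, star q.2) ::ₘ polyStar M by simp [polyStar], polyProd_cons,
      polyProd_cons, ih, star_mul, map_star, mul_comm]

theorem τ_polyProd_polyShift (r : F[X]) (h : F) (M : Multiset (F[X] × A)) (n : F) :
    S.τ (r.eval n) (S.polyProd (polyShift r h M) n) = S.polyProd M (n + h) := by
  induction M using Multiset.induction_on with
  | empty => simp [polyProd, polyShift]
  | cons q M ih =>
    rw [show polyShift r h (q ::ₘ M) = (taylor h q.1 - r, q.2) ::ₘ polyShift r h M by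
      simp [polyShift], polyProd_cons, polyProd_cons, map_mul, ih, ← S.τ_add, eval_sub,
      add_sub_cancel, taylor_eval]

/-- The family arising from `M` after one application of van der Corput's inequality and a change
of variables, with the constant polynomials removed. -/
noncomputable def polyDiff (r : F[X]) (h h' : F) (M : Multiset (F[X] × A)) :
    Multiset (F[X] × A) :=
  (polyShift r h (polyStar M) + polyShift r h' M).filter fun q => 0 < q.1.natDegree

variable {S} in
theorem contr_polyShift_add {M : Multiset (F[X] × A)} (hM : ∀ q ∈ M, S.Contr q.2) (r : F[X])
    (h h' : F) : ∀ q ∈ polyShift r h (polyStar M) + polyShift r h' M, S.Contr q.2 := by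
  intro q hq
  rcases Multiset.mem_add.1 hq with hq | hq
  · obtain ⟨q₁, hq₁, rfl⟩ := mem_polyShift.1 hq
    obtain ⟨q₂, hq₂, rfl⟩ := mem_polyStar.1 hq₁
    exact (hM q₂ hq₂).star
  · obtain ⟨q₁, hq₁, rfl⟩ := mem_polyShift.1 hq
    exact hM q₁ hq₁

/-- Invariance of `Λ` permits subtracting `r` from all the shifted polynomials. Those that become
constant form a factor independent of `n`, which Cauchy–Schwarz discards. -/
theorem norm_avg_inner_polyProd_le {ι : Type*} (H : Finset ι) (e : ι → F) (w : F → ℂ) (r : F[X])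
    (h h' : F) {M : Multiset (F[X] × A)} (hM : ∀ q ∈ M, S.Contr q.2) :
    ‖avg ℂ H fun i => inner ℂ (w (e i + h) • S.ι (S.polyProd M (e i + h)))
        (w (e i + h') • S.ι (S.polyProd M (e i + h')))‖
      ≤ ‖avg ℂ H fun i => (star (w (e i + h)) * w (e i + h')) •
        S.ι (S.polyProd (polyDiff r h h' M) (e i))‖ := by
  set M₀ := (polyShift r h (polyStar M) + polyShift r h' M).filter fun q => ¬ 0 < q.1.natDegree
    with hM₀
  have h1 : ∀ n, S.polyProd M₀ n = (M₀.map fun q => S.τ (q.1.coeff 0) q.2).prod := by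
    intro n
    rw [polyProd]
    congr 1
    refine Multiset.map_congr rfl fun q hq => ?_
    have : q.1.natDegree = 0 := by simpa using (Multiset.mem_filter.1 hq).2
    rw [eq_C_of_natDegree_eq_zero this]
    simp
  have h2 : ∀ n, inner ℂ (w (n + h) • S.ι (S.polyProd M (n + h)))
      (w (n + h') • S.ι (S.polyProd M (n + h')))
      = (star (w (n + h)) * w (n + h')) * S.Λ ((M₀.map fun q => S.τ (q.1.coeff 0) q.2).prod *
        S.polyProd (polyDiff r h h' M) n) := by
    intro n
    rw [inner_smul_left, inner_smul_right, S.inner_ι, ← polyProd_polyStar,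
      ← S.τ_polyProd_polyShift r h, ← S.τ_polyProd_polyShift r h', ← map_mul, S.Λ_τ,
      ← polyProd_add, ← h1, ← polyProd_add, hM₀, polyDiff, add_comm (Multiset.filter _ _),
      Multiset.filter_add_not, ← mul_assoc]
    rfl
  simp only [h2]
  refine S.norm_avg_mul_Λ_mul_le _ _ (Contr.multiset_prod fun a ha => ?_) _
  obtain ⟨q, hq, rfl⟩ := Multiset.mem_map.1 ha
  exact (contr_polyShift_add hM r h h' q (Multiset.mem_of_mem_filter hq)).τ _

section Weight

variable [DecidableEq F]

/-- The set of leading coefficients of the polynomials of degree `j` in a family. -/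
noncomputable def leads (M : Multiset (F[X] × A)) (j : ℕ) : Finset F :=
  ((M.filter fun q => q.1.natDegree = j).map fun q => q.1.leadingCoeff).toFinset

omit [CommRing A] [StarRing A] [Algebra ℂ A] [StarModule ℂ A] in
theorem mem_leads {M : Multiset (F[X] × A)} {j : ℕ} {a : F} :
    a ∈ leads M j ↔ ∃ q ∈ M, q.1.natDegree = j ∧ q.1.leadingCoeff = a := by
  simp [leads, and_assoc]

omit [Algebra ℂ A] [StarModule ℂ A] [DecidableEq F] in
theorem mem_polyDiff_fst {r : F[X]} {h h' : F} {M : Multiset (F[X] × A)} {x : F[X]} :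
    (∃ q ∈ polyDiff r h h' M, q.1 = x) ↔
      0 < x.natDegree ∧ ∃ q ∈ M, x = taylor h q.1 - r ∨ x = taylor h' q.1 - r := by
  constructor
  · rintro ⟨q, hq, rfl⟩
    rw [polyDiff, Multiset.mem_filter, Multiset.mem_add] at hq
    refine ⟨hq.2, ?_⟩
    rcases hq.1 with hq | hq
    · obtain ⟨q₁, hq₁, rfl⟩ := mem_polyShift.1 hq
      obtain ⟨q₂, hq₂, rfl⟩ := mem_polyStar.1 hq₁
      exact ⟨q₂, hq₂, Or.inl rfl⟩
    · obtain ⟨q₁, hq₁, rfl⟩ := mem_polyShift.1 hq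
      exact ⟨q₁, hq₁, Or.inr rfl⟩
  · rintro ⟨hx, q, hq, rfl | rfl⟩
    · exact ⟨(taylor h q.1 - r, star q.2), Multiset.mem_filter.2 ⟨Multiset.mem_add.2 (Or.inl
        (mem_polyShift.2 ⟨(q.1, star q.2), mem_polyStar.2 ⟨q, hq, rfl⟩, rfl⟩)), hx⟩, rfl⟩
    · exact ⟨(taylor h' q.1 - r, q.2), Multiset.mem_filter.2 ⟨Multiset.mem_add.2 (Or.inr
        (mem_polyShift.2 ⟨q, hq, rfl⟩)), hx⟩, rfl⟩

-- Subtracting a polynomial of smaller degree, and translating, affects neither degree nor leading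
-- coefficient. Together with `card_leads_polyDiff_lt` this makes the weight decrease when degrees
-- are compared from the top.
omit [Algebra ℂ A] [StarModule ℂ A] in
theorem leads_polyDiff_of_lt {r : F[X]} {h h' : F} {M : Multiset (F[X] × A)} {j : ℕ}
    (hj : r.natDegree < j) : leads (polyDiff (taylor h r) h h' M) j = leads M j := by
  have hlt : ∀ (q : F[X]) (u : F), (taylor u q - taylor h r).natDegree = j → q.natDegree = j := by
    intro q u hq
    by_contra hne
    rcases lt_or_gt_of_ne hne with hlt | hlt
    · have := natDegree_taylor_sub_taylor_le (d := j - 1) (p := q) (r := r) (by omega) (by omega) u h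
      omega
    · have := natDegree_taylor_sub_taylor_of_lt (hj.trans hlt) u h
      omega
  ext a
  rw [mem_leads, mem_leads]
  constructor
  · rintro ⟨x, hx, hxj, hxa⟩
    obtain ⟨-, q, hq, h1⟩ := mem_polyDiff_fst.1 ⟨x, hx, rfl⟩
    rcases h1 with h1 | h1
    all_goals
      rw [h1] at hxj hxa
      have h2 := hlt _ _ hxj
      rw [leadingCoeff_taylor_sub_taylor_of_lt (by omega)] at hxa
      exact ⟨q, hq, h2, hxa⟩
  · rintro ⟨q, hq, hqj, hqa⟩
    have h2 := natDegree_taylor_sub_taylor_of_lt (show r.natDegree < q.1.natDegree by omega) h h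
    have h3 := leadingCoeff_taylor_sub_taylor_of_lt (show r.natDegree < q.1.natDegree by omega) h h
    obtain ⟨x, hx, hx1⟩ := (mem_polyDiff_fst (r := taylor h r) (h := h) (h' := h') (M := M)).2
      ⟨by omega, q, hq, Or.inl rfl⟩
    exact ⟨x, hx, by rw [hx1, h2, hqj], by rw [hx1, h3, hqa]⟩

-- At the degree of the pivot all leading coefficients are shifted by that of `r`, and the one equal
-- to it is lost. Minimality of the degree of `r` rules out new contributions from below; degrees
-- under that of `r` may gain members, which the lexicographic order ignores.
omit [Algebra ℂ A] [StarModule ℂ A] in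
theorem card_leads_polyDiff_lt {r : F[X]} {h h' : F} {M : Multiset (F[X] × A)}
    (hr : ∃ q ∈ M, q.1 = r) (hmin : ∀ q ∈ M, r.natDegree ≤ q.1.natDegree) (hr0 : 0 < r.natDegree) :
    (leads (polyDiff (taylor h r) h h' M) r.natDegree).card < (leads M r.natDegree).card := by
  have hrl : r.leadingCoeff ∈ leads M r.natDegree := by
    obtain ⟨q, hq, rfl⟩ := hr
    exact mem_leads.2 ⟨q, hq, rfl, rfl⟩
  have hsub : leads (polyDiff (taylor h r) h h' M) r.natDegree
      ⊆ ((leads M r.natDegree).erase r.leadingCoeff).image fun x => x - r.leadingCoeff := by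
    have key : ∀ q ∈ M, ∀ u, (taylor u q.1 - taylor h r).natDegree = r.natDegree →
        (taylor u q.1 - taylor h r).leadingCoeff
          ∈ ((leads M r.natDegree).erase r.leadingCoeff).image fun x => x - r.leadingCoeff := by
      intro q hq u hu
      have h1 : q.1.natDegree = r.natDegree := by
        rcases (hmin q hq).lt_or_eq with hlt | heq
        · have := natDegree_taylor_sub_taylor_of_lt hlt u h
          omega
        · exact heq.symm
      have h2 : (taylor u q.1 - taylor h r).leadingCoeff = q.1.leadingCoeff - r.leadingCoeff := by
        rw [leadingCoeff, hu, coeff_sub, coeff_taylor_of_natDegree_eq h1, coeff_taylor_natDegree]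
      refine Finset.mem_image.2 ⟨q.1.leadingCoeff, Finset.mem_erase.2 ⟨fun h3 => ?_,
        mem_leads.2 ⟨q, hq, h1, rfl⟩⟩, h2.symm⟩
      rw [h3, sub_self, leadingCoeff_eq_zero] at h2
      rw [h2] at hu
      simp at hu
      omega
    intro a ha
    obtain ⟨x, hx, hxj, rfl⟩ := mem_leads.1 ha
    obtain ⟨-, q, hq, h1⟩ := mem_polyDiff_fst.1 ⟨x, hx, rfl⟩
    rcases h1 with h1 | h1
    all_goals
      rw [h1] at hxj ⊢
      exact key q hq _ hxj
  calc _ ≤ _ := Finset.card_le_card hsub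
    _ ≤ _ := Finset.card_image_le
    _ < _ := Finset.card_erase_lt_of_mem hrl

end Weight

/-- A family of polynomials, with a distinguished member `p` of maximal degree which does not
differ from any other member by a constant. -/
structure PolyFamily (p : F[X]) (L : Multiset (F[X] × A)) : Prop where
  pos : 0 < p.natDegree
  pos_of_mem : ∀ q ∈ L, 0 < q.1.natDegree
  le_of_mem : ∀ q ∈ L, q.1.natDegree ≤ p.natDegree
  sub_pos : ∀ q ∈ L, 0 < (p - q.1).natDegree

omit [CommRing A] [StarRing A] [Algebra ℂ A] [StarModule ℂ A] in
/-- The choice of the polynomial to be subtracted in the van der Corput step. -/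
theorem PolyFamily.exists_pivot {p : F[X]} {f : A} {L : Multiset (F[X] × A)}
    (hL : PolyFamily p L) : ∃ r : F[X], (∃ q ∈ (p, f) ::ₘ L, q.1 = r) ∧
      (∀ q ∈ (p, f) ::ₘ L, r.natDegree ≤ q.1.natDegree) ∧ 0 < r.natDegree ∧
      (r.natDegree < p.natDegree ∨ r.natDegree = p.natDegree ∧ r.leadingCoeff ≠ p.leadingCoeff ∨
        r = p ∧ ∀ q ∈ L, q.1.natDegree = p.natDegree ∧ q.1.leadingCoeff = p.leadingCoeff) := by
  classical
  by_cases h1 : ∃ q ∈ L, q.1.natDegree < p.natDegree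
  · obtain ⟨q₀, hq₀, hlt⟩ := h1
    obtain ⟨q, hq, hmin⟩ := Finset.exists_min_image L.toFinset (fun q => q.1.natDegree)
      ⟨q₀, by simpa using hq₀⟩
    have hq' : q ∈ L := by simpa using hq
    have hlt' := (hmin q₀ (by simpa using hq₀)).trans_lt hlt
    refine ⟨q.1, ⟨q, by simp [hq'], rfl⟩, fun q' hq'' => ?_, hL.pos_of_mem q hq', Or.inl hlt'⟩
    rcases Multiset.mem_cons.1 hq'' with rfl | h
    exacts [hlt'.le, hmin q' (by simpa using h)]
  · push Not at h1
    have h2 : ∀ q ∈ L, q.1.natDegree = p.natDegree := fun q hq =>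
      le_antisymm (hL.le_of_mem q hq) (h1 q hq)
    by_cases h3 : ∃ q ∈ L, q.1.leadingCoeff ≠ p.leadingCoeff
    · obtain ⟨q, hq, hne⟩ := h3
      refine ⟨q.1, ⟨q, by simp [hq], rfl⟩, fun q' hq' => ?_, hL.pos_of_mem q hq,
        Or.inr (Or.inl ⟨h2 q hq, hne⟩)⟩
      rcases Multiset.mem_cons.1 hq' with rfl | h
      exacts [(h2 q hq).le, ((h2 q hq).trans (h2 q' h).symm).le]
    · push Not at h3
      refine ⟨p, ⟨(p, f), by simp, rfl⟩, fun q' hq' => ?_, hL.pos,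
        Or.inr (Or.inr ⟨rfl, fun q hq => ⟨h2 q hq, h3 q hq⟩⟩)⟩
      rcases Multiset.mem_cons.1 hq' with rfl | h
      exacts [le_rfl, (h2 q' h).ge]

-- The three alternatives for the pivot guarantee that the member carrying `f` keeps maximal degree.
-- In the first two its leading term survives; in the third all degrees drop, and its coefficient of
-- the next degree is a nonzero multiple of `h' - h`. The excluded differences `hbad` keep it from
-- agreeing up to a constant with a member of the copy shifted by `h`.
omit [Algebra ℂ A] [StarModule ℂ A] in
theorem PolyFamily.polyDiff [CharZero F] {p : F[X]} {f : A} {L : Multiset (F[X] × A)}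
    (hL : PolyFamily p L) (hd : 2 ≤ p.natDegree) {r : F[X]}
    (hr : r.natDegree < p.natDegree ∨ r.natDegree = p.natDegree ∧ r.leadingCoeff ≠ p.leadingCoeff ∨
      r = p ∧ ∀ q ∈ L, q.1.natDegree = p.natDegree ∧ q.1.leadingCoeff = p.leadingCoeff)
    {h h' : F} (hbad : ∀ q ∈ (p, f) ::ₘ L, (taylor (h' - h) p - q.1).natDegree ≠ 0) :
    ∃ L', polyDiff (taylor h r) h h' ((p, f) ::ₘ L) = (taylor h' p - taylor h r, f) ::ₘ L' ∧
      PolyFamily (taylor h' p - taylor h r) L' := by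
  -- The condition `hbad` for `p` itself excludes a zero shift.
  have hu : h' - h ≠ 0 := by
    intro h0
    have := hbad (p, f) (by simp)
    rw [h0, taylor_zero] at this
    simp at this
  obtain ⟨d, hpd⟩ : ∃ d, p.natDegree = d + 1 := ⟨p.natDegree - 1, by omega⟩
  have hlc : p.leadingCoeff ≠ 0 := by
    rw [Ne, leadingCoeff_eq_zero]
    rintro rfl
    simp at hpd
  have hle : ∀ q ∈ (p, f) ::ₘ L, q.1.natDegree ≤ p.natDegree := by
    intro q hq
    rcases Multiset.mem_cons.1 hq with rfl | hq
    exacts [le_rfl, hL.le_of_mem q hq]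
  -- the new distinguished polynomial is nonconstant and of maximal degree
  have hmax : 0 < (taylor h' p - taylor h r).natDegree ∧ ∀ q ∈ (p, f) ::ₘ L, ∀ u,
      (taylor u q.1 - taylor h r).natDegree ≤ (taylor h' p - taylor h r).natDegree := by
    rcases hr with hr | hr | ⟨rfl, hr⟩
    · rw [natDegree_taylor_sub_taylor_of_lt hr]
      exact ⟨hL.pos, fun q hq u => natDegree_taylor_sub_taylor_le (hle q hq) hr.le _ _⟩
    · have h1 : p.natDegree ≤ (taylor h' p - taylor h r).natDegree := by
        refine le_natDegree_of_ne_zero ?_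
        rw [coeff_sub, coeff_taylor_natDegree, coeff_taylor_of_natDegree_eq hr.1]
        exact sub_ne_zero.2 hr.2.symm
      exact ⟨hL.pos.trans_le h1, fun q hq u =>
        (natDegree_taylor_sub_taylor_le (hle q hq) hr.1.le _ _).trans h1⟩
    · have h1 : d ≤ (taylor h' r - taylor h r).natDegree := by
        refine le_natDegree_of_ne_zero ?_
        rw [coeff_sub, coeff_taylor_pred hpd, coeff_taylor_pred hpd, add_sub_add_left_eq_sub,
          ← mul_sub]
        exact mul_ne_zero (mul_ne_zero (by exact_mod_cast d.succ_ne_zero) hlc) hu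
      refine ⟨by omega, fun q hq u => le_trans ?_ h1⟩
      have h2 : q.1.natDegree = r.natDegree ∧ q.1.leadingCoeff = r.leadingCoeff := by
        rcases Multiset.mem_cons.1 hq with rfl | hq
        exacts [⟨rfl, rfl⟩, hr q hq]
      have h3 : (taylor u q.1 - taylor h r).natDegree ≤ d + 1 :=
        natDegree_taylor_sub_taylor_le (by omega) (by omega) _ _
      have h4 : (taylor u q.1 - taylor h r).coeff (d + 1) = 0 := by
        rw [coeff_sub, coeff_taylor_of_natDegree_eq (h2.1.trans hpd),
          coeff_taylor_of_natDegree_eq hpd, h2.2, sub_self]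
      by_contra! h5
      have h6 : (taylor u q.1 - taylor h r).natDegree = d + 1 := by omega
      rw [← h6, coeff_natDegree, leadingCoeff_eq_zero] at h4
      rw [h4] at h6
      simp at h6
  refine ⟨(polyShift (taylor h r) h (polyStar ((p, f) ::ₘ L)) + polyShift (taylor h r) h' L).filter
    fun q => 0 < q.1.natDegree, ?_, ?_⟩
  · rw [KoopmanSystem.polyDiff, show polyShift (taylor h r) h' ((p, f) ::ₘ L)
      = (taylor h' p - taylor h r, f) ::ₘ polyShift (taylor h r) h' L by simp [polyShift],
      Multiset.add_cons]
    exact Multiset.filter_cons_of_pos _ hmax.1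
  · have hform : ∀ x ∈ (polyShift (taylor h r) h (polyStar ((p, f) ::ₘ L)) +
        polyShift (taylor h r) h' L).filter fun q => 0 < q.1.natDegree,
        (∃ q ∈ (p, f) ::ₘ L, x.1 = taylor h q.1 - taylor h r) ∨
          ∃ q ∈ L, x.1 = taylor h' q.1 - taylor h r := by
      intro x hx
      rcases Multiset.mem_add.1 (Multiset.mem_of_mem_filter hx) with hx | hx
      · obtain ⟨q₁, hq₁, rfl⟩ := mem_polyShift.1 hx
        obtain ⟨q₂, hq₂, rfl⟩ := mem_polyStar.1 hq₁
        exact Or.inl ⟨q₂, hq₂, rfl⟩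
      · obtain ⟨q, hq, rfl⟩ := mem_polyShift.1 hx
        exact Or.inr ⟨q, hq, rfl⟩
    refine ⟨hmax.1, fun x hx => (Multiset.mem_filter.1 hx).2, fun x hx => ?_, fun x hx => ?_⟩
    · rcases hform x hx with ⟨q, hq, h1⟩ | ⟨q, hq, h1⟩
      · rw [h1]
        exact hmax.2 q hq _
      · rw [h1]
        exact hmax.2 q (Multiset.mem_cons_of_mem hq) _
    · rcases hform x hx with ⟨q, hq, h1⟩ | ⟨q, hq, h1⟩
      · rw [h1, sub_sub_sub_cancel_right, taylor_sub_taylor_eq, natDegree_taylor]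
        exact Nat.pos_of_ne_zero (hbad q hq)
      · rw [h1, sub_sub_sub_cancel_right, ← map_sub, natDegree_taylor]
        exact hL.sub_pos q hq

end KoopmanSystem

/-! ### Polynomial exhaustion: control by the seminorms -/

namespace KoopmanSystem

open Polynomial

variable {F A E : Type*} [Field F] [CommRing A] [StarRing A] [Algebra ℂ A]
    [StarModule ℂ A] [NormedAddCommGroup E] [InnerProductSpace ℂ E] (S : KoopmanSystem F A E)
    [DecidableEq F] {Φ : ℕ → Finset F}

/-- Constant terms are absorbed into the functions, which reduces to `limLe_linear`; the seminorms
do not notice the translation. Nonconstant differences between degree-one polynomials mean different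
linear coefficients. -/
theorem tendsto_avg_polyProd_of_natDegree_eq_one (hΦ : IsFolnerSequence Φ) {p : F[X]} {f : A}
    {L : Multiset (F[X] × A)} (hL : PolyFamily p L) (hp : p.natDegree = 1)
    (hM : ∀ q ∈ (p, f) ::ₘ L, S.Contr q.2) (hf : ∀ s, S.G s f = 0) {w : F → ℂ}
    (hw : ∀ n, ‖w n‖ ≤ 1) :
    Tendsto (fun N => ‖avg ℂ (Φ N) fun n => w n • S.ι (S.polyProd ((p, f) ::ₘ L) n)‖)
      atTop (𝓝 0) := by
  let e : F[X] × A → F × A := fun q => (q.1.coeff 1, S.τ (q.1.coeff 0) q.2)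
  have hdeg : ∀ q ∈ (p, f) ::ₘ L, q.1.natDegree ≤ 1 := by
    intro q hq
    rcases Multiset.mem_cons.1 hq with rfl | hq
    exacts [hp.le, (hL.le_of_mem q hq).trans hp.le]
  have h1 : ∀ n, S.polyProd ((p, f) ::ₘ L) n = S.linProd (e (p, f) ::ₘ L.map e) n := by
    intro n
    rw [polyProd, linProd, ← Multiset.map_cons, Multiset.map_map]
    congr 1
    refine Multiset.map_congr rfl fun q hq => ?_
    rw [Function.comp_apply, ← S.τ_add]
    conv_lhs => rw [eq_X_add_C_of_natDegree_le_one (hdeg q hq)]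
    simp [e]
  have h2 := S.limLe_linear hΦ _ hw (c := p.coeff 1) (f := S.τ (p.coeff 0) f) (L := L.map e)
    (fun h0 => ?_) ((hM _ (Multiset.mem_cons_self _ _)).τ _) ?_ ?_ rfl
  · simp only [h1]
    rw [G_τ, hf] at h2
    have h3 := h2.tendsto_zero fun N => by positivity
    refine ((h3.rpow_const (p := (1 / (2 ^ (((L.map e).map Prod.fst).toFinset.card + 2) : ℕ)))
      (Or.inr (by positivity))).congr fun N => ?_).trans_eq ?_
    · rw [one_div, Real.pow_rpow_inv_natCast (norm_nonneg _) (by positivity)]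
    · rw [Real.zero_rpow (by positivity)]
  · rw [← hp, coeff_natDegree, leadingCoeff_eq_zero] at h0
    simp [h0] at hp
  · intro q hq
    obtain ⟨q₁, hq₁, rfl⟩ := Multiset.mem_map.1 hq
    exact (hM q₁ (Multiset.mem_cons_of_mem hq₁)).τ _
  · intro q hq
    obtain ⟨q₁, hq₁, rfl⟩ := Multiset.mem_map.1 hq
    intro h0
    have h3 := hL.sub_pos q₁ hq₁
    have h4 : (p - q₁.1).natDegree ≤ 1 := by
      have := natDegree_sub_le p q₁.1
      have := hL.le_of_mem q₁ hq₁
      omega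
    have h5 : (p - q₁.1).natDegree = 1 := by omega
    have h6 : (p - q₁.1).coeff 1 = 0 := by
      rw [coeff_sub, sub_eq_zero]
      exact h0.symm
    rw [← h5, coeff_natDegree, leadingCoeff_eq_zero] at h6
    rw [h6] at h5
    simp at h5

/-- Differences of elements of large finite sets rarely lie in a given finite set. -/
theorem _root_.Set.Finite.exists_avg_indicator_le {F : Type*} [AddGroup F] [Infinite F] {B : Set F}
    (hB : B.Finite) {ε : ℝ} (hε : 0 < ε) :
    ∃ H : Finset F, H.Nonempty ∧
      (avg ℝ H fun h => avg ℝ H fun h' => B.indicator 1 (h' - h)) ≤ ε := by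
  classical
  obtain ⟨m, hm⟩ := exists_nat_gt (hB.toFinset.card / ε)
  obtain ⟨H, hH⟩ := Infinite.exists_subset_card_eq F (m + 1)
  have hHne : H.Nonempty := Finset.card_pos.1 (by omega)
  have hpos : (0 : ℝ) < H.card := by exact_mod_cast hHne.card_pos
  refine ⟨H, hHne, avg_le_of_le hHne fun h _ => ?_⟩
  have h1 : ∑ h' ∈ H, B.indicator (1 : F → ℝ) (h' - h) ≤ hB.toFinset.card := by
    rw [← Finset.sum_image (f := fun x => B.indicator (1 : F → ℝ) x) (g := fun h' => h' - h)
      (sub_left_injective.injOn)]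
    simp only [Set.indicator_apply, Pi.one_apply, Finset.sum_ite, Finset.sum_const_zero, add_zero,
      Finset.sum_const, nsmul_eq_mul, mul_one, Nat.cast_le]
    refine Finset.card_le_card fun x hx => ?_
    simpa using (Finset.mem_filter.1 hx).2
  simp only [avg, smul_eq_mul]
  rw [inv_mul_le_iff₀ hpos]
  refine h1.trans ?_
  rw [div_lt_iff₀ hε] at hm
  have : (m : ℝ) ≤ H.card := by
    rw [hH]
    push_cast
    linarith
  nlinarith

/-- Polynomial averages are controlled by the seminorms of a function whose polynomial has maximal
degree, with arbitrary bounded weights. -/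
theorem tendsto_avg_polyProd [CharZero F] (hΦ : IsFolnerSequence Φ) {p : F[X]} {f : A}
    {L : Multiset (F[X] × A)} (hL : PolyFamily p L) (hM : ∀ q ∈ (p, f) ::ₘ L, S.Contr q.2)
    (hf : ∀ s, S.G s f = 0) {w : F → ℂ} (hw : ∀ n, ‖w n‖ ≤ 1) :
    Tendsto (fun N => ‖avg ℂ (Φ N) fun n => w n • S.ι (S.polyProd ((p, f) ::ₘ L) n)‖)
      atTop (𝓝 0) := by
  classical
  obtain ⟨D, hD⟩ : ∃ D, p.natDegree ≤ D := ⟨_, le_rfl⟩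
  -- The weight counts leading coefficients degree by degree, compared from the highest degree down.
  -- A fixed bound `D` on the degrees keeps the index set finite throughout the induction.
  have wf : WellFounded (Pi.Lex (· > ·) (· < ·) : (Fin (D + 1) → ℕ) → (Fin (D + 1) → ℕ) → Prop) :=
    Pi.Lex.wellFounded _ fun _ => wellFounded_lt
  obtain ⟨W, hW⟩ : ∃ W : Fin (D + 1) → ℕ, W = fun j : Fin (D + 1) => (leads ((p, f) ::ₘ L) j).card := ⟨_, rfl⟩
  induction W using wf.induction generalizing p L w with
  | _ W ih =>
  have hp1 := hL.pos
  rcases (show p.natDegree = 1 ∨ 2 ≤ p.natDegree by omega) with hd | hd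
  · exact S.tendsto_avg_polyProd_of_natDegree_eq_one hΦ hL hd hM hf hw
  obtain ⟨r, hrM, hmin, hr0, hr⟩ := hL.exists_pivot (f := f)
  -- The bad differences `h' - h`, at most one for each member. For these the correlation is bounded
  -- trivially by one; for all others the induction hypothesis makes it vanish. Since `F` is
  -- infinite, bad pairs can be made arbitrarily rare.
  let B : Set F := ⋃ q ∈ ((p, f) ::ₘ L).toFinset.image Prod.fst,
    {u : F | (taylor u p - q).natDegree = 0}
  have hB : B.Finite := Set.Finite.biUnion (Finset.finite_toSet _) fun q _ =>
    (subsingleton_natDegree_taylor_sub_eq_zero hd q).finite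
  have hv : ∀ n, ‖w n • S.ι (S.polyProd ((p, f) ::ₘ L) n)‖ ≤ 1 := by
    intro n
    rw [norm_smul]
    exact mul_le_one₀ (hw n) (norm_nonneg _) (Contr.polyProd hM n).norm_ι_le
  have hpair : ∀ h h', LimLe (fun N => ‖avg ℂ (Φ N) fun n =>
      inner ℂ (w (n + h) • S.ι (S.polyProd ((p, f) ::ₘ L) (n + h)))
        (w (n + h') • S.ι (S.polyProd ((p, f) ::ₘ L) (n + h')))‖)
      (B.indicator 1 (h' - h)) := by
    intro h h'
    by_cases hh : h' - h ∈ B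
    · rw [Set.indicator_of_mem hh]
      refine LimLe.of_le fun N => norm_avg_le_of_le zero_le_one fun n _ => ?_
      exact (norm_inner_le_norm _ _).trans (mul_le_one₀ (hv _) (norm_nonneg _) (hv _))
    · rw [Set.indicator_of_notMem hh]
      have hbad : ∀ q ∈ (p, f) ::ₘ L, (taylor (h' - h) p - q.1).natDegree ≠ 0 := by
        intro q hq h0
        refine hh (Set.mem_biUnion (x := q.1) ?_ h0)
        exact Finset.mem_coe.2 (Finset.mem_image.2 ⟨q, Multiset.mem_toFinset.2 hq, rfl⟩)
      obtain ⟨L', hL'eq, hL'⟩ := hL.polyDiff (f := f) hd hr hbad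
      have hM' : ∀ q ∈ (taylor h' p - taylor h r, f) ::ₘ L', S.Contr q.2 := by
        rw [← hL'eq]
        exact fun q hq => contr_polyShift_add hM _ h h' q (Multiset.mem_of_mem_filter hq)
      have hrp : r.natDegree ≤ p.natDegree := hmin (p, f) (by simp)
      have hlex : Pi.Lex (· > ·) (· < ·)
          (fun j : Fin (D + 1) => (leads ((taylor h' p - taylor h r, f) ::ₘ L') j).card) W := by
        rw [hW, ← hL'eq]
        refine ⟨⟨r.natDegree, by omega⟩, fun j hj => ?_, ?_⟩
        · exact congrArg _ (leads_polyDiff_of_lt (show r.natDegree < (j : ℕ) from hj))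
        · exact card_leads_polyDiff_lt hrM hmin hr0
      have := ih _ hlex hL' hM' (w := fun n => star (w (n + h)) * w (n + h'))
        (fun n => by
          rw [norm_mul, norm_star]
          exact mul_le_one₀ (hw _) (norm_nonneg _) (hw _))
        ((natDegree_taylor_sub_taylor_le le_rfl hrp _ _).trans hD) rfl
      refine (LimLe.of_tendsto this).mono (fun N => ?_) le_rfl
      rw [← hL'eq]
      exact S.norm_avg_inner_polyProd_le _ _ w _ _ _ hM
  have hsq : LimLe (fun N =>
      ‖avg ℂ (Φ N) fun n => w n • S.ι (S.polyProd ((p, f) ::ₘ L) n)‖ ^ 2) 0 := by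
    refine LimLe.of_forall_pos fun ε hε => ?_
    have : Infinite F := CharZero.infinite F
    obtain ⟨H, hH, hle⟩ := hB.exists_avg_indicator_le hε
    rw [zero_add]
    exact (hΦ.vanDerCorput (𝕜 := ℂ) hv hH _ fun h _ h' _ => hpair h h').mono (fun _ => le_rfl) hle
  have := (hsq.tendsto_zero fun N => sq_nonneg _).sqrt
  simpa [Real.sqrt_sq] using this

end KoopmanSystem

/-! ### Averages over tuples and pairs of tuples -/

section IteratedAverages

variable {F E : Type*}

/-- The average of a function of tuples over a product of finite sets. -/
noncomputable def tupleAvg (𝕜 : Type*) [Field 𝕜] [AddCommMonoid E] [Module 𝕜 E] :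
    List (Finset F) → (List F → E) → E
  | [], φ => φ []
  | H :: L, φ => avg 𝕜 H fun h => tupleAvg 𝕜 L fun t => φ (h :: t)

/-- The average of a function of pairs of tuples over the square of a product of finite sets. -/
noncomputable def tupleAvg₂ : List (Finset F) → (List F → List F → ℝ) → ℝ
  | [], φ => φ [] []
  | H :: L, φ => avg ℝ H fun h => avg ℝ H fun h' => tupleAvg₂ L fun t t' => φ (h :: t) (h' :: t')

section

variable {𝕜 : Type*} [Field 𝕜] [AddCommGroup E] [Module 𝕜 E]

theorem tupleAvg_congr {L : List (Finset F)} {φ ψ : List F → E}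
    (h : ∀ t : List F, t.length = L.length → φ t = ψ t) : tupleAvg 𝕜 L φ = tupleAvg 𝕜 L ψ := by
  induction L generalizing φ ψ with
  | nil => exact h [] rfl
  | cons H L ih => exact avg_congr fun x _ => ih fun t ht => h _ (by simp [ht])

theorem avg_tupleAvg {ι : Type*} (H : Finset ι) (L : List (Finset F)) (φ : ι → List F → E) :
    (avg 𝕜 H fun i => tupleAvg 𝕜 L (φ i)) = tupleAvg 𝕜 L fun t => avg 𝕜 H fun i => φ i t := by
  induction L generalizing φ with
  | nil => rfl
  | cons H' L ih =>
    simp only [tupleAvg]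
    rw [avg_comm]
    exact avg_congr fun h _ => ih _

end

theorem tupleAvg_mono {L : List (Finset F)} {φ ψ : List F → ℝ}
    (h : ∀ t : List F, t.length = L.length → φ t ≤ ψ t) : tupleAvg ℝ L φ ≤ tupleAvg ℝ L ψ := by
  induction L generalizing φ ψ with
  | nil => exact h [] rfl
  | cons H L ih => exact avg_le_avg fun x _ => ih fun t ht => h _ (by simp [ht])

theorem pow_tupleAvg_le {L : List (Finset F)} {φ : List F → ℝ} (h : ∀ t, 0 ≤ φ t) {n : ℕ}
    (hn : n ≠ 0) : tupleAvg ℝ L φ ^ n ≤ tupleAvg ℝ L fun t => φ t ^ n := by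
  have h0 : ∀ (L : List (Finset F)) (φ : List F → ℝ), (∀ t, 0 ≤ φ t) → 0 ≤ tupleAvg ℝ L φ := by
    intro L
    induction L with
    | nil => exact fun φ h => h []
    | cons H L ih => exact fun φ h => avg_nonneg fun x _ => ih _ fun t => h _
  induction L generalizing φ with
  | nil => exact le_rfl
  | cons H L ih =>
    exact (pow_avg_le_avg_pow (fun x _ => h0 _ _ fun t => h _) hn).trans
      (avg_le_avg fun x _ => ih fun t => h _)

theorem norm_tupleAvg_le (L : List (Finset F)) (φ : List F → ℂ) :
    ‖tupleAvg ℂ L φ‖ ≤ tupleAvg ℝ L fun t => ‖φ t‖ := by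
  induction L generalizing φ with
  | nil => exact le_rfl
  | cons H L ih => exact (norm_avg_le _ _).trans (avg_le_avg fun h _ => ih _)

theorem re_tupleAvg (L : List (Finset F)) (φ : List F → ℂ) :
    (tupleAvg ℂ L φ).re = tupleAvg ℝ L fun t => (φ t).re := by
  induction L generalizing φ with
  | nil => rfl
  | cons H L ih => exact (re_avg (𝕜 := ℂ) _ _).trans (avg_congr fun h _ => ih _)

theorem tendsto_avg {ι κ 𝕜 : Type*} [RCLike 𝕜] {l : Filter κ} {H : Finset ι} {φ : κ → ι → 𝕜}
    {a : ι → 𝕜} (h : ∀ i ∈ H, Tendsto (fun k => φ k i) l (𝓝 (a i))) :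
    Tendsto (fun k => avg 𝕜 H (φ k)) l (𝓝 (avg 𝕜 H a)) :=
  (tendsto_finsetSum _ h).const_smul _

theorem tendsto_tupleAvg {κ : Type*} {l : Filter κ} {L : List (Finset F)} {φ : κ → List F → ℂ}
    {a : List F → ℂ} (h : ∀ t, Tendsto (fun k => φ k t) l (𝓝 (a t))) :
    Tendsto (fun k => tupleAvg ℂ L (φ k)) l (𝓝 (tupleAvg ℂ L a)) := by
  induction L generalizing φ a with
  | nil => exact h []
  | cons H L ih => exact tendsto_avg fun x _ => ih fun t => h _

theorem tendsto_tupleAvg₂ {κ : Type*} {l : Filter κ} {L : List (Finset F)}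
    {φ : κ → List F → List F → ℝ} {a : List F → List F → ℝ}
    (h : ∀ t t' : List F, t.length = t'.length → Tendsto (fun k => φ k t t') l (𝓝 (a t t'))) :
    Tendsto (fun k => tupleAvg₂ L (φ k)) l (𝓝 (tupleAvg₂ L a)) := by
  induction L generalizing φ a with
  | nil => exact h [] [] rfl
  | cons H L ih =>
    exact tendsto_avg fun x _ => tendsto_avg fun y _ => ih fun t t' ht => h _ _ (by simp [ht])

theorem tupleAvg₂_mono {L : List (Finset F)} {φ ψ : List F → List F → ℝ}
    (h : ∀ t t' : List F, t.length = L.length → t'.length = L.length → φ t t' ≤ ψ t t') :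
    tupleAvg₂ L φ ≤ tupleAvg₂ L ψ := by
  induction L generalizing φ ψ with
  | nil => exact h [] [] rfl rfl
  | cons H L ih =>
    exact avg_le_avg fun x _ => avg_le_avg fun y _ =>
      ih fun t t' ht ht' => h _ _ (by simp [ht]) (by simp [ht'])

theorem tupleAvg₂_nonneg (L : List (Finset F)) {φ : List F → List F → ℝ}
    (h : ∀ t t', 0 ≤ φ t t') : 0 ≤ tupleAvg₂ L φ := by
  induction L generalizing φ with
  | nil => exact h [] []
  | cons H L ih => exact avg_nonneg fun x _ => avg_nonneg fun y _ => ih fun t t' => h _ _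

theorem pow_tupleAvg₂_le (L : List (Finset F)) {φ : List F → List F → ℝ}
    (h : ∀ t t', 0 ≤ φ t t') {n : ℕ} (hn : n ≠ 0) :
    tupleAvg₂ L φ ^ n ≤ tupleAvg₂ L fun t t' => φ t t' ^ n := by
  induction L generalizing φ with
  | nil => exact le_rfl
  | cons H L ih =>
    refine (pow_avg_le_avg_pow (fun x _ => avg_nonneg fun y _ =>
      tupleAvg₂_nonneg _ fun t t' => h _ _) hn).trans (avg_le_avg fun x _ => ?_)
    exact (pow_avg_le_avg_pow (fun y _ => tupleAvg₂_nonneg _ fun t t' => h _ _) hn).trans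
      (avg_le_avg fun y _ => ih fun t t' => h _ _)

theorem avg_tupleAvg₂ {ι : Type*} (H : Finset ι) (L : List (Finset F))
    (φ : ι → List F → List F → ℝ) :
    (avg ℝ H fun i => tupleAvg₂ L (φ i)) = tupleAvg₂ L fun t t' => avg ℝ H fun i => φ i t t' := by
  induction L generalizing φ with
  | nil => rfl
  | cons H' L ih =>
    simp only [tupleAvg₂]
    rw [avg_comm]
    refine avg_congr fun h _ => ?_
    rw [avg_comm]
    exact avg_congr fun h _ => ih _

/-- Pigeonhole one coordinate at a time: the base vertex of the cubes can be frozen without loss. -/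
theorem exists_le_tupleAvg_of_le_tupleAvg₂ {L : List (Finset F)} (hL : ∀ H ∈ L, H.Nonempty)
    {φ : List F → List F → ℝ} {c : ℝ} (h : c ≤ tupleAvg₂ L φ) :
    ∃ t' : List F, t'.length = L.length ∧ c ≤ tupleAvg ℝ L fun t => φ t t' := by
  induction L generalizing φ with
  | nil => exact ⟨[], rfl, h⟩
  | cons H L ih =>
    rw [tupleAvg₂, avg_comm] at h
    obtain ⟨h', -, hh'⟩ := exists_le_of_le_avg (hL H (by simp)) h
    rw [avg_tupleAvg₂] at hh'
    obtain ⟨t', ht', hle⟩ := ih (fun H' hH' => hL H' (by simp [hH'])) hh'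
    exact ⟨h' :: t', by simp [ht'], hle.trans_eq (avg_tupleAvg _ _ _).symm⟩

end IteratedAverages

/-! ### Cube products and the Gowers–Cauchy–Schwarz inequality -/

section CubeProduct

variable {F B : Type*} [CommRing B] [StarRing B]

/-- The product of the values of `a`, with alternating conjugations, at the vertices of the
discrete cube with coordinates in `t` and `t'`. -/
def cubeProd : List F → List F → (List F → B) → B
  | [], [], a => a []
  | h :: t, h' :: t', a => cubeProd t t' fun s => a (h :: s) * star (a (h' :: s))
  -- Default values for tuples of different lengths, chosen so that the product remains
  -- multiplicative in `a`.
  | [], _ :: _, _ => 1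
  | _ :: _, [], _ => 1

theorem cubeProd_mul (t t' : List F) (a b : List F → B) :
    cubeProd t t' (fun s => a s * b s) = cubeProd t t' a * cubeProd t t' b := by
  induction t generalizing t' a b with
  | nil => cases t' <;> simp [cubeProd]
  | cons h t ih =>
    cases t' with
    | nil => simp [cubeProd]
    | cons h' t' =>
      simp only [cubeProd]
      rw [← ih]
      congr 1
      ext s
      rw [star_mul]
      ring

theorem map_cubeProd {B' L : Type*} [CommRing B'] [StarRing B'] [FunLike L B B']
    [RingHomClass L B B'] [StarHomClass L B B'] (φ : L) (t t' : List F) (a : List F → B) :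
    φ (cubeProd t t' a) = cubeProd t t' fun s => φ (a s) := by
  induction t generalizing t' a with
  | nil => cases t' <;> simp [cubeProd]
  | cons h t ih => cases t' <;> simp [cubeProd, ih, map_star]

theorem cubeProd_prod {κ : Type*} (T : Finset κ) (t t' : List F) (a : κ → List F → B) :
    cubeProd t t' (fun s => ∏ j ∈ T, a j s) = ∏ j ∈ T, cubeProd t t' (a j) := by
  classical
  have h1 : cubeProd t t' (fun _ => (1 : B)) = 1 := by
    induction t generalizing t' with
    | nil => cases t' <;> simp [cubeProd]
    | cons h t ih => cases t' <;> simp [cubeProd, ih]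
  induction T using Finset.induction_on with
  | empty => simpa using h1
  | insert j T hj ih => simp only [Finset.prod_insert hj, cubeProd_mul, ih]

/-- A multiplicative class of elements which is stable under `star`. -/
structure IsStarMultiplicative (P : B → Prop) : Prop where
  one : P 1
  mul : ∀ {a b}, P a → P b → P (a * b)
  star : ∀ {a}, P a → P (star a)

theorem IsStarMultiplicative.cubeProd {P : B → Prop} (hP : IsStarMultiplicative P)
    {a : List F → B} (ha : ∀ s, P (a s)) (t t' : List F) : P (cubeProd t t' a) := by
  induction t generalizing t' a with
  | nil => cases t' <;> simp [_root_.cubeProd, ha, hP.one]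
  | cons h t ih =>
    cases t' with
    | nil => simp [_root_.cubeProd, hP.one]
    | cons h' t' => exact ih (fun s => hP.mul (ha _) (hP.star (ha _))) t'

/-- `b` is a product of functions of `r`-tuples with values in `P`, the `i`-th of which does not
depend on the `i`-th coordinate. -/
def IsNegligible (P : B → Prop) : ℕ → (List F → B) → Prop
  | 0, b => b [] = 1
  | r + 1, b => ∃ (b₀ : List F → B) (b₁ : F → List F → B), (∀ t, P (b₀ t)) ∧
      (∀ h, IsNegligible P r (b₁ h)) ∧ ∀ h t, b (h :: t) = b₀ t * b₁ h t

namespace IsNegligible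

variable {P : B → Prop} {r : ℕ} {b b' : List F → B}

theorem mul (hP : IsStarMultiplicative P) (hb : IsNegligible P r b) (hb' : IsNegligible P r b') :
    IsNegligible P r fun t => b t * b' t := by
  induction r generalizing b b' with
  | zero => simp_all [IsNegligible]
  | succ r ih =>
    obtain ⟨b₀, b₁, h0, h1, h2⟩ := hb
    obtain ⟨b₀', b₁', h0', h1', h2'⟩ := hb'
    refine ⟨fun t => b₀ t * b₀' t, fun h t => b₁ h t * b₁' h t, fun t => hP.mul (h0 t) (h0' t),
      fun h => ih (h1 h) (h1' h), fun h t => ?_⟩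
    simp only [h2, h2']
    ring

theorem star (hP : IsStarMultiplicative P) (hb : IsNegligible P r b) :
    IsNegligible P r fun t => star (b t) := by
  induction r generalizing b with
  | zero => simp_all [IsNegligible]
  | succ r ih =>
    obtain ⟨b₀, b₁, h0, h1, h2⟩ := hb
    refine ⟨fun t => Star.star (b₀ t), fun h t => Star.star (b₁ h t), fun t => hP.star (h0 t),
      fun h => ih (h1 h), fun h t => ?_⟩
    simp only [h2, star_mul]
    exact mul_comm _ _

omit [StarRing B] in
theorem map {B' L : Type*} [CommRing B'] [FunLike L B B'] [RingHomClass L B B']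
    {P' : B' → Prop} (φ : L) (hφ : ∀ a, P a → P' (φ a)) (hb : IsNegligible P r b) :
    IsNegligible P' r fun t => φ (b t) := by
  induction r generalizing b with
  | zero => simp_all [IsNegligible]
  | succ r ih =>
    obtain ⟨b₀, b₁, h0, h1, h2⟩ := hb
    exact ⟨fun t => φ (b₀ t), fun h t => φ (b₁ h t), fun t => hφ _ (h0 t), fun h => ih (h1 h),
      fun h t => by simp only [h2, map_mul]⟩

theorem mem (hP : IsStarMultiplicative P) (hb : IsNegligible P r b) {t : List F}
    (ht : t.length = r) : P (b t) := by
  induction r generalizing b t with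
  | zero =>
    obtain rfl := List.length_eq_zero_iff.1 ht
    rw [show b [] = 1 from hb]
    exact hP.one
  | succ r ih =>
    obtain ⟨b₀, b₁, h0, h1, h2⟩ := hb
    cases t with
    | nil => simp at ht
    | cons h t =>
      rw [h2]
      exact hP.mul (h0 t) (ih (h1 h) (by simpa using ht))

end IsNegligible

/-- As a function of `t`, the cube product is the value at the top vertex `t`, up to a negligible
factor. -/
theorem exists_cubeProd_eq {P : B → Prop} (hP : IsStarMultiplicative P) (t' : List F)
    {a : List F → B} (ha : ∀ s, P (a s)) :
    ∃ b : List F → B, IsNegligible P t'.length b ∧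
      ∀ t : List F, t.length = t'.length → cubeProd t t' a = a t * b t := by
  induction t' generalizing a with
  | nil =>
    refine ⟨fun _ => 1, rfl, fun t ht => ?_⟩
    obtain rfl := List.length_eq_zero_iff.1 ht
    simp [cubeProd]
  | cons h' t' ih =>
    choose b hb hb' using fun h => ih (a := fun s => a (h :: s)) fun s => ha _
    -- The vertices whose first coordinate is `h'` form a factor that does not involve `h`; the
    -- remaining vertices are handled recursively.
    let b₀ : List F → B := fun t => cubeProd t t' fun s => star (a (h' :: s))
    let c : List F → B := fun
      | [] => 1
      | h :: t => b₀ t * b h t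
    refine ⟨c, ⟨b₀, b, fun t => hP.cubeProd (fun s => hP.star (ha _)) _ _, hb, fun h t => rfl⟩, ?_⟩
    intro t ht
    cases t with
    | nil => simp at ht
    | cons h t =>
      rw [cubeProd, cubeProd_mul, hb' h t (by simpa using ht)]
      simp only [c, b₀]
      ring

/-- The Gowers–Cauchy–Schwarz inequality eliminating negligible factors. -/
theorem norm_tupleAvg_pow_le [Algebra ℂ B] [StarModule ℂ B] {P : B → Prop}
    (hP : IsStarMultiplicative P)
    {Λ : B →ₗ[ℂ] ℂ} (hΛ : ∀ b y, P b → ‖Λ (b * y)‖ ^ 2 ≤ (Λ (y * star y)).re)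
    (L : List (Finset F)) (a b : List F → B) (hb : IsNegligible P L.length b) :
    ‖tupleAvg ℂ L fun t => Λ (a t * b t)‖ ^ (2 ^ L.length)
      ≤ tupleAvg₂ L fun t t' => ‖Λ (cubeProd t t' a)‖ := by
  induction L generalizing a b with
  | nil =>
    have : b [] = 1 := hb
    simp [tupleAvg, tupleAvg₂, cubeProd, this]
  | cons H L ih =>
    obtain ⟨b₀, b₁, h0, h1, h2⟩ := hb
    -- Averaging over the first coordinate inside lets Cauchy–Schwarz discard `b₀`, which does not
    -- see it, at the price of doubling that coordinate. The remaining factor `b₁ h * star (b₁ h')`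
    -- is negligible in one variable fewer.
    let Y : List F → B := fun t => avg ℂ H fun h => a (h :: t) * b₁ h t
    let x : F → F → ℂ := fun h h' => tupleAvg ℂ L fun t =>
      Λ ((a (h :: t) * star (a (h' :: t))) * (b₁ h t * star (b₁ h' t)))
    have e1 : (tupleAvg ℂ (H :: L) fun t => Λ (a t * b t))
        = tupleAvg ℂ L fun t => Λ (b₀ t * Y t) := by
      rw [tupleAvg, avg_tupleAvg]
      refine tupleAvg_congr fun t _ => ?_
      rw [show Λ (b₀ t * Y t) = (Λ ∘ₗ LinearMap.mulLeft ℂ (b₀ t)) (Y t) from rfl, map_avg]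
      refine avg_congr fun h _ => ?_
      rw [h2]
      simp only [LinearMap.comp_apply, LinearMap.mulLeft_apply]
      congr 1
      ring
    have e2 : (tupleAvg ℝ L fun t => (Λ (Y t * star (Y t))).re)
        = avg ℝ H fun h => avg ℝ H fun h' => (x h h').re := by
      simp only [x, re_tupleAvg]
      have : ∀ t, (Λ (Y t * star (Y t))).re = avg ℝ H fun h => avg ℝ H fun h' =>
          (Λ ((a (h :: t) * star (a (h' :: t))) * (b₁ h t * star (b₁ h' t)))).re := by
        intro t
        have e3 : Y t * star (Y t) = avg ℂ H fun h => avg ℂ H fun h' =>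
            (a (h :: t) * star (a (h' :: t))) * (b₁ h t * star (b₁ h' t)) := by
          have e4 : star (Y t) = avg ℂ H fun h => star (a (h :: t) * b₁ h t) := by
            simp [Y, avg, star_smul, star_sum]
          rw [e4, show Y t * avg ℂ H (fun h => star (a (h :: t) * b₁ h t))
            = LinearMap.mulRight ℂ (avg ℂ H (fun h => star (a (h :: t) * b₁ h t))) (Y t) from rfl,
            map_avg]
          refine avg_congr fun h _ => ?_
          rw [LinearMap.mulRight_apply, ← LinearMap.mulLeft_apply (R := ℂ), map_avg]
          refine avg_congr fun h' _ => ?_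
          rw [LinearMap.mulLeft_apply, star_mul]
          ring
        rw [e3, map_avg, ← RCLike.re_to_complex, re_avg]
        refine avg_congr fun h _ => ?_
        rw [map_avg, re_avg]
        rfl
      simp only [this]
      rw [← avg_tupleAvg]
      refine avg_congr fun h _ => ?_
      rw [← avg_tupleAvg]
    have e5 : ‖tupleAvg ℂ (H :: L) fun t => Λ (a t * b t)‖ ^ 2
        ≤ avg ℝ H fun h => avg ℝ H fun h' => ‖x h h'‖ := by
      rw [e1]
      calc _ ≤ (tupleAvg ℝ L fun t => ‖Λ (b₀ t * Y t)‖) ^ 2 := by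
            gcongr
            exact norm_tupleAvg_le _ _
        _ ≤ tupleAvg ℝ L fun t => ‖Λ (b₀ t * Y t)‖ ^ 2 :=
            pow_tupleAvg_le (fun _ => norm_nonneg _) two_ne_zero
        _ ≤ tupleAvg ℝ L fun t => (Λ (Y t * star (Y t))).re :=
            tupleAvg_mono fun t _ => hΛ _ _ (h0 t)
        _ = avg ℝ H fun h => avg ℝ H fun h' => (x h h').re := e2
        _ ≤ _ := avg_le_avg fun h _ => avg_le_avg fun h' _ => Complex.re_le_norm _
    rw [List.length_cons, pow_succ', pow_mul]
    have hpos : 2 ^ L.length ≠ 0 := by positivity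
    calc _ ≤ (avg ℝ H fun h => avg ℝ H fun h' => ‖x h h'‖) ^ (2 ^ L.length) :=
          pow_le_pow_left₀ (sq_nonneg _) e5 _
      _ ≤ avg ℝ H fun h => avg ℝ H fun h' => ‖x h h'‖ ^ (2 ^ L.length) :=
          (pow_avg_le_avg_pow (fun h _ => avg_nonneg fun h' _ => norm_nonneg _) hpos).trans
            (avg_le_avg fun h _ => pow_avg_le_avg_pow (fun h' _ => norm_nonneg _) hpos)
      _ ≤ _ := avg_le_avg fun h _ => avg_le_avg fun h' _ =>
          ih _ _ ((h1 h).mul hP ((h1 h').star hP))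

end CubeProduct

/-! ### Eigenfunction classes and cube products of translates -/

namespace KoopmanSystem

variable {F A E : Type*} [AddCommGroup F] [CommRing A] [StarRing A] [Algebra ℂ A]
    [StarModule ℂ A] [NormedAddCommGroup E] [InnerProductSpace ℂ E] (S : KoopmanSystem F A E)

theorem isStarMultiplicative_contr : IsStarMultiplicative S.Contr :=
  ⟨Contr.one, fun ha hb => ha.mul hb, fun ha => ha.star⟩

theorem norm_Λ_mul_sq_le {b : A} (hb : S.Contr b) (y : A) :
    ‖S.Λ (b * y)‖ ^ 2 ≤ (S.Λ (y * star y)).re := by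
  have h : (S.Λ (y * star y)).re = ‖S.ι y‖ ^ 2 := by
    rw [mul_comm, ← S.norm_ι_sq, ← Complex.ofReal_pow, Complex.ofReal_re]
  rw [h]
  exact pow_le_pow_left₀ (norm_nonneg _) (hb.norm_Λ_mul_le y) 2

/-- The average over `H` of the integrals of a family of elements of `A`. -/
noncomputable def avgΛ (H : Finset F) : (F → A) →ₗ[ℂ] ℂ where
  toFun y := avg ℂ H fun n => S.Λ (y n)
  map_add' x y := by simp only [Pi.add_apply, map_add, avg_add]
  map_smul' c y := by simp only [Pi.smul_apply, map_smul, avg_smul, RingHom.id_apply]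

theorem avgΛ_apply (H : Finset F) (y : F → A) : S.avgΛ H y = avg ℂ H fun n => S.Λ (y n) := rfl

theorem isStarMultiplicative_forall_contr :
    IsStarMultiplicative fun y : F → A => ∀ n, S.Contr (y n) :=
  ⟨fun _ => Contr.one, fun ha hb n => (ha n).mul (hb n), fun ha n => (ha n).star⟩

theorem norm_avgΛ_mul_sq_le (H : Finset F) (b y : F → A) (hb : ∀ n, S.Contr (b n)) :
    ‖S.avgΛ H (b * y)‖ ^ 2 ≤ (S.avgΛ H (y * star y)).re := by
  rw [avgΛ_apply, avgΛ_apply, ← RCLike.re_to_complex, re_avg]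
  calc _ ≤ (avg ℝ H fun n => ‖S.Λ (b n * y n)‖) ^ 2 := by
        gcongr
        exact norm_avg_le _ _
    _ ≤ avg ℝ H fun n => ‖S.Λ (b n * y n)‖ ^ 2 :=
        pow_avg_le_avg_pow (fun _ _ => norm_nonneg _) two_ne_zero
    _ ≤ _ := avg_le_avg fun n _ => S.norm_Λ_mul_sq_le (hb n) _

/-- A class of unimodular elements closed under multiplication, those with nonzero integral being
scalars, transforming under the action by characters, and controlling the averages `S.G 1`. -/
structure IsEigenClass (Eig : A → Prop) : Prop where
  mul_star_self : ∀ {χ}, Eig χ → χ * star χ = 1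
  isStarMultiplicative : IsStarMultiplicative Eig
  map_τ : ∀ {χ}, Eig χ → ∀ g, Eig (S.τ g χ)
  exists_character : ∀ {χ}, Eig χ → ∃ z : F → ℂ,
    (∀ g b, S.ι (S.τ g χ * b) = z g • S.ι (χ * b)) ∧ (S.Λ χ = 0 → ∃ g, z g ≠ 1)
  exists_Λ_mul : ∀ {χ}, Eig χ → S.Λ χ ≠ 0 → ∃ κ : ℂ, ∀ a, S.Λ (a * χ) = κ * S.Λ a
  exists_G_one_le : ∀ f, S.Contr f → ∃ χ, Eig χ ∧ S.G 1 f ≤ ‖S.Λ (f * χ)‖ ^ 2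

variable {S} in
theorem contr_of_mul_star_self {χ : A} (h : χ * star χ = 1) : S.Contr χ := fun b =>
  (S.norm_ι_eq (by rw [star_mul, show star b * star χ * (χ * b) = χ * star χ * (star b * b) by ring,
    h, one_mul])).le

/-- Successive shifts add up, so the vertex `s` of the cube carries the translate of `f` by the sum
of its coordinates. -/
theorem iterAvg_eq_tupleAvg₂ (q : A → ℝ) (L : List (Finset F)) (f : A) :
    S.iterAvg q L f = tupleAvg₂ L fun t t' => q (cubeProd t t' fun s => S.τ s.sum f) := by
  induction L generalizing f with
  | nil => simp [iterAvg, tupleAvg₂, cubeProd, S.τ_zero]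
  | cons H L ih =>
    simp only [iterAvg, tupleAvg₂, ih, cubeProd, List.sum_cons, map_mul, map_star, ← S.τ_add]
    simp only [add_comm]

theorem isStarMultiplicative_norm_le_one : IsStarMultiplicative fun c : ℂ => ‖c‖ ≤ 1 :=
  ⟨by simp, fun ha hb => by simpa using mul_le_one₀ ha (norm_nonneg _) hb, fun ha => by simpa⟩

-- All vertices other than the top one contribute factors of modulus at most one.
omit [AddCommGroup F] in
theorem norm_cubeProd_le {c : List F → ℂ} (hc : ∀ s, ‖c s‖ ≤ 1) {t t' : List F}
    (ht : t.length = t'.length) : ‖cubeProd t t' c‖ ≤ ‖c t‖ := by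
  obtain ⟨b, hb, hb'⟩ := exists_cubeProd_eq isStarMultiplicative_norm_le_one t' hc
  rw [hb' t ht, norm_mul]
  exact mul_le_of_le_one_right (norm_nonneg _) (hb.mem isStarMultiplicative_norm_le_one ht)

omit [AddCommGroup F] in
theorem cubeProd_algebraMap_mul (c : List F → ℂ) (a : List F → A) (t t' : List F) :
    cubeProd t t' (fun s => algebraMap ℂ A (c s) * a s)
      = algebraMap ℂ A (cubeProd t t' c) * cubeProd t t' a := by
  rw [cubeProd_mul]
  congr 1
  exact (map_cubeProd (StarAlgHom.ofId ℂ A) t t' c).symm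

end KoopmanSystem

/-! ### Degree lowering for dual functions -/

namespace KoopmanSystem

variable {F A E : Type*} [AddCommGroup F] [CommRing A] [StarRing A] [Algebra ℂ A]
    [StarModule ℂ A] [NormedAddCommGroup E] [InnerProductSpace ℂ E] (S : KoopmanSystem F A E)

variable {S}

/-- Under the integral such a `χ` acts as a scalar, whose modulus is at most one because `χ` is a
contraction. -/
theorem IsEigenClass.norm_Λ_le {Eig : A → Prop} (hEig : S.IsEigenClass Eig) {χ : A} (hχ : Eig χ)
    (hΛ : S.Λ χ ≠ 0) (a : A) : ‖S.Λ (a * χ)‖ ≤ ‖S.Λ a‖ := by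
  obtain ⟨κ, hκ⟩ := hEig.exists_Λ_mul hχ hΛ
  have h1 : ‖κ‖ ≤ 1 := by
    have := hκ 1
    rw [one_mul, S.Λ_one, mul_one] at this
    exact this ▸ (contr_of_mul_star_self (hEig.mul_star_self hχ)).norm_Λ_le
  rw [hκ, norm_mul]
  exact mul_le_of_le_one_left (norm_nonneg _) h1

/-- The correlations of the cube products of `f₀` with the eigenfunctions, when `f₀` is a weak limit
of the averages of `τ (-a n) (g N * u n)`. -/
theorem norm_tupleAvg_pow_le_of_tendsto {Eig : A → Prop} (hEig : S.IsEigenClass Eig)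
    {U : Filter ℕ} [U.NeBot] {Φ : ℕ → Finset F} {a : F → F} {u : F → A}
    (hu : ∀ n, S.Contr (u n)) {g : ℕ → A} (hg : ∀ N, S.Contr (g N)) {f₀ : A}
    (hdual : ∀ x, Tendsto (fun N => avg ℂ (Φ N) fun n => S.Λ (g N * u n * S.τ (a n) x)) U
      (𝓝 (S.Λ (f₀ * x))))
    (hequi : ∀ t t' : List F, t.length = t'.length → ∀ g' : ℕ → A, (∀ N, S.Contr (g' N)) →
      ∀ χ, Eig χ → S.Λ χ = 0 → Tendsto (fun N => avg ℂ (Φ N) fun n =>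
        S.Λ (g' N * cubeProd t t' (fun s => S.τ s.sum (u n)) * S.τ (a n) χ)) U (𝓝 0))
    (L : List (Finset F)) {b χ : List F → A} (hb : IsNegligible S.Contr L.length b)
    (hχ : ∀ t, Eig (χ t)) {c : List F → ℂ} (hc : ∀ t, ‖c t‖ ≤ 1) :
    ‖tupleAvg ℂ L fun t => c t * S.Λ (S.τ t.sum f₀ * (b t * χ t))‖ ^ (2 ^ L.length)
      ≤ tupleAvg₂ L fun t t' => if S.Λ (cubeProd t t' χ) = 0 then 0 else ‖c t‖ := by
  classical
  -- Gowers–Cauchy–Schwarz is applied to sequences indexed by `n`, with the functional `avgΛ`. After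
  -- `f₀` is unfolded into its defining averages, the main factor `α` contains `g`, `u` and `χ`,
  -- while `b`, moved by `τ (a n)`, remains negligible.
  let α : ℕ → List F → F → A := fun N t n =>
    algebraMap ℂ A (c t) * (S.τ t.sum (g N) * S.τ t.sum (u n) * S.τ (a n) (χ t))
  let β : List F → F → A := fun t n => S.τ (a n) (b t)
  let Θ : List F → List F → ℕ → ℂ := fun t t' N => avg ℂ (Φ N) fun n =>
    S.Λ (cubeProd t t' (fun s => S.τ s.sum (g N)) * cubeProd t t' (fun s => S.τ s.sum (u n)) *
      S.τ (a n) (cubeProd t t' χ))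
  have hcP := S.isStarMultiplicative_contr
  have hg' : ∀ (t t' : List F) N, S.Contr (cubeProd t t' (fun s => S.τ s.sum (g N))) :=
    fun t t' N => hcP.cubeProd (fun s => (hg N).τ _) _ _
  have hα : ∀ N t t', S.avgΛ (Φ N) (cubeProd t t' (α N)) = cubeProd t t' c * Θ t t' N := by
    intro N t t'
    rw [avgΛ_apply, ← avg_mul_left]
    refine avg_congr fun n _ => ?_
    have h1 : cubeProd t t' (α N) n = cubeProd t t' fun s => α N s n :=
      map_cubeProd (Pi.evalStarAlgHom ℂ (fun _ : F => A) n) t t' (α N)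
    rw [h1]
    simp only [α]
    rw [cubeProd_algebraMap_mul, ← Algebra.smul_def, map_smul, cubeProd_mul, cubeProd_mul,
      ← map_cubeProd (S.τ (a n)), smul_eq_mul]
  have hΘ : ∀ t t' N, ‖Θ t t' N‖ ≤ 1 := fun t t' N => norm_avg_le_of_le zero_le_one fun n _ =>
    Contr.norm_Λ_le (((hg' t t' N).mul (hcP.cubeProd (fun s => (hu n).τ _) _ _)).mul
      ((hcP.cubeProd (fun s => contr_of_mul_star_self (hEig.mul_star_self (hχ s))) _ _).τ _))
  have hleft : Tendsto (fun N => tupleAvg ℂ L fun t => S.avgΛ (Φ N) (α N t * β t)) U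
      (𝓝 (tupleAvg ℂ L fun t => c t * S.Λ (S.τ t.sum f₀ * (b t * χ t)))) := by
    refine tendsto_tupleAvg fun t => ?_
    have h1 := (hdual (S.τ (-t.sum) (b t * χ t))).const_mul (c t)
    rw [← S.Λ_τ t.sum, map_mul (S.τ t.sum), S.τ_τ_neg] at h1
    refine h1.congr fun N => ?_
    rw [avgΛ_apply, ← avg_mul_left]
    refine avg_congr fun n _ => ?_
    have h2 : (α N t * β t) n = c t • S.τ t.sum (g N * u n * S.τ (a n) (S.τ (-t.sum) (b t * χ t))) := by
      simp only [Pi.mul_apply, α, β, map_mul, Algebra.smul_def]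
      rw [S.τ_comm t.sum (a n), S.τ_comm t.sum (a n), S.τ_τ_neg, S.τ_τ_neg]
      ring
    rw [h2, map_smul, S.Λ_τ, smul_eq_mul]
  have hneg : IsNegligible (fun y : F → A => ∀ n, S.Contr (y n)) L.length β :=
    hb.map (RingHom.pi fun n => (S.τ (a n) : A →+* A)) fun y hy n => hy.τ _
  -- For a cube on which the product of the `χ` has integral zero, `hequi` makes the correlation
  -- vanish in the limit. For every other cube only the size of the coefficient at the top vertex is
  -- kept.
  refine le_of_tendsto_of_tendsto' (hleft.norm.pow (2 ^ L.length)) (tendsto_tupleAvg₂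
    (φ := fun N t t' => if S.Λ (cubeProd t t' χ) = 0 then ‖Θ t t' N‖ else ‖c t‖) fun t t' ht => ?_)
    fun N => ?_
  · split_ifs with h0
    · exact (tendsto_zero_iff_norm_tendsto_zero.1 (hequi t t' ht _ (hg' t t') _
        (hEig.isStarMultiplicative.cubeProd hχ _ _) h0))
    · exact tendsto_const_nhds
  · refine (norm_tupleAvg_pow_le S.isStarMultiplicative_forall_contr
      (fun b y hb => S.norm_avgΛ_mul_sq_le (Φ N) b y hb) L (α N) β hneg).trans
      (tupleAvg₂_mono fun t t' ht ht' => ?_)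
    have h1 := norm_cubeProd_le hc (ht.trans ht'.symm)
    rw [hα, norm_mul]
    split_ifs with h0
    · exact mul_le_of_le_one_left (norm_nonneg _) (h1.trans (hc t))
    · exact (mul_le_of_le_one_right (norm_nonneg _) (hΘ _ _ _)).trans h1

theorem exists_phase (z : ℂ) : ∃ θ : ℂ, ‖θ‖ ≤ 1 ∧ θ * z = ‖z‖ := by
  rcases eq_or_ne z 0 with rfl | hz
  · exact ⟨0, by simp, by simp⟩
  · refine ⟨star z / ‖z‖, ?_, ?_⟩
    · rw [norm_div, norm_star, Complex.norm_real, norm_norm, div_self (norm_ne_zero_iff.2 hz)]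
    · rw [div_mul_eq_mul_div, RCLike.star_def, RCLike.conj_mul]
      have : (‖z‖ : ℂ) ≠ 0 := by exact_mod_cast norm_ne_zero_iff.2 hz
      field_simp
      rfl

/-- Unimodular phases turn the average of absolute values into the absolute value of an average.
They are scalars, so their cube products only decrease the right-hand side. -/
theorem tupleAvg_norm_pow_le (L : List (Finset F)) (f : A) {b : List F → A}
    (hb : IsNegligible S.Contr L.length b) :
    (tupleAvg ℝ L fun t => ‖S.Λ (S.τ t.sum f * b t)‖) ^ (2 ^ L.length)
      ≤ tupleAvg₂ L fun t t' => ‖S.Λ (cubeProd t t' fun s => S.τ s.sum f)‖ := by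
  choose θ hθ hθ' using fun t : List F => exists_phase (S.Λ (S.τ t.sum f * b t))
  have h0 : (tupleAvg ℝ L fun t => ‖S.Λ (S.τ t.sum f * b t)‖)
      ≤ ‖tupleAvg ℂ L fun t => S.Λ (algebraMap ℂ A (θ t) * S.τ t.sum f * b t)‖ := by
    refine le_trans (le_of_eq ?_) (Complex.re_le_norm _)
    rw [re_tupleAvg]
    refine tupleAvg_congr fun t _ => ?_
    rw [mul_assoc, ← Algebra.smul_def, map_smul, smul_eq_mul, hθ', Complex.ofReal_re]
  have h1 : 0 ≤ tupleAvg ℝ L fun t => ‖S.Λ (S.τ t.sum f * b t)‖ :=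
    (norm_nonneg _).trans (norm_tupleAvg_le L _)
  refine (pow_le_pow_left₀ h1 h0 _).trans ((norm_tupleAvg_pow_le S.isStarMultiplicative_contr
    (fun b y hb => S.norm_Λ_mul_sq_le hb y) L _ b hb).trans (tupleAvg₂_mono fun t t' ht ht' => ?_))
  rw [cubeProd_algebraMap_mul, ← Algebra.smul_def, map_smul, norm_smul]
  exact mul_le_of_le_one_left (norm_nonneg _)
    ((norm_cubeProd_le hθ (ht.trans ht'.symm)).trans (hθ t))

/-- Degree lowering. -/
theorem G_ne_zero_of_G_succ_ne_zero [DecidableEq F] {Eig : A → Prop} (hEig : S.IsEigenClass Eig)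
    {U : Filter ℕ} [U.NeBot] {Φ : ℕ → Finset F} (hΦ : IsFolnerSequence Φ) {a : F → F} {u : F → A}
    (hu : ∀ n, S.Contr (u n)) {g : ℕ → A} (hg : ∀ N, S.Contr (g N)) {f₀ : A} (hf₀ : S.Contr f₀)
    (hdual : ∀ x, Tendsto (fun N => avg ℂ (Φ N) fun n => S.Λ (g N * u n * S.τ (a n) x)) U
      (𝓝 (S.Λ (f₀ * x))))
    (hequi : ∀ t t' : List F, t.length = t'.length → ∀ g' : ℕ → A, (∀ N, S.Contr (g' N)) →
      ∀ χ, Eig χ → S.Λ χ = 0 → Tendsto (fun N => avg ℂ (Φ N) fun n =>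
        S.Λ (g' N * cubeProd t t' (fun s => S.τ s.sum (u n)) * S.τ (a n) χ)) U (𝓝 0))
    {r : ℕ} (hr : S.G (r + 1) f₀ ≠ 0) : S.G r f₀ ≠ 0 := by
  intro hr0
  have hc : 0 < S.G (r + 1) f₀ := (S.G_nonneg _ _).lt_of_ne' hr
  set c := S.G (r + 1) f₀ with hc_def
  -- As `G r f₀ = 0`, the cube averages of `G 0` along `L` can be made smaller than half the lower
  -- bound that the two applications of Gowers–Cauchy–Schwarz and a final squaring will produce from
  -- `c`.
  obtain ⟨L, hLr, hL, hLf⟩ := S.exists_iterAvg_le hΦ r (Set.finite_singleton f₀)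
    (ε := ((c ^ 2 ^ r) ^ 2 ^ r) ^ 2 / 2) (by positivity)
  have hcP := S.isStarMultiplicative_contr
  have hEP := hEig.isStarMultiplicative
  have h1 : c ≤ tupleAvg₂ L fun t t' => S.G 1 (cubeProd t t' fun s => S.τ s.sum f₀) := by
    rw [← iterAvg_eq_tupleAvg₂, hc_def, ← hLr]
    exact S.G_le_iterAvg 1 L hL f₀
  obtain ⟨t₁, ht₁, h2⟩ := exists_le_tupleAvg_of_le_tupleAvg₂ hL h1
  obtain ⟨b, hb, hb'⟩ := exists_cubeProd_eq hcP t₁ fun s => hf₀.τ s.sum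
  have hf : ∀ t, S.Contr (cubeProd t t₁ fun s => S.τ s.sum f₀) :=
    fun t => hcP.cubeProd (fun s => hf₀.τ _) _ _
  -- With the base vertex `t₁` fixed, each cube product of `f₀` correlates with an eigenfunction `χ
  -- t`, on average in `t`.
  choose χ hχ hχ' using fun t => hEig.exists_G_one_le _ (hf t)
  let z : List F → ℂ := fun t => S.Λ ((cubeProd t t₁ fun s => S.τ s.sum f₀) * χ t)
  have hχc : ∀ t, S.Contr (χ t) := fun t => contr_of_mul_star_self (hEig.mul_star_self (hχ t))
  have hz : ∀ t, ‖star (z t)‖ ≤ 1 := fun t => by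
    rw [norm_star]
    exact ((hf t).mul (hχc t)).norm_Λ_le
  have h3 : c ≤ ‖tupleAvg ℂ L fun t => star (z t) * S.Λ (S.τ t.sum f₀ * (b t * χ t))‖ := by
    refine le_trans (h2.trans ((tupleAvg_mono fun t _ => hχ' t).trans_eq ?_)) (Complex.re_le_norm _)
    rw [re_tupleAvg]
    refine tupleAvg_congr fun t ht => ?_
    rw [← mul_assoc, ← hb' t (ht.trans ht₁.symm)]
    change ‖z t‖ ^ 2 = (star (z t) * z t).re
    rw [RCLike.star_def, RCLike.conj_mul, ← RCLike.ofReal_pow]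
    exact (Complex.ofReal_re _).symm
  rw [ht₁] at hb
  have h4 := norm_tupleAvg_pow_le_of_tendsto hEig hu hg hdual hequi L hb hχ hz
  obtain ⟨t₂, ht₂, h5⟩ := exists_le_tupleAvg_of_le_tupleAvg₂ hL h4
  -- After a second base vertex `t₂` is fixed, only those `t` matter for which `χ t * b' t` has
  -- nonzero integral and hence acts as a scalar. For them `χ t` may be replaced by `star (b' t)`,
  -- which is negligible, so the eigenfunctions are eliminated from the correlation.
  obtain ⟨b', hb₂, hb₂'⟩ := exists_cubeProd_eq hEP t₂ hχ
  have h6 : c ^ 2 ^ r ≤ tupleAvg ℝ L fun t => ‖S.Λ (S.τ t.sum f₀ * (b t * star (b' t)))‖ := by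
    rw [← hLr]
    refine (pow_le_pow_left₀ hc.le h3 _).trans (h5.trans (tupleAvg_mono fun t ht => ?_))
    split_ifs with h0
    · exact norm_nonneg _
    · have hb1 : b' t * star (b' t) = 1 :=
        hEig.mul_star_self (hb₂.mem hEP (ht.trans ht₂.symm))
      have e : z t = S.Λ (S.τ t.sum f₀ * (b t * star (b' t)) * cubeProd t t₂ χ) := by
        simp only [z]
        rw [hb' t (ht.trans ht₁.symm), hb₂' t (ht.trans ht₂.symm)]
        congr 1
        linear_combination (-(S.τ t.sum f₀ * b t * χ t)) * hb1
      rw [norm_star, e]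
      exact hEig.norm_Λ_le (hEP.cubeProd hχ _ _) h0 _
  rw [ht₂] at hb₂
  have hneg : IsNegligible S.Contr L.length fun t => b t * star (b' t) :=
    hb.mul hcP (((hb₂.map (RingHom.id A) fun x hx =>
      contr_of_mul_star_self (hEig.mul_star_self hx)).star hcP))
  have h7 := tupleAvg_norm_pow_le L f₀ hneg
  rw [hLr] at h7
  have h8 : ((c ^ 2 ^ r) ^ 2 ^ r) ^ 2 ≤ ((c ^ 2 ^ r) ^ 2 ^ r) ^ 2 / 2 := by
    calc ((c ^ 2 ^ r) ^ 2 ^ r) ^ 2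
        ≤ (tupleAvg₂ L fun t t' => ‖S.Λ (cubeProd t t' fun s => S.τ s.sum f₀)‖) ^ 2 := by
          gcongr
          exact (pow_le_pow_left₀ (by positivity) h6 _).trans h7
      _ ≤ tupleAvg₂ L fun t t' => ‖S.Λ (cubeProd t t' fun s => S.τ s.sum f₀)‖ ^ 2 :=
          pow_tupleAvg₂_le L (fun _ _ => norm_nonneg _) two_ne_zero
      _ = S.iterAvg (S.G 0) L f₀ := (S.iterAvg_eq_tupleAvg₂ (S.G 0) _ _).symm
      _ ≤ _ := by simpa [hr0] using hLf f₀ rfl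
  have : 0 < ((c ^ 2 ^ r) ^ 2 ^ r) ^ 2 := by positivity
  linarith

theorem G_zero_ne_zero_of_G_ne_zero [DecidableEq F] {Eig : A → Prop} (hEig : S.IsEigenClass Eig)
    {U : Filter ℕ} [U.NeBot] {Φ : ℕ → Finset F} (hΦ : IsFolnerSequence Φ) {a : F → F} {u : F → A}
    (hu : ∀ n, S.Contr (u n)) {g : ℕ → A} (hg : ∀ N, S.Contr (g N)) {f₀ : A} (hf₀ : S.Contr f₀)
    (hdual : ∀ x, Tendsto (fun N => avg ℂ (Φ N) fun n => S.Λ (g N * u n * S.τ (a n) x)) U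
      (𝓝 (S.Λ (f₀ * x))))
    (hequi : ∀ t t' : List F, t.length = t'.length → ∀ g' : ℕ → A, (∀ N, S.Contr (g' N)) →
      ∀ χ, Eig χ → S.Λ χ = 0 → Tendsto (fun N => avg ℂ (Φ N) fun n =>
        S.Λ (g' N * cubeProd t t' (fun s => S.τ s.sum (u n)) * S.τ (a n) χ)) U (𝓝 0))
    {r : ℕ} (hr : S.G r f₀ ≠ 0) : S.Λ f₀ ≠ 0 := by
  induction r with
  | zero =>
    intro h
    exact hr (by simp [G, h])
  | succ r ih => exact ih (G_ne_zero_of_G_succ_ne_zero hEig hΦ hu hg hf₀ hdual hequi hr)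

end KoopmanSystem

/-! ### Compactness from finite trace, and eigenspaces -/

section TraceClass

variable {E : Type*} [NormedAddCommGroup E] [InnerProductSpace ℂ E]

/-- A nonnegative quadratic form of finite trace is small off a finite-dimensional subspace. -/
theorem exists_finiteDimensional_le_of_sum_le {q : E → ℝ} {C : ℝ}
    (hq : ∀ s : Finset E, Orthonormal ℂ ((↑) : s → E) → ∑ x ∈ s, q x ≤ C)
    (hsmul : ∀ (c : ℂ) x, q (c • x) = ‖c‖ ^ 2 * q x) {ε : ℝ} (hε : 0 < ε) :
    ∃ V : Submodule ℂ E, FiniteDimensional ℂ V ∧ ∀ x ∈ Vᗮ, q x ≤ ε * ‖x‖ ^ 2 := by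
  classical
  by_contra! hcon
  -- If no such subspace exists, orthonormal vectors with `q ≥ ε` can be chosen greedily, each
  -- orthogonal to the span of the previous ones; more than `C / ε` of them violate the trace bound.
  have key : ∀ n : ℕ, ∃ s : Finset E, s.card = n ∧ Orthonormal ℂ ((↑) : s → E) ∧
      ∀ x ∈ s, ε ≤ q x := by
    intro n
    induction n with
    | zero => exact ⟨∅, rfl, by simp [Orthonormal], by simp⟩
    | succ n ih =>
      obtain ⟨s, hs, hso, hsq⟩ := ih
      obtain ⟨x, hx, hxq⟩ := hcon (Submodule.span ℂ (s : Set E))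
        (FiniteDimensional.span_finset ℂ s)
      have hx0 : x ≠ 0 := by
        rintro rfl
        have := hsmul 0 0
        simp at this
        simp [this] at hxq
      have hn : ‖x‖ ≠ 0 := norm_ne_zero_iff.2 hx0
      set y := ((‖x‖ : ℂ)⁻¹) • x with hy
      have hyn : ‖y‖ = 1 := by
        rw [hy, norm_smul, norm_inv, Complex.norm_real, norm_norm, inv_mul_cancel₀ hn]
      have hyq : ε ≤ q y := by
        rw [hy, hsmul, norm_inv, Complex.norm_real, norm_norm]
        have : 0 < ‖x‖ := norm_pos_iff.2 hx0
        rw [inv_pow, ← div_eq_inv_mul, le_div_iff₀ (by positivity)]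
        exact hxq.le
      have hyV : ∀ z ∈ s, inner ℂ z y = 0 := fun z hz =>
        Submodule.inner_right_of_mem_orthogonal (Submodule.subset_span hz)
          (Submodule.smul_mem _ _ hx)
      have hso' := (orthonormal_subtype_iff_ite (s := (s : Set E))).1 hso
      have hyy : inner ℂ y y = (1 : ℂ) := by
        rw [inner_self_eq_norm_sq_to_K, hyn]
        simp
      have hys : y ∉ s := fun h => by rw [hyV y h] at hyy; exact zero_ne_one hyy
      refine ⟨insert y s, by simp [hys, hs], ?_, ?_⟩
      · refine (orthonormal_subtype_iff_ite (s := ((insert y s : Finset E) : Set E))).2 ?_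
        intro v hv w hw
        simp only [Finset.coe_insert, Set.mem_insert_iff, Finset.mem_coe] at hv hw
        rcases hv with rfl | hv <;> rcases hw with rfl | hw
        · rw [hyy, if_pos rfl]
        · rw [← inner_conj_symm, hyV w hw, if_neg (by rintro rfl; exact hys hw), map_zero]
        · rw [hyV v hv, if_neg (by rintro rfl; exact hys hv)]
        · exact hso' v hv w hw
      · simp only [Finset.mem_insert, forall_eq_or_imp]
        exact ⟨hyq, hsq⟩
  obtain ⟨n, hn⟩ := exists_nat_gt (C / ε)
  obtain ⟨s, hs, hso, hsq⟩ := key n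
  have h1 : (n : ℝ) * ε ≤ C := by
    refine le_trans ?_ (hq s hso)
    rw [← hs, ← nsmul_eq_mul]
    exact Finset.card_nsmul_le_sum _ _ _ hsq
  rw [div_lt_iff₀ hε] at hn
  linarith

/-- A bounded operator dominated by a quadratic form of finite trace is compact. -/
theorem isCompactOperator_of_sum_le [CompleteSpace E] {S : E →L[ℂ] E} {q : E → ℝ} {C : ℝ}
    (hq : ∀ s : Finset E, Orthonormal ℂ ((↑) : s → E) → ∑ x ∈ s, q x ≤ C)
    (hsmul : ∀ (c : ℂ) x, q (c • x) = ‖c‖ ^ 2 * q x) (hS : ∀ x, ‖S x‖ ^ 2 ≤ q x) :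
    IsCompactOperator S := by
  have h1 : ∀ n : ℕ, ∃ R : E →L[ℂ] E, IsCompactOperator R ∧ ‖R - S‖ ≤ 1 / ((n : ℝ) + 1) := by
    intro n
    have hn : 0 < 1 / ((n : ℝ) + 1) := by positivity
    obtain ⟨V, hV, hV'⟩ := exists_finiteDimensional_le_of_sum_le hq hsmul (pow_pos hn 2)
    -- The finite rank operator that ignores `Vᗮ`, where `q`, and with it `S`, is small.
    refine ⟨S ∘L V.starProjection, ?_, ?_⟩
    · have h2 : IsCompactOperator (S ∘L V.subtypeL) := by
        have : IsCompactOperator (id : V → V) :=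
          isCompactOperator_id_iff_locallyCompactSpace.2 inferInstance
        exact this.clm_comp (S ∘L V.subtypeL)
      exact h2.comp_clm V.orthogonalProjectionOnto
    · refine ContinuousLinearMap.opNorm_le_bound _ hn.le fun x => ?_
      have h3 := Submodule.sub_starProjection_mem_orthogonal (K := V) x
      have h4 : ‖S (x - V.starProjection x)‖ ^ 2 ≤ (1 / ((n : ℝ) + 1) * ‖x‖) ^ 2 := by
        refine (hS _).trans ((hV' _ h3).trans ?_)
        rw [mul_pow]
        gcongr
        rw [← Submodule.starProjection_orthogonal_val]
        exact (Vᗮ.norm_starProjection_apply_le x)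
      rw [sq_le_sq₀ (norm_nonneg _) (by positivity), map_sub] at h4
      rw [_root_.sub_apply, norm_sub_rev]
      exact h4
  choose R hR hRS using h1
  refine isCompactOperator_of_tendsto (l := atTop) (F := R) ?_ (Eventually.of_forall hR)
  rw [tendsto_iff_norm_sub_tendsto_zero]
  exact squeeze_zero (fun _ => norm_nonneg _) hRS tendsto_one_div_add_atTop_nhds_zero_nat

/-- On the eigenspace the operator is `μ` times the identity, so the identity is compact there. -/
theorem IsCompactOperator.finiteDimensional_eigenspace [CompleteSpace E] {S : E →L[ℂ] E}
    (hS : IsCompactOperator S) {μ : ℂ} (hμ : μ ≠ 0) :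
    FiniteDimensional ℂ (Module.End.eigenspace (S : E →ₗ[ℂ] E) μ) := by
  set W := Module.End.eigenspace (S : E →ₗ[ℂ] E) μ
  have hW : ∀ x ∈ W, S x = μ • x := fun x hx => Module.End.mem_eigenspace_iff.1 hx
  have hmaps : ∀ x ∈ W, (S : E →ₗ[ℂ] E) x ∈ W := fun x hx => by
    rw [show (S : E →ₗ[ℂ] E) x = μ • x from hW x hx]
    exact W.smul_mem _ hx
  have h1 : IsCompactOperator ((S : E →ₗ[ℂ] E).restrict hmaps) := by
    have hclosed : IsClosed (W : Set E) := by
      have : (W : Set E) = {x | S x = μ • x} := by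
        ext x
        exact Module.End.mem_eigenspace_iff
      rw [this]
      exact isClosed_eq S.continuous (continuous_const_smul μ)
    exact IsCompactOperator.restrict (f := (S : E →ₗ[ℂ] E)) hS hmaps hclosed
  have h2 : ((S : E →ₗ[ℂ] E).restrict hmaps : W → W) = μ • id := by
    ext x
    simpa using hW x x.2
  rw [h2, IsCompactOperator.smul_iff₀ hμ] at h1
  exact FiniteDimensional.of_isCompactOperator_id h1

/-- A self-adjoint compact operator has an eigenvalue of maximal modulus. -/
theorem exists_hasEigenvalue_norm_eq [CompleteSpace E] {S : E →L[ℂ] E} (hS : IsCompactOperator S)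
    (hsa : IsSelfAdjoint S) (h0 : S ≠ 0) :
    ∃ μ : ℂ, ‖μ‖ = ‖S‖ ∧ Module.End.HasEigenvalue (S : E →ₗ[ℂ] E) μ := by
  have : Nontrivial (E →L[ℂ] E) := ⟨S, 0, h0⟩
  obtain ⟨μ, hμ, hμ'⟩ := spectrum.exists_nnnorm_eq_spectralRadius S
  rw [hsa.spectralRadius_eq_nnnorm] at hμ'
  have hn : ‖μ‖ = ‖S‖ := by
    have : ‖μ‖₊ = ‖S‖₊ := by exact_mod_cast hμ'
    exact congrArg NNReal.toReal this
  refine ⟨μ, hn, (hS.hasEigenvalue_iff_mem_spectrum ?_).2 hμ⟩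
  rw [← norm_ne_zero_iff, hn]
  exact norm_ne_zero_iff.2 h0

end TraceClass

/-- Commuting endomorphisms have a common eigenvector in every nonzero finite-dimensional invariant
subspace. -/
theorem exists_common_eigenvector {ι E : Type*} [AddCommGroup E] [Module ℂ E] (T : ι → E →ₗ[ℂ] E)
    (hT : ∀ i j x, T i (T j x) = T j (T i x)) (W : Submodule ℂ E) [FiniteDimensional ℂ W]
    (hW : W ≠ ⊥) (hTW : ∀ i, ∀ x ∈ W, T i x ∈ W) :
    ∃ x ∈ W, x ≠ 0 ∧ ∀ i, ∃ c : ℂ, T i x = c • x := by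
  induction hn : Module.finrank ℂ W using Nat.strong_induction_on generalizing W with
  | _ n ih =>
    by_cases hsc : ∀ i, ∃ c : ℂ, ∀ x ∈ W, T i x = c • x
    · obtain ⟨x, hx, hx0⟩ := W.exists_mem_ne_zero_of_ne_bot hW
      exact ⟨x, hx, hx0, fun i => (hsc i).imp fun c hc => hc x hx⟩
    · push Not at hsc
      obtain ⟨i, hi⟩ := hsc
      have : Nontrivial W := (Submodule.nontrivial_iff_ne_bot).2 hW
      obtain ⟨c, hc⟩ := Module.End.exists_eigenvalue ((T i).restrict (hTW i))
      obtain ⟨y, hy⟩ := hc.exists_hasEigenvector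
      -- An eigenspace of a `T i` that is not scalar on `W` is a proper nonzero subspace, and it is
      -- invariant because the endomorphisms commute.
      let W' := W ⊓ LinearMap.ker (T i - c • LinearMap.id)
      have hlt : W' < W := by
        refine lt_of_le_of_ne inf_le_left fun h => ?_
        obtain ⟨x, hx, hxc⟩ := hi c
        rw [← h] at hx
        exact hxc (sub_eq_zero.1 hx.2)
      have hW' : W' ≠ ⊥ := by
        refine (Submodule.ne_bot_iff _).2 ⟨y, ⟨y.2, ?_⟩, fun h => hy.2 (Subtype.ext h)⟩
        have := congrArg Subtype.val hy.apply_eq_smul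
        simpa [sub_eq_zero] using this
      have : FiniteDimensional ℂ W' := Submodule.finiteDimensional_of_le hlt.le
      obtain ⟨x, hx, h⟩ := ih _ (hn ▸ Submodule.finrank_lt_finrank_of_lt hlt) W' hW'
        (fun j x hx => ⟨hTW j x hx.1, by
          have : T i x = c • x := by simpa [sub_eq_zero] using hx.2
          simp [hT i j, this]⟩) rfl
      exact ⟨x, hx.1, h⟩

/-! ### Averaging operators and joint eigenvectors -/

section AveragingOperator

variable {κ E : Type*} [NormedAddCommGroup E] [InnerProductSpace ℂ E]

theorem Ultrafilter.exists_tendsto_of_norm_le {ι : Type*} (U : Ultrafilter ι) {u : ι → ℂ} {C : ℝ}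
    (hu : ∀ i, ‖u i‖ ≤ C) : ∃ z, Tendsto u U (𝓝 z) := by
  obtain ⟨z, -, hz⟩ := (isCompact_closedBall (0 : ℂ) C).ultrafilter_le_nhds (U.map u)
    (Filter.le_principal_iff.2 (Filter.Eventually.of_forall (f := (U : Filter ι)) fun i => by simpa using hu i))
  exact ⟨z, hz⟩

/-- A pointwise limit of bounded linear functionals, along an ultrafilter, is represented by a
vector. -/
theorem Ultrafilter.exists_tendsto_inner [CompleteSpace E] {ι : Type*} (U : Ultrafilter ι)
    {y : ι → E} {C : ℝ} (hy : ∀ i, ‖y i‖ ≤ C) :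
    ∃ z : E, ∀ x, Tendsto (fun i => inner ℂ (y i) x) U (𝓝 (inner ℂ z x)) := by
  have hb : ∀ x i, ‖inner ℂ (y i) x‖ ≤ C * ‖x‖ := fun x i => (norm_inner_le_norm _ _).trans
    (mul_le_mul_of_nonneg_right (hy i) (norm_nonneg _))
  choose φ hφ using fun x => U.exists_tendsto_of_norm_le (hb x)
  let ψ : E →ₗ[ℂ] ℂ :=
    { toFun := φ
      map_add' := fun x x' => tendsto_nhds_unique (hφ _) (((hφ x).add (hφ x')).congr fun i => by
        rw [inner_add_right])
      map_smul' := fun c x => tendsto_nhds_unique (hφ _) (((hφ x).const_mul c).congr fun i => by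
        rw [inner_smul_right]) }
  let ψ' : StrongDual ℂ E := ψ.mkContinuous C fun x => le_of_tendsto (hφ x).norm
    (Eventually.of_forall (hb x))
  refine ⟨(InnerProductSpace.toDual ℂ E).symm ψ', fun x => ?_⟩
  rw [InnerProductSpace.toDual_symm_apply]
  exact hφ x

variable {H : ℕ → Finset κ} {w : κ → E}

/-- `S` is the limit along `U` of the averages over `H` of the rank one operators
`x ↦ ⟪w k, x⟫ w k`. -/
def IsAveragingOperator (U : Filter ℕ) (H : ℕ → Finset κ) (w : κ → E) (S : E →L[ℂ] E) : Prop :=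
  ∀ a b, Tendsto (fun N => avg ℂ (H N) fun k => inner ℂ a (w k) * inner ℂ (w k) b) U
    (𝓝 (inner ℂ (S a) b))

theorem exists_isAveragingOperator [CompleteSpace E] (U : Ultrafilter ℕ) (H : ℕ → Finset κ)
    (hw : ∀ k, ‖w k‖ ≤ 1) : ∃ S : E →L[ℂ] E, IsAveragingOperator (U : Filter ℕ) H w S := by
  have hb : ∀ a b N, ‖avg ℂ (H N) fun k => inner ℂ a (w k) * inner ℂ (w k) b‖ ≤ ‖a‖ * ‖b‖ :=
    fun a b N => norm_avg_le_of_le (by positivity) fun k _ => by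
      rw [norm_mul]
      gcongr
      · exact (norm_inner_le_norm _ _).trans (mul_le_of_le_one_right (norm_nonneg _) (hw k))
      · exact (norm_inner_le_norm _ _).trans (mul_le_of_le_one_left (norm_nonneg _) (hw k))
  choose B hB using fun a b => U.exists_tendsto_of_norm_le (hb a b)
  let B' : E →ₗ⋆[ℂ] E →ₗ[ℂ] ℂ := LinearMap.mk₂'ₛₗ (starRingEnd ℂ) (RingHom.id ℂ) B
    (fun a a' b => tendsto_nhds_unique (hB _ _) (((hB a b).add (hB a' b)).congr fun N => by
      simp only [inner_add_left, add_mul, avg_add]))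
    (fun c a b => tendsto_nhds_unique (hB _ _) (((hB a b).const_mul _).congr fun N => by
      simp only [inner_smul_left, mul_assoc, avg_mul_left]))
    (fun a b b' => tendsto_nhds_unique (hB _ _) (((hB a b).add (hB a b')).congr fun N => by
      simp only [inner_add_right, mul_add, avg_add]))
    (fun c a b => tendsto_nhds_unique (hB _ _) (((hB a b).const_mul _).congr fun N => by
      simp only [inner_smul_right, mul_left_comm _ c, avg_mul_left, RingHom.id_apply]))
  let B'' : E →L⋆[ℂ] E →L[ℂ] ℂ := B'.mkContinuous₂ 1 fun a b =>
    le_of_tendsto (hB a b).norm (Eventually.of_forall fun N => by rw [one_mul]; exact hb a b N)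
  refine ⟨InnerProductSpace.continuousLinearMapOfBilin B'', fun a b => ?_⟩
  rw [InnerProductSpace.continuousLinearMapOfBilin_apply]
  exact hB a b

namespace IsAveragingOperator

variable {U : Filter ℕ} [U.NeBot] {S : E →L[ℂ] E}

omit [U.NeBot] in
theorem tendsto_re (hS : IsAveragingOperator U H w S) (x : E) :
    Tendsto (fun N => avg ℝ (H N) fun k => ‖inner ℂ (w k) x‖ ^ 2) U
      (𝓝 (RCLike.re (inner ℂ (S x) x))) := by
  refine ((RCLike.continuous_re.tendsto _).comp (hS x x)).congr fun N => ?_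
  rw [Function.comp_apply, re_avg]
  refine avg_congr fun k _ => ?_
  rw [← inner_conj_symm, RCLike.conj_mul, ← RCLike.ofReal_pow, RCLike.ofReal_re]

theorem isSelfAdjoint [CompleteSpace E] (hS : IsAveragingOperator U H w S) : IsSelfAdjoint S := by
  rw [ContinuousLinearMap.isSelfAdjoint_iff_isSymmetric]
  intro a b
  have h1 := (RCLike.continuous_conj.tendsto _).comp (hS b a)
  rw [inner_conj_symm] at h1
  refine tendsto_nhds_unique (hS a b) (h1.congr fun N => ?_)
  simp only [Function.comp_apply, avg, smul_eq_mul, map_mul, map_sum, map_inv₀, map_natCast,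
    inner_conj_symm]
  congr 1
  exact Finset.sum_congr rfl fun k _ => mul_comm _ _

/-- Cauchy–Schwarz in the average, with `‖w k‖ ≤ 1`, bounds `‖⟪S x, a⟫‖²` by `‖a‖²` times the
quadratic form; then `a = S x`. -/
theorem norm_sq_le (hS : IsAveragingOperator U H w S) (hw : ∀ k, ‖w k‖ ≤ 1) (x : E) :
    ‖S x‖ ^ 2 ≤ RCLike.re (inner ℂ (S x) x) := by
  have key : ∀ a, ‖inner ℂ (S x) a‖ ^ 2 ≤ ‖a‖ ^ 2 * RCLike.re (inner ℂ (S x) x) := by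
    intro a
    refine le_of_tendsto_of_tendsto' ((hS x a).norm.pow 2) ((hS.tendsto_re x).const_mul _)
      fun N => ?_
    calc _ ≤ (avg ℝ (H N) fun k => ‖a‖ * ‖inner ℂ (w k) x‖) ^ 2 := by
          gcongr
          refine (norm_avg_le _ _).trans (avg_le_avg fun k _ => ?_)
          rw [norm_mul, mul_comm, norm_inner_symm]
          gcongr
          · exact (norm_inner_le_norm _ _).trans (mul_le_of_le_one_right (norm_nonneg _) (hw k))
          · rw [norm_inner_symm]
      _ ≤ avg ℝ (H N) fun k => (‖a‖ * ‖inner ℂ (w k) x‖) ^ 2 :=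
          pow_avg_le_avg_pow (fun _ _ => by positivity) two_ne_zero
      _ = _ := by simp only [mul_pow, avg_mul_left]
  have h1 := key (S x)
  rw [inner_self_eq_norm_sq_to_K, ← RCLike.ofReal_pow, RCLike.norm_ofReal,
    abs_of_nonneg (sq_nonneg _)] at h1
  rcases eq_or_ne (‖S x‖) 0 with h0 | h0
  · rw [norm_eq_zero] at h0
    simp [h0]
  · have : 0 < ‖S x‖ ^ 2 := by positivity
    rw [sq (‖S x‖ ^ 2)] at h1
    exact le_of_mul_le_mul_left h1 this

/-- Bessel's inequality gives each rank one operator `x ↦ ⟪w k, x⟫ w k` trace at most one, and the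
bound survives averaging and limits. The quadratic form dominates the operator by `norm_sq_le`. -/
theorem isCompactOperator [CompleteSpace E] (hS : IsAveragingOperator U H w S)
    (hw : ∀ k, ‖w k‖ ≤ 1) : IsCompactOperator S := by
  refine isCompactOperator_of_sum_le (q := fun x => RCLike.re (inner ℂ (S x) x)) (C := 1)
    (fun s hs => ?_) (fun c x => ?_) (hS.norm_sq_le hw)
  · refine le_of_tendsto' (tendsto_finsetSum _ fun x _ => hS.tendsto_re x) fun N => ?_
    rw [← avg_sum]
    refine (Real.le_norm_self _).trans (norm_avg_le_of_le (𝕜 := ℝ) zero_le_one fun k _ => ?_)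
    rw [Real.norm_of_nonneg (by positivity)]
    have h1 := hs.sum_inner_products_le (w k) (s := Finset.univ)
    rw [Finset.univ_eq_attach, Finset.sum_attach s fun x => ‖inner ℂ x (w k)‖ ^ 2] at h1
    simp only [norm_inner_symm (w k)]
    exact h1.trans (pow_le_one₀ (norm_nonneg _) (hw k))
  · simp only [map_smul, inner_smul_left, inner_smul_right]
    rw [← mul_assoc, RCLike.mul_conj, ← RCLike.ofReal_pow, RCLike.re_ofReal_mul]

end IsAveragingOperator

variable {F : Type*} [AddCommGroup F] [DecidableEq F] {Φ : ℕ → Finset F}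

theorem avg_product {ι ι' 𝕜 E : Type*} [Field 𝕜] [AddCommGroup E] [Module 𝕜 E] (H : Finset ι)
    (H' : Finset ι') (ψ : ι × ι' → E) :
    avg 𝕜 (H ×ˢ H') ψ = avg 𝕜 H fun h => avg 𝕜 H' fun h' => ψ (h, h') := by
  simp only [avg, Finset.sum_product, Finset.card_product, Nat.cast_mul, mul_inv,
    ← Finset.smul_sum, smul_smul]

theorem IsFolnerSequence.tendsto_avg_sub_shift (hΦ : IsFolnerSequence Φ) {ψ : F → ℂ} {C : ℝ}
    (hψ : ∀ n, ‖ψ n‖ ≤ C) (g : F) :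
    Tendsto (fun N => (avg ℂ (Φ N ×ˢ Φ N) fun k => ψ (g + (k.1 - k.2)))
      - avg ℂ (Φ N ×ˢ Φ N) fun k => ψ (k.1 - k.2)) atTop (𝓝 0) := by
  have hC : 0 ≤ C := (norm_nonneg _).trans (hψ 0)
  refine squeeze_zero_norm (a := fun N => C * (((symmDiff (Φ N)
    ((Φ N).image fun x => g + x)).card : ℝ) / ((Φ N).card : ℝ))) (fun N => ?_)
    (by simpa using (hΦ.tendsto_symmDiff g).const_mul C)
  rw [avg_product, avg_product, avg_comm, avg_comm _ _ fun h h' => ψ (h - h'), ← avg_sub]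
  refine norm_avg_le_of_le (by positivity) fun h' _ => ?_
  have := norm_avg_shift_sub_le (𝕜 := ℂ) (Φ N) (v := fun n => ψ (n - h')) (fun n => hψ _) g
  refine le_trans (le_of_eq ?_) this
  congr 3
  ext h
  congr 1
  abel

/-- A vector whose translates do not become orthogonal to it correlates with a joint eigenvector of
the translations. -/
theorem IsFolnerSequence.exists_eigenvector [CompleteSpace E] (hΦ : IsFolnerSequence Φ)
    (T : F → E →ₗᵢ[ℂ] E) (hT : ∀ g h x, T (g + h) x = T g (T h x)) {v : E} (hv : ‖v‖ ≤ 1)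
    (hT0 : ∀ x, T 0 x = x) {c : ℝ} (hc : 0 < c)
    (hlim : Tendsto (fun N => avg ℝ (Φ N) fun h => avg ℝ (Φ N) fun h' =>
      ‖inner ℂ (T (h - h') v) v‖ ^ 2) atTop (𝓝 c)) :
    ∃ χ : E, ‖χ‖ = 1 ∧ (∀ g, ∃ z : ℂ, T g χ = z • χ) ∧ c ≤ ‖inner ℂ v χ‖ ^ 2 := by
  let U : Ultrafilter ℕ := hyperfilter ℕ
  have hU : (U : Filter ℕ) ≤ atTop := Nat.hyperfilter_le_atTop
  -- The limit operator averages the projections onto translates of `v`, so its quadratic form at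
  -- `v` is `c`. Følner invariance makes it commute with every `T g`.
  let w : F × F → E := fun k => T (k.1 - k.2) v
  have hw : ∀ k, ‖w k‖ ≤ 1 := fun k => by simpa [w] using hv
  obtain ⟨S, hS⟩ := exists_isAveragingOperator U (fun N => Φ N ×ˢ Φ N) hw
  have hcomp := hS.isCompactOperator hw
  have hsa := hS.isSelfAdjoint
  have hcS : c ≤ ‖S‖ := by
    have h1 : RCLike.re (inner ℂ (S v) v) = c := by
      refine tendsto_nhds_unique (hS.tendsto_re v) ((hlim.mono_left hU).congr fun N => ?_)
      rw [avg_product]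
    rw [← h1]
    calc _ ≤ ‖inner ℂ (S v) v‖ := RCLike.re_le_norm _
      _ ≤ ‖S v‖ * ‖v‖ := norm_inner_le_norm _ _
      _ ≤ ‖S‖ * ‖v‖ * ‖v‖ := by
          gcongr
          exact S.le_opNorm v
      _ ≤ ‖S‖ * 1 * 1 := by gcongr
      _ = _ := by ring
  have hS0 : S ≠ 0 := by
    rintro rfl
    simp at hcS
    linarith
  obtain ⟨μ, hμ, hev⟩ := exists_hasEigenvalue_norm_eq hcomp hsa hS0
  have hμ0 : μ ≠ 0 := by
    rw [← norm_ne_zero_iff, hμ]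
    exact norm_ne_zero_iff.2 hS0
  have hcomm : ∀ g x, S (T g x) = T g (S x) := by
    have hsymm := fun g a b => show inner ℂ (S (T g a)) (T g b) = inner ℂ (S a) b from by
      have h1 : ∀ n, ‖inner ℂ (T g a) (T n v) * inner ℂ (T n v) (T g b)‖ ≤ ‖a‖ * ‖b‖ := by
        intro n
        rw [norm_mul]
        gcongr
        · refine (norm_inner_le_norm _ _).trans ?_
          simpa using mul_le_of_le_one_right (norm_nonneg a) hv
        · refine (norm_inner_le_norm _ _).trans ?_
          simpa using mul_le_of_le_one_left (norm_nonneg b) hv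
      have h2 := (hS (T g a) (T g b)).add ((hΦ.tendsto_avg_sub_shift h1 g).mono_left hU)
      rw [add_zero] at h2
      refine tendsto_nhds_unique h2 ((hS a b).congr fun N => ?_)
      simp only [w, add_sub_cancel, hT, LinearIsometry.inner_map_map]
    intro g x
    have hsurj : ∀ y, T g (T (-g) y) = y := fun y => by rw [← hT, add_neg_cancel, hT0]
    refine ext_inner_right ℂ fun y => ?_
    rw [← hsurj y, hsymm, LinearIsometry.inner_map_map]
  have := hcomp.finiteDimensional_eigenspace hμ0
  obtain ⟨χ, hχ, hχ0, hχT⟩ := exists_common_eigenvector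
    (fun g => (T g).toLinearMap) (fun g h x => by simp [← hT, add_comm])
    (Module.End.eigenspace (S : E →ₗ[ℂ] E) μ) hev (fun g x hx => by
      have hx' : S x = μ • x := Module.End.mem_eigenspace_iff.1 hx
      refine Module.End.mem_eigenspace_iff.2 ?_
      change S (T g x) = μ • T g x
      rw [hcomm, hx', map_smul])
  have hSχ : S χ = μ • χ := Module.End.mem_eigenspace_iff.1 hχ
  have hn : ‖χ‖ ≠ 0 := norm_ne_zero_iff.2 hχ0
  -- A joint eigenvector correlates equally with all translates of `v`. Its quadratic form is
  -- therefore exactly `‖⟪v, χ⟫‖²`, while the choice of an eigenvalue of maximal modulus makes it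
  -- `‖S‖ * ‖χ‖²`, with `‖S‖ ≥ c`.
  have habs : ∀ k, ‖inner ℂ (w k) χ‖ ^ 2 = ‖inner ℂ v χ‖ ^ 2 := by
    intro k
    obtain ⟨z, hz⟩ := hχT (k.1 - k.2)
    have hz' : T (k.1 - k.2) χ = z • χ := hz
    have hz1 : ‖z‖ = 1 := by
      have := congrArg norm hz'
      rw [LinearIsometry.norm_map, norm_smul] at this
      exact (mul_eq_right₀ hn).1 this.symm
    have h1 : inner ℂ (w k) (T (k.1 - k.2) χ) = inner ℂ v χ := LinearIsometry.inner_map_map _ _ _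
    rw [← h1, hz', inner_smul_right, norm_mul, hz1, one_mul]
  have hμχ : ‖inner ℂ v χ‖ ^ 2 = ‖S‖ * ‖χ‖ ^ 2 := by
    have h1 := hS.tendsto_re χ
    simp only [habs] at h1
    have h2 : RCLike.re (inner ℂ (S χ) χ) = ‖inner ℂ v χ‖ ^ 2 := by
      refine tendsto_nhds_unique h1 (tendsto_const_nhds.congr fun N => ?_)
      rw [avg_const ((hΦ.nonempty N).product (hΦ.nonempty N))]
    have h3 : inner ℂ (S χ) χ = ((‖inner ℂ v χ‖ ^ 2 : ℝ) : ℂ) := by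
      rw [← h2]
      have h4 : inner ℂ (S χ) χ = inner ℂ χ (S χ) :=
        (ContinuousLinearMap.isSelfAdjoint_iff_isSymmetric.1 hsa) χ χ
      exact (RCLike.conj_eq_iff_re.1 (by rw [inner_conj_symm, ← h4])).symm
    have h5 := congrArg norm h3
    rw [hSχ, inner_smul_left, norm_mul, RCLike.norm_conj, hμ, inner_self_eq_norm_sq_to_K,
      ← RCLike.ofReal_pow, RCLike.norm_ofReal, abs_of_nonneg (sq_nonneg _), Complex.norm_real,
      Real.norm_of_nonneg (sq_nonneg _)] at h5
    exact h5.symm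
  refine ⟨((‖χ‖ : ℂ)⁻¹) • χ, ?_, fun g => ?_, ?_⟩
  · rw [norm_smul, norm_inv, Complex.norm_real, norm_norm, inv_mul_cancel₀ hn]
  · obtain ⟨z, hz⟩ := hχT g
    refine ⟨z, ?_⟩
    rw [map_smul, smul_comm]
    congr 1
  · rw [inner_smul_right, norm_mul, norm_inv, Complex.norm_real, norm_norm, mul_pow, hμχ, inv_pow,
      mul_left_comm, inv_mul_cancel₀ (pow_ne_zero 2 hn), mul_one]
    exact hcS

end AveragingOperator

/-! ### Bounded measurable functions as a Koopman system -/

section BoundedMeasurable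

variable (X : Type*) [MeasurableSpace X]

/-- The `*`-algebra of bounded measurable functions. -/
def boundedMeasurable : StarSubalgebra ℂ (X → ℂ) where
  carrier := {f | Measurable f ∧ ∃ C, ∀ x, ‖f x‖ ≤ C}
  mul_mem' := by
    rintro f g ⟨hf, C, hC⟩ ⟨hg, D, hD⟩
    refine ⟨hf.mul hg, C * D, fun x => ?_⟩
    rw [Pi.mul_apply, norm_mul]
    exact mul_le_mul (hC x) (hD x) (norm_nonneg _) ((norm_nonneg _).trans (hC x))
  add_mem' := by
    rintro f g ⟨hf, C, hC⟩ ⟨hg, D, hD⟩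
    exact ⟨hf.add hg, C + D, fun x => (norm_add_le _ _).trans (add_le_add (hC x) (hD x))⟩
  algebraMap_mem' c := ⟨measurable_const, ‖c‖, fun _ => le_rfl⟩
  star_mem' := by
    rintro f ⟨hf, C, hC⟩
    exact ⟨continuous_star.measurable.comp hf, C, fun x => by simpa using hC x⟩

variable {X} (μ : Measure X) [IsProbabilityMeasure μ]

theorem boundedMeasurable.memLp (f : boundedMeasurable X) (p : ENNReal) : MemLp f.1 p μ := by
  obtain ⟨hf, C, hC⟩ := f.2
  exact MemLp.of_bound hf.aestronglyMeasurable C (Eventually.of_forall hC)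

theorem boundedMeasurable.integrable (f : boundedMeasurable X) : Integrable f.1 μ :=
  memLp_one_iff_integrable.1 (boundedMeasurable.memLp μ f 1)

variable {F : Type*} [AddCommGroup F] [AddAction F X] [MeasurableConstVAdd F X]
  [VAddInvariantMeasure F X μ]

variable (F) in
/-- The Koopman representation of a measure preserving action. -/
noncomputable def koopmanSystem : KoopmanSystem F (boundedMeasurable X) (Lp ℂ 2 μ) where
  τ g :=
    { toFun := fun f => ⟨fun x => f.1 (g +ᵥ x), f.2.1.comp (measurable_const_vadd g),
        f.2.2.imp fun C hC x => hC _⟩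
      map_one' := rfl
      map_mul' := fun _ _ => rfl
      map_zero' := rfl
      map_add' := fun _ _ => rfl
      commutes' := fun _ => rfl
      map_star' := fun _ => rfl }
  Λ :=
    { toFun := fun f => ∫ x, f.1 x ∂μ
      map_add' := fun f g =>
        integral_add (boundedMeasurable.integrable μ f) (boundedMeasurable.integrable μ g)
      map_smul' := fun c f => integral_const_mul c _ }
  ι :=
    { toFun := fun f => (boundedMeasurable.memLp μ f 2).toLp f.1
      map_add' := fun f g => MemLp.toLp_add _ _
      map_smul' := fun c f => MemLp.toLp_const_smul c _ }
  inner_ι a b := by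
    rw [L2.inner_def]
    refine integral_congr_ae ?_
    filter_upwards [(boundedMeasurable.memLp μ a 2).coeFn_toLp,
      (boundedMeasurable.memLp μ b 2).coeFn_toLp] with x hx hx'
    change inner ℂ ((boundedMeasurable.memLp μ a 2).toLp a.1 x)
      ((boundedMeasurable.memLp μ b 2).toLp b.1 x) = _
    rw [hx, hx', RCLike.inner_apply']
    rfl
  τ_add g h f := Subtype.ext (funext fun x => by
    change f.1 ((g + h) +ᵥ x) = f.1 (h +ᵥ (g +ᵥ x))
    rw [add_comm, add_vadd])
  τ_zero f := Subtype.ext (funext fun x => by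
    change f.1 ((0 : F) +ᵥ x) = f.1 x
    rw [zero_vadd])
  Λ_τ g f := (measurePreserving_vadd g μ).integral_comp' (f := MeasurableEquiv.vadd g) f.1
  Λ_star f := integral_conj
  Λ_one := by
    change ∫ _, (1 : ℂ) ∂μ = 1
    simp

theorem koopmanSystem_Λ (f : boundedMeasurable X) : (koopmanSystem μ F).Λ f = ∫ x, f.1 x ∂μ := rfl

theorem koopmanSystem_ι (f : boundedMeasurable X) :
    (koopmanSystem μ F).ι f = (boundedMeasurable.memLp μ f 2).toLp f.1 := rfl

theorem koopmanSystem_ι_congr {f g : boundedMeasurable X} (h : f.1 =ᵐ[μ] g.1) :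
    (koopmanSystem μ F).ι f = (koopmanSystem μ F).ι g :=
  (MemLp.toLp_eq_toLp_iff (boundedMeasurable.memLp μ f 2) (boundedMeasurable.memLp μ g 2)).2 h

theorem contr_koopmanSystem {f : boundedMeasurable X} (hf : ∀ x, ‖f.1 x‖ ≤ 1) :
    (koopmanSystem μ F).Contr f := fun b => by
  rw [koopmanSystem_ι, koopmanSystem_ι, Lp.norm_toLp, Lp.norm_toLp]
  refine ENNReal.toReal_mono (boundedMeasurable.memLp μ b 2).2.ne (eLpNorm_mono fun x => ?_)
  change ‖f.1 x * b.1 x‖ ≤ _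
  rw [norm_mul]
  exact mul_le_of_le_one_left (norm_nonneg _) (hf x)

theorem compMeasurePreserving_ι (g : F) (f : boundedMeasurable X) :
    Lp.compMeasurePreserving (g +ᵥ ·) (measurePreserving_vadd g μ) ((koopmanSystem μ F).ι f)
      = (koopmanSystem μ F).ι ((koopmanSystem μ F).τ g f) :=
  Lp.toLp_compMeasurePreserving (boundedMeasurable.memLp μ f 2) _

/-- A weak limit of a sequence of contractions along an ultrafilter. -/
theorem exists_weak_limit (U : Ultrafilter ℕ) {y : ℕ → boundedMeasurable X}
    (hy : ∀ N, (koopmanSystem μ F).Contr (y N)) :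
    ∃ y', (koopmanSystem μ F).Contr y' ∧ ∀ x, Tendsto (fun N => (koopmanSystem μ F).Λ (y N * x)) U
      (𝓝 ((koopmanSystem μ F).Λ (y' * x))) := by
  set S := koopmanSystem μ F
  obtain ⟨z, hz⟩ := U.exists_tendsto_inner (y := fun N => S.ι (star (y N))) (C := 1)
    fun N => (hy N).star.norm_ι_le
  have hzx : ∀ x : boundedMeasurable X, inner ℂ z (S.ι x) = ∫ t, star (z t) * x.1 t ∂μ := by
    intro x
    rw [L2.inner_def]
    refine integral_congr_ae ?_
    filter_upwards [(boundedMeasurable.memLp μ x 2).coeFn_toLp] with t ht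
    change inner ℂ (z t) ((boundedMeasurable.memLp μ x 2).toLp x.1 t) = _
    rw [ht, RCLike.inner_apply']
    rfl
  have hz' : ∀ x, Tendsto (fun N => S.Λ (y N * x)) U (𝓝 (∫ t, star (z t) * x.1 t ∂μ)) := by
    intro x
    rw [← hzx]
    refine (hz (S.ι x)).congr fun N => ?_
    rw [S.inner_ι, star_star]
  have hzm : Measurable z := (Lp.stronglyMeasurable z).measurable
  -- The Riesz vector `z` is a priori only in `L²`. Testing against `z` restricted to `B` gives `∫_B
  -- ‖z‖² ≤ μ(B)`, which forces `B` to be null. The upper cutoff `M` makes the test function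
  -- bounded.
  have hB : ∀ M : ℕ, ∀ᵐ t ∂μ, ¬ (1 < ‖z t‖ ∧ ‖z t‖ ≤ M) := by
    intro M
    let B : Set X := {t | 1 < ‖z t‖ ∧ ‖z t‖ ≤ M}
    have hBm : MeasurableSet B :=
      (measurableSet_lt measurable_const hzm.norm).inter (measurableSet_le hzm.norm measurable_const)
    let b : boundedMeasurable X := ⟨B.indicator 1, measurable_one.indicator hBm, 1, fun t => by
      by_cases ht : t ∈ B <;> simp [ht]⟩
    let w : boundedMeasurable X := ⟨B.indicator z, hzm.indicator hBm, M, fun t => by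
      by_cases ht : t ∈ B
      · simpa [ht] using ht.2
      · simp [ht]⟩
    have hbw : b * w = w := Subtype.ext (funext fun t => by
      change B.indicator 1 t * B.indicator z t = B.indicator z t
      by_cases ht : t ∈ B <;> simp [ht])
    have h1 : ‖∫ t, star (z t) * w.1 t ∂μ‖ ≤ ‖S.ι b‖ * ‖S.ι w‖ := by
      refine le_of_tendsto (hz' w).norm (Eventually.of_forall fun N => ?_)
      have h2 : S.Λ (y N * w) = inner ℂ (S.ι (star (y N * b))) (S.ι w) := by
        rw [S.inner_ι, star_star, mul_assoc, hbw]
      rw [h2]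
      refine (norm_inner_le_norm _ _).trans ?_
      gcongr
      rw [S.norm_ι_star]
      exact hy N b
    have h3 : ∀ a : boundedMeasurable X, ‖S.ι a‖ ^ 2 = ∫ t, ‖a.1 t‖ ^ 2 ∂μ := by
      intro a
      have := S.norm_ι_sq a
      have h4 : S.Λ (star a * a) = ((∫ t, ‖a.1 t‖ ^ 2 ∂μ : ℝ) : ℂ) := by
        refine Eq.trans ?_ integral_complex_ofReal
        refine integral_congr_ae (Eventually.of_forall fun t => ?_)
        change star (a.1 t) * a.1 t = _
        rw [RCLike.star_def, RCLike.conj_mul]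
        simp
      rw [h4] at this
      exact_mod_cast this
    have h5 : ∫ t, star (z t) * w.1 t ∂μ = ((‖S.ι w‖ ^ 2 : ℝ) : ℂ) := by
      rw [h3]
      refine Eq.trans ?_ integral_complex_ofReal
      refine integral_congr_ae (Eventually.of_forall fun t => ?_)
      change star (z t) * B.indicator z t = ((‖B.indicator z t‖ ^ 2 : ℝ) : ℂ)
      by_cases ht : t ∈ B
      · simp only [Set.indicator_of_mem ht, RCLike.star_def, RCLike.conj_mul]
        simp
      · simp [ht]
    rw [h5, Complex.norm_real, Real.norm_of_nonneg (sq_nonneg _)] at h1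
    have h6 : ‖S.ι w‖ ^ 2 ≤ ‖S.ι b‖ ^ 2 := by
      nlinarith [norm_nonneg (S.ι w), norm_nonneg (S.ι b), sq_nonneg (‖S.ι w‖ - ‖S.ι b‖)]
    rw [h3, h3] at h6
    have hi : ∀ a : boundedMeasurable X, Integrable (fun t => ‖a.1 t‖ ^ 2) μ := fun a =>
      (boundedMeasurable.memLp μ a 2).integrable_norm_pow two_ne_zero
    have h7 : ∫ t, (‖w.1 t‖ ^ 2 - ‖b.1 t‖ ^ 2) ∂μ = 0 := by
      refine le_antisymm ?_ (integral_nonneg fun t => ?_)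
      · rw [integral_sub (hi w) (hi b)]
        linarith
      · change 0 ≤ ‖B.indicator z t‖ ^ 2 - ‖B.indicator (1 : X → ℂ) t‖ ^ 2
        by_cases ht : t ∈ B
        · have := ht.1
          simp only [Set.indicator_of_mem ht, Pi.one_apply, norm_one]
          nlinarith
        · simp [ht]
    rw [integral_eq_zero_iff_of_nonneg (f := fun t => ‖w.1 t‖ ^ 2 - ‖b.1 t‖ ^ 2) ?_
      ((hi w).sub (hi b))] at h7
    · filter_upwards [h7] with t ht htB
      have h8 : ‖B.indicator z t‖ ^ 2 - ‖B.indicator (1 : X → ℂ) t‖ ^ 2 = 0 := ht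
      have htB' : t ∈ B := htB
      have := htB.1
      simp only [Set.indicator_of_mem htB', Pi.one_apply, norm_one] at h8
      nlinarith
    · intro t
      change 0 ≤ ‖B.indicator z t‖ ^ 2 - ‖B.indicator (1 : X → ℂ) t‖ ^ 2
      by_cases ht : t ∈ B
      · have := ht.1
        simp only [Set.indicator_of_mem ht, Pi.one_apply, norm_one]
        nlinarith
      · simp [ht]
  have hz1 : ∀ᵐ t ∂μ, ‖z t‖ ≤ 1 := by
    filter_upwards [ae_all_iff.2 hB] with t ht
    by_contra! hlt
    obtain ⟨M, hM⟩ := exists_nat_ge ‖z t‖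
    exact ht M ⟨hlt, hM⟩
  have hset : MeasurableSet {t | ‖z t‖ ≤ 1} := measurableSet_le hzm.norm measurable_const
  -- The conjugate undoes the `star` in the vectors `ι (star (y N))` whose limit is `z`; truncation
  -- makes the bound hold everywhere.
  let y' : boundedMeasurable X := ⟨{t | ‖z t‖ ≤ 1}.indicator fun t => star (z t),
    (continuous_star.measurable.comp hzm).indicator hset, 1, fun t => by
      by_cases ht : ‖z t‖ ≤ 1 <;> simp [ht]⟩
  refine ⟨y', contr_koopmanSystem μ fun t => ?_, fun x => ?_⟩
  · change ‖{t | ‖z t‖ ≤ 1}.indicator (fun t => star (z t)) t‖ ≤ 1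
    by_cases ht : ‖z t‖ ≤ 1 <;> simp [ht]
  · have h1 : S.Λ (y' * x) = ∫ t, star (z t) * x.1 t ∂μ := by
      refine integral_congr_ae ?_
      filter_upwards [hz1] with t ht
      change {t | ‖z t‖ ≤ 1}.indicator (fun t => star (z t)) t * x.1 t = _
      rw [Set.indicator_of_mem (show t ∈ {t | ‖z t‖ ≤ 1} from ht)]
    rw [h1]
    exact hz' x

end BoundedMeasurable

/-! ### Eigenfunctions of an ergodic action -/

section Eigenfunctions

variable {X : Type*} [MeasurableSpace X] (μ : Measure X) [IsProbabilityMeasure μ]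
variable {F : Type*} [AddCommGroup F] [AddAction F X] [MeasurableConstVAdd F X]

omit [IsProbabilityMeasure μ] in
/-- An invariant measurable function is constant almost everywhere. -/
theorem exists_ae_eq_const_of_invariant (F : Type*) [AddCommGroup F] [AddAction F X]
    [MeasurableConstVAdd F X] [ErgodicVAdd F X μ] {Y : Type*} [Nonempty Y] [MeasurableSpace Y]
    [MeasurableSpace.CountablySeparated Y] {f : X → Y} (hf : Measurable f)
    (h : ∀ g : F, (fun x => f (g +ᵥ x)) =ᵐ[μ] f) : ∃ c, f =ᵐ[μ] fun _ => c := by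
  refine exists_eventuallyEq_const_of_forall_separating MeasurableSet fun V hV => ?_
  have h1 := ErgodicVAdd.aeconst_of_forall_preimage_vadd_ae_eq (G := F) (μ := μ) (hf hV)
    fun g => (h g).preimage V
  rcases eventuallyConst_set.1 h1 with h2 | h2
  · exact Or.inl h2
  · right
    filter_upwards [h2] with x hx
    exact fun hxV => by simpa using hx hxV

variable (F) in
/-- A bounded measurable function is a unimodular eigenfunction if it is of modulus one and its
translates are multiples of it. -/
def IsUnimodularEigenfunction (χ : boundedMeasurable X) : Prop :=
  (∀ x, ‖χ.1 x‖ = 1) ∧ ∃ z : F → ℂ, ∀ g, (fun x => χ.1 (g +ᵥ x)) =ᵐ[μ] fun x => z g * χ.1 x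

omit [IsProbabilityMeasure μ] [MeasurableConstVAdd F X] in
theorem isStarMultiplicative_eigenfunction :
    IsStarMultiplicative (IsUnimodularEigenfunction μ F) := by
  refine ⟨⟨fun x => norm_one, fun _ => 1, fun g => ?_⟩, ?_, ?_⟩
  · exact Eventually.of_forall fun x => (one_mul _).symm
  · rintro a b ⟨ha, z, hz⟩ ⟨hb, z', hz'⟩
    refine ⟨fun x => ?_, fun g => z g * z' g, fun g => ?_⟩
    · change ‖a.1 x * b.1 x‖ = 1
      rw [norm_mul, ha, hb, one_mul]
    · filter_upwards [hz g, hz' g] with x hx hx'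
      change a.1 (g +ᵥ x) * b.1 (g +ᵥ x) = z g * z' g * (a.1 x * b.1 x)
      rw [hx, hx']
      ring
  · rintro a ⟨ha, z, hz⟩
    refine ⟨fun x => ?_, fun g => star (z g), fun g => ?_⟩
    · change ‖star (a.1 x)‖ = 1
      rw [norm_star, ha]
    · filter_upwards [hz g] with x hx
      change star (a.1 (g +ᵥ x)) = star (z g) * star (a.1 x)
      rw [hx, star_mul']

theorem IsUnimodularEigenfunction.exists_ι_mul [VAddInvariantMeasure F X μ]
    {χ : boundedMeasurable X} (hχ : IsUnimodularEigenfunction μ F χ) :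
    ∃ z : F → ℂ, (∀ g, (fun x => χ.1 (g +ᵥ x)) =ᵐ[μ] fun x => z g * χ.1 x) ∧
      ∀ g b, (koopmanSystem μ F).ι ((koopmanSystem μ F).τ g χ * b)
        = z g • (koopmanSystem μ F).ι (χ * b) := by
  obtain ⟨-, z, hz⟩ := hχ
  refine ⟨z, hz, fun g b => ?_⟩
  rw [← map_smul]
  refine koopmanSystem_ι_congr μ ?_
  filter_upwards [hz g] with x hx
  change χ.1 (g +ᵥ x) * b.1 x = z g * (χ.1 x * b.1 x)
  rw [hx, mul_assoc]

variable [ErgodicVAdd F X μ]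

theorem exists_Λ_mul_of_forall_eq_one {χ : boundedMeasurable X} {z : F → ℂ}
    (hz : ∀ g, (fun x => χ.1 (g +ᵥ x)) =ᵐ[μ] fun x => z g * χ.1 x) (hz1 : ∀ g, z g = 1) :
    ∃ c : ℂ, ∀ a, (koopmanSystem μ F).Λ (a * χ) = c * (koopmanSystem μ F).Λ a := by
  obtain ⟨c, hc⟩ := exists_ae_eq_const_of_invariant μ F χ.2.1 fun g => by
    simpa [hz1 g] using hz g
  refine ⟨c, fun a => ?_⟩
  rw [koopmanSystem_Λ, koopmanSystem_Λ, ← integral_const_mul]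
  refine integral_congr_ae ?_
  filter_upwards [hc] with x hx
  change a.1 x * χ.1 x = c * a.1 x
  rw [hx, mul_comm]

omit [IsProbabilityMeasure μ] [MeasurableConstVAdd F X] [ErgodicVAdd F X μ] in
theorem IsUnimodularEigenfunction.mul_star_self {χ : boundedMeasurable X}
    (hχ : IsUnimodularEigenfunction μ F χ) : χ * star χ = 1 :=
  Subtype.ext (funext fun x => by
    change χ.1 x * star (χ.1 x) = 1
    rw [RCLike.star_def, RCLike.mul_conj, hχ.1 x]
    simp)

/-- If the character were trivial, `χ` would be constant by ergodicity, and being unimodular it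
could not have integral zero. -/
theorem IsUnimodularEigenfunction.exists_character {χ : boundedMeasurable X}
    (hχ : IsUnimodularEigenfunction μ F χ) :
    ∃ z : F → ℂ, (∀ g b, (koopmanSystem μ F).ι ((koopmanSystem μ F).τ g χ * b)
        = z g • (koopmanSystem μ F).ι (χ * b)) ∧
      ((koopmanSystem μ F).Λ χ = 0 → ∃ g, z g ≠ 1) := by
  obtain ⟨z, hz, hzι⟩ := hχ.exists_ι_mul
  refine ⟨z, hzι, fun h0 => ?_⟩
  by_contra! hz1
  obtain ⟨c, hc⟩ := exists_Λ_mul_of_forall_eq_one μ hz hz1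
  have h1 := hc 1
  rw [one_mul, h0, (koopmanSystem μ F).Λ_one, mul_one] at h1
  have h2 := hc (star χ)
  rw [mul_comm, hχ.mul_star_self, (koopmanSystem μ F).Λ_one, ← h1, zero_mul] at h2
  exact one_ne_zero h2

/-- The eigenvalues are unimodular, so `‖v‖` is invariant pointwise, hence constant by ergodicity,
and the normalisation makes it one. Redefinition on a null set gives modulus one everywhere. -/
theorem exists_eigenfunction_of_mem_Lp {v : Lp ℂ 2 μ} (hv : ‖v‖ = 1)
    (hT : ∀ g : F, ∃ z : ℂ,
      Lp.compMeasurePreserving (g +ᵥ ·) (measurePreserving_vadd g μ) v = z • v) :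
    ∃ χ : boundedMeasurable X, IsUnimodularEigenfunction μ F χ ∧ χ.1 =ᵐ[μ] v := by
  choose z hz using hT
  have hm : Measurable v := (Lp.stronglyMeasurable v).measurable
  have hz1 : ∀ g, ‖z g‖ = 1 := by
    intro g
    have h1 := congrArg norm (hz g)
    rw [Lp.norm_compMeasurePreserving, norm_smul, hv, mul_one] at h1
    exact h1.symm
  have hzv : ∀ g : F, (fun x => v (g +ᵥ x)) =ᵐ[μ] fun x => z g * v x := by
    intro g
    have h1 := Lp.coeFn_compMeasurePreserving v (measurePreserving_vadd g μ)
    rw [hz g] at h1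
    filter_upwards [h1, Lp.coeFn_smul (z g) v] with x hx hx'
    rw [hx'] at hx
    exact hx.symm
  obtain ⟨c, hc⟩ := exists_ae_eq_const_of_invariant μ F (f := fun x => ‖v x‖) hm.norm fun g => by
    filter_upwards [hzv g] with x hx
    rw [hx, norm_mul, hz1, one_mul]
  have hc1 : c = 1 := by
    have hc0 : 0 ≤ c := by
      obtain ⟨x, hx⟩ := hc.exists
      exact (norm_nonneg (v x)).trans_eq hx
    have h1 : (inner ℂ v v : ℂ) = ((c ^ 2 : ℝ) : ℂ) := by
      rw [L2.inner_def]
      have h2 : (fun x => (inner ℂ (v x) (v x) : ℂ)) =ᵐ[μ] fun _ => ((c ^ 2 : ℝ) : ℂ) := by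
        filter_upwards [hc] with x hx
        rw [inner_self_eq_norm_sq_to_K, hx]
        simp
      rw [integral_congr_ae h2]
      simp
    rw [inner_self_eq_norm_sq_to_K, hv] at h1
    have h2 : (1 : ℝ) = c ^ 2 := by
      have : ((1 : ℝ) : ℂ) = ((c ^ 2 : ℝ) : ℂ) := by simpa using h1
      exact_mod_cast this
    nlinarith
  subst hc1
  have hset : MeasurableSet {x | ‖v x‖ = 1} := measurableSet_eq_fun hm.norm measurable_const
  classical
  let χ : boundedMeasurable X := ⟨fun x => if ‖v x‖ = 1 then v x else 1,
    Measurable.ite hset hm measurable_const, 1, fun x => by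
      change ‖if ‖v x‖ = 1 then v x else 1‖ ≤ 1
      split_ifs with h <;> simp [h]⟩
  have hχv : χ.1 =ᵐ[μ] v := by
    filter_upwards [hc] with x hx
    exact if_pos hx
  refine ⟨χ, ⟨fun x => ?_, z, fun g => ?_⟩, hχv⟩
  · change ‖if ‖v x‖ = 1 then v x else 1‖ = 1
    split_ifs with h <;> simp [h]
  · have h1 := (measurePreserving_vadd g μ).quasiMeasurePreserving.ae_eq_comp hχv
    filter_upwards [h1, hzv g, hχv] with x hx hx' hx''
    rw [hx'', ← hx']
    exact hx

theorem isEigenClass_koopmanSystem [DecidableEq F] {Φ : ℕ → Finset F} (hΦ : IsFolnerSequence Φ) :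
    (koopmanSystem μ F).IsEigenClass (IsUnimodularEigenfunction μ F) where
  mul_star_self hχ := hχ.mul_star_self
  isStarMultiplicative := isStarMultiplicative_eigenfunction μ
  map_τ {χ} hχ g := by
    obtain ⟨h1, z, hz⟩ := hχ
    refine ⟨fun x => h1 _, z, fun h => ?_⟩
    filter_upwards [(measurePreserving_vadd g μ).quasiMeasurePreserving.ae_eq_comp (hz h)] with x hx
    change χ.1 (g +ᵥ (h +ᵥ x)) = z h * χ.1 (g +ᵥ x)
    rw [vadd_comm g h]
    exact hx
  exists_character hχ := hχ.exists_character
  exists_Λ_mul := by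
    intro χ hχ h0
    obtain ⟨z, hz, hzι⟩ := hχ.exists_ι_mul
    refine exists_Λ_mul_of_forall_eq_one μ hz fun g => ?_
    have h1 : (koopmanSystem μ F).Λ ((koopmanSystem μ F).τ g χ)
        = z g * (koopmanSystem μ F).Λ χ := by
      rw [koopmanSystem_Λ, koopmanSystem_Λ, ← integral_const_mul]
      exact integral_congr_ae (hz g)
    rw [KoopmanSystem.Λ_τ] at h1
    exact (mul_eq_right₀ h0).1 h1.symm
  exists_G_one_le f hf := by
    set S := koopmanSystem μ F
    rcases (S.G_nonneg 1 f).eq_or_lt with h0 | h0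
    · refine ⟨1, (isStarMultiplicative_eigenfunction μ).one, ?_⟩
      rw [← h0]
      positivity
    have hT : ∀ g a, Lp.compMeasurePreservingₗᵢ ℂ (g +ᵥ ·) (measurePreserving_vadd g μ) (S.ι a)
        = S.ι (S.τ g a) := fun g a => compMeasurePreserving_ι μ g a
    have hadd : ∀ (g h : F) (x : Lp ℂ 2 μ),
        Lp.compMeasurePreservingₗᵢ ℂ ((g + h) +ᵥ ·) (measurePreserving_vadd (g + h) μ) x
          = Lp.compMeasurePreservingₗᵢ ℂ (g +ᵥ ·) (measurePreserving_vadd g μ)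
            (Lp.compMeasurePreservingₗᵢ ℂ (h +ᵥ ·) (measurePreserving_vadd h μ) x) := by
      intro g h x
      have e : x = (Lp.memLp x).toLp x := (Lp.toLp_coeFn x _).symm
      rw [e]
      change Lp.compMeasurePreserving _ _ _ = Lp.compMeasurePreserving _ _
        (Lp.compMeasurePreserving _ _ _)
      rw [Lp.toLp_compMeasurePreserving, Lp.toLp_compMeasurePreserving,
        Lp.toLp_compMeasurePreserving]
      congr 1
      ext t
      simp only [Function.comp_apply, ← add_vadd, add_comm]
    have hzero : ∀ x : Lp ℂ 2 μ,
        Lp.compMeasurePreservingₗᵢ ℂ ((0 : F) +ᵥ ·) (measurePreserving_vadd (0 : F) μ) x = x := by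
      intro x
      have e : x = (Lp.memLp x).toLp x := (Lp.toLp_coeFn x _).symm
      conv_rhs => rw [e]
      rw [e]
      change Lp.compMeasurePreserving _ _ _ = _
      rw [Lp.toLp_compMeasurePreserving]
      congr 1
      ext t
      simp
    -- `G 1 f` is the limit of averages of `‖⟪T (h - h') f, f⟫‖²`, by invariance of the integral, so
    -- the spectral argument applies to `ι f`.
    obtain ⟨v, hv1, hv2, hv3⟩ := hΦ.exists_eigenvector
      (fun g => Lp.compMeasurePreservingₗᵢ ℂ (g +ᵥ ·) (measurePreserving_vadd g μ)) hadd
      hf.norm_ι_le hzero h0 ((S.tendsto_avg_G hΦ 0 f).congr fun N => avg_congr fun h _ =>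
        avg_congr fun h' _ => by
          simp only [hT]
          rw [S.inner_ι, KoopmanSystem.G, ← norm_star (S.Λ _), ← S.Λ_star]
          have e : star (S.τ h f * star (S.τ h' f))
              = S.τ h' (star (S.τ (h - h') f) * f) := by
            rw [map_mul, map_star, ← S.τ_add, add_sub_cancel, star_mul, star_star, mul_comm]
          rw [e, S.Λ_τ])
    obtain ⟨χ, hχ, hχv⟩ := exists_eigenfunction_of_mem_Lp μ hv1 hv2
    refine ⟨star χ, (isStarMultiplicative_eigenfunction μ).star hχ, hv3.trans_eq ?_⟩
    have e : v = S.ι χ := by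
      refine Lp.ext ?_
      exact hχv.symm.trans (boundedMeasurable.memLp μ χ 2).coeFn_toLp.symm
    rw [e, S.inner_ι, ← norm_star (S.Λ _), ← S.Λ_star, star_mul, star_star, mul_comm]

end Eigenfunctions

/-! ### Weyl equidistribution for characters along polynomials -/

section Weyl

open Polynomial

variable {F : Type*} [Field F] [DecidableEq F] {Φ : ℕ → Finset F} {κ : Type*}

theorem AddChar.star_eq_neg {G : Type*} [AddCommGroup G] {χ : AddChar G ℂ} (hχ : ∀ x, ‖χ x‖ = 1)
    (x : G) : star (χ x) = χ (-x) := by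
  rw [χ.map_neg_eq_inv, Complex.inv_def, Complex.normSq_eq_norm_sq, hχ]
  simp

/-- Weyl equidistribution of polynomial phases: the averages of a product of characters evaluated
along polynomials vanish in the limit if the phase has a nontrivial nonconstant coefficient. -/
theorem IsFolnerSequence.tendsto_avg_prod_addChar_of_coeff [CharZero F] (hΦ : IsFolnerSequence Φ)
    (T : Finset κ) {χ : κ → AddChar F ℂ} (hχ : ∀ j x, ‖χ j x‖ = 1) {D : ℕ} {p : κ → F[X]}
    (hD : ∀ j, (p j).natDegree ≤ D) {d : ℕ} (hd : d ≠ 0) {x : F}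
    (hx : ∏ j ∈ T, χ j ((p j).coeff d * x) ≠ 1) :
    Tendsto (fun N => avg ℂ (Φ N) fun n => ∏ j ∈ T, χ j ((p j).eval n)) atTop (𝓝 0) := by
  induction D generalizing p d x with
  | zero =>
    refine absurd (Finset.prod_eq_one fun j _ => ?_) hx
    rw [coeff_eq_zero_of_natDegree_lt (by have := hD j; omega), zero_mul, AddChar.map_zero_eq_one]
  | succ D ih =>
    have hnorm : ∀ (p : κ → F[X]) n, ‖∏ j ∈ T, χ j ((p j).eval n)‖ = 1 := fun p n => by
      rw [norm_prod]
      exact Finset.prod_eq_one fun j _ => hχ j _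
    -- A trivial top-degree phase can be deleted, which lowers the degree bound. A nontrivial one is
    -- handled by shift invariance in degree one, and by van der Corput in higher degree.
    by_cases htop : ∀ y, ∏ j ∈ T, χ j ((p j).coeff (D + 1) * y) = 1
    · have hdD : d ≠ D + 1 := by
        rintro rfl
        exact hx (htop x)
      let q : κ → F[X] := fun j => p j - monomial (D + 1) ((p j).coeff (D + 1))
      have hq : ∀ j, (q j).natDegree ≤ D := by
        intro j
        refine natDegree_le_iff_coeff_eq_zero.2 fun m hm => ?_
        rw [coeff_sub, coeff_monomial]
        split_ifs with h
        · rw [h, sub_self]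
        · rw [sub_zero, coeff_eq_zero_of_natDegree_lt]
          have := hD j
          omega
      have hqd : ∏ j ∈ T, χ j ((q j).coeff d * x) ≠ 1 := by
        simpa [q, coeff_sub, coeff_monomial, hdD.symm] using hx
      refine (ih hq hd hqd).congr fun N => avg_congr fun n _ => ?_
      rw [← mul_one (∏ j ∈ T, χ j ((q j).eval n)), ← htop (n ^ (D + 1)), ← Finset.prod_mul_distrib]
      refine Finset.prod_congr rfl fun j _ => ?_
      rw [← AddChar.map_add_eq_mul, eval_sub, eval_monomial, sub_add_cancel]
    · push Not at htop
      obtain ⟨y, hy⟩ := htop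
      rcases Nat.eq_zero_or_pos D with rfl | hDpos
      · have hlin : ∀ n, ∏ j ∈ T, χ j ((p j).eval (n + y))
            = (∏ j ∈ T, χ j ((p j).coeff 1 * y)) * ∏ j ∈ T, χ j ((p j).eval n) := by
          intro n
          rw [← Finset.prod_mul_distrib]
          refine Finset.prod_congr rfl fun j _ => ?_
          rw [← AddChar.map_add_eq_mul, eq_X_add_C_of_natDegree_le_one (hD j)]
          congr 1
          simp
          ring
        set z := ∏ j ∈ T, χ j ((p j).coeff 1 * y)
        have h1 := hΦ.tendsto_avg_shift_sub (𝕜 := ℂ) (fun n => (hnorm p n).le) y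
        have hz : z - 1 ≠ 0 := sub_ne_zero.2 hy
        have h2 := h1.const_mul (z - 1)⁻¹
        rw [mul_zero] at h2
        -- Shifting by `y` multiplies the phase by `z ≠ 1`, yet changes the average by `o(1)`;
        -- dividing by `z - 1` gives the limit.
        refine h2.congr fun N => ?_
        simp only [hlin, avg_mul_left]
        field_simp
      · have key : ∀ H : Finset F, H.Nonempty → LimLe (fun N =>
            ‖avg ℂ (Φ N) fun n => ∏ j ∈ T, χ j ((p j).eval n)‖ ^ 2) ((H.card : ℝ)⁻¹) := by
          intro H hH
          refine (hΦ.vanDerCorput (𝕜 := ℂ) (fun n => (hnorm p n).le) hH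
            (fun h h' => if h = h' then 1 else 0) fun h _ h' _ => ?_).mono (fun _ => le_rfl) ?_
          · have hinner : ∀ n, inner ℂ (∏ j ∈ T, χ j ((p j).eval (n + h)))
                (∏ j ∈ T, χ j ((p j).eval (n + h')))
                = ∏ j ∈ T, χ j ((taylor h' (p j) - taylor h (p j)).eval n) := by
              intro n
              rw [RCLike.inner_apply', map_prod, ← Finset.prod_mul_distrib]
              refine Finset.prod_congr rfl fun j _ => ?_
              have := AddChar.star_eq_neg (hχ j) ((p j).eval (n + h))
              rw [RCLike.star_def] at this
              rw [this, ← AddChar.map_add_eq_mul, eval_sub, taylor_eval, taylor_eval, neg_add_eq_sub]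
            simp only [hinner]
            split_ifs with hh
            · exact LimLe.of_le fun N => norm_avg_le_of_le zero_le_one fun n _ => (hnorm _ n).le
            · have hc : ((D + 1 : ℕ) : F) * (h' - h) ≠ 0 :=
                mul_ne_zero (by exact_mod_cast Nat.succ_ne_zero D) (sub_ne_zero.2 (Ne.symm hh))
              refine LimLe.of_tendsto ?_
              rw [← norm_zero (E := ℂ)]
              -- The difference has degree at most `D`, with coefficient of degree `D` equal to `(D
              -- + 1) * (h' - h)` times the old top coefficient; `x` is scaled so that the new phase
              -- there equals the old one at `y`.
              refine (ih (p := fun j => taylor h' (p j) - taylor h (p j)) (fun j => ?_)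
                hDpos.ne' (x := (((D + 1 : ℕ) : F) * (h' - h))⁻¹ * y) ?_).norm
              · refine natDegree_le_iff_coeff_eq_zero.2 fun m hm => ?_
                rcases (show m = D + 1 ∨ D + 1 < m by omega) with rfl | hm'
                · have h1 := fun u => coeff_taylor_pred_of_le ((hD j).trans (Nat.le_succ _)) u
                  rw [coeff_sub, h1, h1, coeff_eq_zero_of_natDegree_lt (n := D + 1 + 1)]
                  · ring
                  · have := hD j
                    omega
                · exact coeff_eq_zero_of_natDegree_lt
                    ((natDegree_taylor_sub_taylor_le (hD j) (hD j) _ _).trans_lt hm')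
              · convert hy using 3 with j
                rw [coeff_sub, coeff_taylor_pred_of_le (hD j), coeff_taylor_pred_of_le (hD j)]
                push_cast at hc ⊢
                field_simp
                ring
          · have h1 : ∀ h ∈ H, avg ℝ H (fun h' => if h = h' then (1 : ℝ) else 0)
                = (H.card : ℝ)⁻¹ := fun h hh => by simp [avg, hh]
            rw [avg_congr h1, avg_const hH]
        have h0 : LimLe (fun N => ‖avg ℂ (Φ N) fun n => ∏ j ∈ T, χ j ((p j).eval n)‖ ^ 2) 0 := by
          refine LimLe.of_forall_pos fun ε hε => ?_
          obtain ⟨n, hn⟩ := exists_nat_gt ε⁻¹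
          have hn0 : (0 : ℝ) < n := (inv_pos.2 hε).trans hn
          obtain ⟨H, hH⟩ := Infinite.exists_subset_card_eq F n
          refine (key H (Finset.card_pos.1 (by rw [hH]; exact_mod_cast hn0))).mono (fun _ => le_rfl) ?_
          rw [hH, zero_add]
          exact inv_le_of_inv_le₀ hε hn.le
        have h1 := h0.tendsto_zero fun N => sq_nonneg _
        rw [tendsto_zero_iff_norm_tendsto_zero]
        simpa using h1.sqrt

/-- Weyl equidistribution for independent polynomials. -/
theorem IsFolnerSequence.tendsto_avg_prod_addChar [CharZero F] (hΦ : IsFolnerSequence Φ) {k : ℕ}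
    {p : Fin k → F[X]} (hp : IndependentPolynomials p) {χ : Fin k → AddChar F ℂ}
    (hχ : ∀ j x, ‖χ j x‖ = 1) {j₀ : Fin k} {y : F} (hy : χ j₀ y ≠ 1) :
    Tendsto (fun N => avg ℂ (Φ N) fun n => ∏ j, χ j ((p j).eval n)) atTop (𝓝 0) := by
  classical
  by_cases hcon : ∀ d : ℕ, d ≠ 0 → ∀ x, ∏ j, χ j ((p j).coeff d * x) = 1
  · exfalso
    -- The vectors of non-constant coefficients span `F^k`, since a functional killing them all
    -- would give a constant linear combination. If every phase were trivial, the product character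
    -- would be trivial on `V`, hence in every single slot.
    let V : Submodule F (Fin k → F) :=
      Submodule.span F ((fun (d : ℕ) j => (p j).coeff d) '' {d | d ≠ 0})
    have hV : V = ⊤ := by
      by_contra hne
      obtain ⟨φ, hφ0, hφ⟩ := V.exists_le_ker_of_lt_top (lt_top_iff_ne_top.2 hne)
      let b : Fin k → F := fun j => φ (Pi.single j 1)
      have hφb : ∀ v : Fin k → F, φ v = ∑ j, b j * v j := by
        intro v
        conv_lhs => rw [pi_eq_sum_univ' v]
        rw [map_sum]
        exact Finset.sum_congr rfl fun j _ => by rw [map_smul, smul_eq_mul, mul_comm]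
      have hb : b ≠ 0 := by
        rintro hb
        refine hφ0 (LinearMap.ext fun v => ?_)
        rw [hφb, hb]
        simp
      refine hp b hb ((∑ j, C (b j) * p j).coeff 0) (Polynomial.ext fun d => ?_)
      rcases eq_or_ne d 0 with rfl | hd
      · rw [coeff_C_zero]
      · rw [coeff_C_of_ne_zero hd, finsetSum_coeff]
        have h1 : φ (fun j => (p j).coeff d) = 0 := hφ (Submodule.subset_span ⟨d, hd, rfl⟩)
        rw [hφb] at h1
        simpa only [coeff_C_mul] using h1
    have key : ∀ v ∈ V, ∏ j, χ j (v j) = 1 := by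
      intro v hv
      induction hv using Submodule.closure_induction with
      | zero => simp
      | add v w _ _ hv hw =>
        simp only [Pi.add_apply, AddChar.map_add_eq_mul, Finset.prod_mul_distrib, hv, hw, one_mul]
      | smul_mem c v hv =>
        obtain ⟨d, hd, rfl⟩ := hv
        simpa [mul_comm] using hcon d hd c
    have h1 := key (Pi.single j₀ y) (hV ▸ Submodule.mem_top)
    rw [Finset.prod_eq_single j₀ (fun j _ hj => by simp [Pi.single_eq_of_ne hj]) (by simp),
      Pi.single_eq_same] at h1
    exact hy h1
  · push Not at hcon
    obtain ⟨d, hd, x, hx⟩ := hcon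
    exact hΦ.tendsto_avg_prod_addChar_of_coeff Finset.univ hχ
      (fun j => Finset.le_sup (f := fun j => (p j).natDegree) (Finset.mem_univ j)) hd hx

end Weyl

/-! ### Multiple averages: multilinearity and the eigenfunction case -/

namespace KoopmanSystem

section

variable {F A E : Type*} [AddCommGroup F] [CommRing A] [StarRing A] [Algebra ℂ A]
    [StarModule ℂ A] [NormedAddCommGroup E] [InnerProductSpace ℂ E] {S : KoopmanSystem F A E}

theorem Λ_eq_inner (a : A) : S.Λ a = inner ℂ (S.ι 1) (S.ι a) := by
  rw [S.inner_ι, star_one, one_mul]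

theorem Contr.avg {ι : Type*} (H : Finset ι) {f : ι → A} (hf : ∀ i, S.Contr (f i)) :
    S.Contr (avg ℂ H f) := fun b => by
  rw [show S.ι (_root_.avg ℂ H f * b) = (S.ι ∘ₗ LinearMap.mulRight ℂ b) (_root_.avg ℂ H f) from rfl,
    map_avg]
  exact norm_avg_le_of_le (norm_nonneg _) fun i _ => hf i b

theorem Contr.half_sub {a b : A} (ha : S.Contr a) (hb : S.Contr b) :
    S.Contr ((2⁻¹ : ℂ) • (a - b)) := fun c => by
  rw [smul_mul_assoc, map_smul, norm_smul, sub_mul, map_sub]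
  have h1 := norm_sub_le (S.ι (a * c)) (S.ι (b * c))
  have h2 := ha c
  have h3 := hb c
  have h4 : ‖(2⁻¹ : ℂ)‖ = 2⁻¹ := by simp
  rw [h4]
  linarith

theorem ι_one_ne_zero : S.ι 1 ≠ 0 := by
  rw [← norm_ne_zero_iff, S.norm_ι_one]
  exact one_ne_zero

theorem norm_ι_of_mul_star_self {χ : A} (h : χ * star χ = 1) : ‖S.ι χ‖ = 1 := by
  rw [← S.norm_ι_one]
  exact S.norm_ι_eq (by rw [mul_comm, h, star_one, one_mul])

theorem ι_prod_τ_mul {κ : Type*} (T : Finset κ) {χ : κ → A} {z : κ → AddChar F ℂ}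
    (hz : ∀ j ∈ T, ∀ g b, S.ι (S.τ g (χ j) * b) = z j g • S.ι (χ j * b)) (e : κ → F) (b : A) :
    S.ι ((∏ j ∈ T, S.τ (e j) (χ j)) * b) = (∏ j ∈ T, z j (e j)) • S.ι ((∏ j ∈ T, χ j) * b) := by
  classical
  induction T using Finset.induction_on generalizing b with
  | empty => simp
  | insert j T hj ih =>
    rw [Finset.prod_insert hj, Finset.prod_insert hj, Finset.prod_insert hj, mul_assoc,
      hz j (by simp), mul_left_comm, ih (fun i hi => hz i (by simp [hi])), mul_smul, mul_left_comm,
      mul_assoc]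

namespace IsEigenClass

variable {Eig : A → Prop} (hEig : S.IsEigenClass Eig)
include hEig

theorem contr {χ : A} (hχ : Eig χ) : S.Contr χ := contr_of_mul_star_self (hEig.mul_star_self hχ)

/-- The character of an eigenfunction. -/
theorem exists_addChar {χ : A} (hχ : Eig χ) : ∃ z : AddChar F ℂ, (∀ g, ‖z g‖ = 1) ∧
    (∀ g b, S.ι (S.τ g χ * b) = z g • S.ι (χ * b)) ∧ (S.Λ χ = 0 ↔ ∃ g, z g ≠ 1) := by
  obtain ⟨z, hz, hz'⟩ := hEig.exists_character hχ
  -- Unimodularity turns `χ * star χ` into `1`, so scalars can be compared on the nonzero vector `ι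
  -- 1`.
  have h1 : ∀ w w' : ℂ, w • S.ι (χ * star χ) = w' • S.ι (χ * star χ) → w = w' := by
    intro w w' h
    rw [hEig.mul_star_self hχ] at h
    exact smul_left_injective ℂ S.ι_one_ne_zero h
  refine ⟨⟨z, h1 _ _ ?_, fun g h => h1 _ _ ?_⟩, fun g => ?_, hz, hz', ?_⟩
  · rw [← hz, S.τ_zero, one_smul]
  · rw [← hz, mul_smul, smul_comm, ← hz, ← map_smul, ← sub_eq_zero, ← map_sub,
      ← norm_eq_zero, S.τ_add, ← S.norm_ι_τ (-g), map_sub, map_smul, map_mul, map_mul, S.τ_neg_τ,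
      S.τ_neg_τ, map_sub, map_smul, hz, sub_self, norm_zero]
  · have h2 := congrArg norm (hz g 1)
    rw [norm_smul, mul_one, mul_one, S.norm_ι_τ,
      norm_ι_of_mul_star_self (hEig.mul_star_self hχ), mul_one] at h2
    exact h2.symm
  · rintro ⟨g, hg⟩
    by_contra h0
    have h2 : S.Λ (S.τ g χ) = z g * S.Λ χ := by
      have := hz g 1
      rw [mul_one, mul_one] at this
      rw [Λ_eq_inner, this, inner_smul_right, ← Λ_eq_inner]
    rw [S.Λ_τ] at h2
    exact hg ((mul_eq_right₀ h0).1 h2.symm)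

/-- The class axiom says that `χ` is a scalar only under the integral; expanding the squared norm of
the difference upgrades this to `L²`. -/
theorem ι_mul_of_Λ_ne_zero {χ : A} (hχ : Eig χ) (h0 : S.Λ χ ≠ 0) (b : A) :
    S.ι (χ * b) = S.Λ χ • S.ι b := by
  obtain ⟨κ, hκ⟩ := hEig.exists_Λ_mul hχ h0
  have h1 : S.Λ χ = κ := by
    have := hκ 1
    rwa [one_mul, S.Λ_one, mul_one] at this
  rw [h1, ← map_smul, ← sub_eq_zero, ← map_sub, ← inner_self_eq_zero (𝕜 := ℂ), S.inner_ι, mul_sub,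
    map_sub, mul_smul_comm, map_smul, smul_eq_mul, ← hκ]
  rw [sub_eq_zero]
  congr 1
  ring

theorem ι_prod_mul_of_Λ_ne_zero {κ : Type*} (T : Finset κ) {χ : κ → A} (hχ : ∀ j ∈ T, Eig (χ j))
    (h0 : ∀ j ∈ T, S.Λ (χ j) ≠ 0) (b : A) :
    S.ι ((∏ j ∈ T, χ j) * b) = (∏ j ∈ T, S.Λ (χ j)) • S.ι b := by
  classical
  induction T using Finset.induction_on with
  | empty => simp
  | insert j T hj ih =>
    rw [Finset.prod_insert hj, Finset.prod_insert hj, mul_assoc,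
      hEig.ι_mul_of_Λ_ne_zero (hχ j (by simp)) (h0 j (by simp)),
      ih (fun i hi => hχ i (by simp [hi])) (fun i hi => h0 i (by simp [hi])), mul_smul]

end IsEigenClass

end

open Polynomial

variable {F A E : Type*} [Field F] [CommRing A] [StarRing A]
    [Algebra ℂ A] [StarModule ℂ A] [NormedAddCommGroup E] [InnerProductSpace ℂ E]
    {S : KoopmanSystem F A E} {Φ : ℕ → Finset F} {k : ℕ} {p : Fin k → F[X]}

theorem _root_.IndependentPolynomials.natDegree_pos (hp : IndependentPolynomials p) (j : Fin k) :
    0 < (p j).natDegree := by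
  by_contra! h0
  refine hp (Pi.single j 1) (by simp) ((p j).coeff 0) ?_
  rw [Finset.sum_eq_single j (fun i _ hi => by simp [Pi.single_eq_of_ne hi]) (by simp),
    Pi.single_eq_same, C_1, one_mul]
  exact eq_C_of_natDegree_le_zero h0

theorem _root_.IndependentPolynomials.natDegree_sub_pos (hp : IndependentPolynomials p) {i j : Fin k}
    (hij : i ≠ j) : 0 < (p i - p j).natDegree := by
  by_contra! h0
  refine hp (Pi.single i 1 - Pi.single j 1) (fun h => ?_) ((p i - p j).coeff 0) ?_
  · have := congrFun h i
    simp [Pi.single_eq_of_ne hij] at this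
  · rw [← eq_C_of_natDegree_le_zero h0]
    simp only [Pi.sub_apply, C_sub, sub_mul, Finset.sum_sub_distrib]
    rw [Finset.sum_eq_single i (fun l _ hl => by simp [Pi.single_eq_of_ne hl]) (by simp),
      Finset.sum_eq_single j (fun l _ hl => by simp [Pi.single_eq_of_ne hl]) (by simp)]
    simp

/-- The polynomial multiple ergodic averages. -/
noncomputable def multiAvg (S : KoopmanSystem F A E) (p : Fin k → F[X]) (H : Finset F)
    (f : Fin k → A) : A :=
  avg ℂ H fun n => ∏ j, S.τ ((p j).eval n) (f j)

/-- The averages of `f` along `p` converge to the product of the integrals. -/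
def MultiConv (S : KoopmanSystem F A E) (p : Fin k → F[X]) (Φ : ℕ → Finset F)
    (f : Fin k → A) : Prop :=
  Tendsto (fun N => S.ι (S.multiAvg p (Φ N) f)) atTop (𝓝 ((∏ j, S.Λ (f j)) • S.ι 1))

theorem multiAvg_update (H : Finset F) (f : Fin k → A) (m : Fin k) (a : A) :
    S.multiAvg p H (Function.update f m a) = avg ℂ H fun n =>
      (∏ j ∈ Finset.univ.erase m, S.τ ((p j).eval n) (f j)) * S.τ ((p m).eval n) a := by
  refine avg_congr fun n _ => ?_
  rw [← Finset.prod_erase_mul _ _ (Finset.mem_univ m), Function.update_self]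
  congr 1
  refine Finset.prod_congr rfl fun j hj => ?_
  rw [Function.update_of_ne (Finset.ne_of_mem_erase hj)]

theorem prod_Λ_update (f : Fin k → A) (m : Fin k) (a : A) :
    ∏ j, S.Λ (Function.update f m a j) = (∏ j ∈ Finset.univ.erase m, S.Λ (f j)) * S.Λ a := by
  rw [← Finset.prod_erase_mul _ _ (Finset.mem_univ m), Function.update_self]
  congr 1
  refine Finset.prod_congr rfl fun j hj => ?_
  rw [Function.update_of_ne (Finset.ne_of_mem_erase hj)]

/-- The averages are linear in each function. -/
theorem MultiConv.of_update {f : Fin k → A} {m : Fin k} {a b : A} {c d : ℂ}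
    (ha : S.MultiConv p Φ (Function.update f m a)) (hb : S.MultiConv p Φ (Function.update f m b))
    (hf : f m = c • a + d • b) : S.MultiConv p Φ f := by
  have hfu : f = Function.update f m (c • a + d • b) := by rw [← hf, Function.update_eq_self]
  rw [hfu]
  unfold MultiConv at *
  rw [prod_Λ_update] at *
  have h1 := (ha.const_smul c).add (hb.const_smul d)
  have h2 : (∏ j ∈ Finset.univ.erase m, S.Λ (f j)) * S.Λ (c • a + d • b)
      = c * ((∏ j ∈ Finset.univ.erase m, S.Λ (f j)) * S.Λ a)
        + d * ((∏ j ∈ Finset.univ.erase m, S.Λ (f j)) * S.Λ b) := by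
    rw [map_add, map_smul, map_smul, smul_eq_mul, smul_eq_mul]
    ring
  rw [h2, add_smul, mul_smul c, mul_smul d]
  refine h1.congr fun N => ?_
  rw [multiAvg_update, multiAvg_update, multiAvg_update, ← map_smul, ← map_smul, ← map_add,
    ← avg_smul, ← avg_smul, ← avg_add]
  congr 1
  refine avg_congr fun n _ => ?_
  rw [map_add, map_smul, map_smul, mul_add, mul_smul_comm, mul_smul_comm]

/-- The convergence of the averages of eigenfunctions. -/
theorem multiConv_of_eig [DecidableEq F] [CharZero F] (hΦ : IsFolnerSequence Φ) (hp : IndependentPolynomials p)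
    {Eig : A → Prop} (hEig : S.IsEigenClass Eig) {χ : Fin k → A} (hχ : ∀ j, Eig (χ j)) :
    S.MultiConv p Φ χ := by
  choose z hz1 hz hz0 using fun j => hEig.exists_addChar (hχ j)
  have h1 : ∀ N, S.ι (S.multiAvg p (Φ N) χ)
      = (avg ℂ (Φ N) fun n => ∏ j, z j ((p j).eval n)) • S.ι (∏ j, χ j) := by
    intro N
    rw [multiAvg, map_avg, avg, avg, smul_assoc, Finset.sum_smul]
    congr 1
    refine Finset.sum_congr rfl fun n _ => ?_
    have := ι_prod_τ_mul Finset.univ (fun j _ => hz j) (fun j => (p j).eval n) 1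
    simpa using this
  unfold MultiConv
  simp only [h1]
  by_cases h0 : ∀ j, S.Λ (χ j) ≠ 0
  · have h2 : ∀ j g, z j g = 1 := by
      intro j
      by_contra! h
      exact h0 j ((hz0 j).2 h)
    have h3 := hEig.ι_prod_mul_of_Λ_ne_zero Finset.univ (fun j _ => hχ j) (fun j _ => h0 j) 1
    rw [mul_one] at h3
    simp only [h2, Finset.prod_const_one, h3]
    refine tendsto_const_nhds.congr fun N => ?_
    rw [avg_const (hΦ.nonempty N), one_smul]
  · push Not at h0
    obtain ⟨j, hj⟩ := h0
    obtain ⟨y, hy⟩ := (hz0 j).1 hj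
    rw [Finset.prod_eq_zero (f := fun j => S.Λ (χ j)) (Finset.mem_univ j) hj, zero_smul,
      ← zero_smul ℂ (S.ι (∏ j, χ j))]
    exact (hΦ.tendsto_avg_prod_addChar hp hz1 hy).smul_const _

end KoopmanSystem

/-! ### The induction on the number of slots that are not eigenfunctions -/

namespace KoopmanSystem

open Polynomial

variable {F A E : Type*} [Field F] [CommRing A] [StarRing A]
    [Algebra ℂ A] [StarModule ℂ A] [NormedAddCommGroup E] [InnerProductSpace ℂ E]
    {S : KoopmanSystem F A E} {Φ : ℕ → Finset F} {k : ℕ} {p : Fin k → F[X]}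

/-- Sequences of contractions have weak limits along ultrafilters. -/
def HasWeakLimits (S : KoopmanSystem F A E) : Prop :=
  ∀ (U : Ultrafilter ℕ) (y : ℕ → A), (∀ N, S.Contr (y N)) →
    ∃ y', S.Contr y' ∧ ∀ x, Tendsto (fun N => S.Λ (y N * x)) U (𝓝 (S.Λ (y' * x)))

theorem contr_multiAvg {f : Fin k → A} (hf : ∀ j, S.Contr (f j)) (H : Finset F) :
    S.Contr (S.multiAvg p H f) :=
  Contr.avg H fun _ => Contr.prod fun j _ => (hf j).τ _

theorem Contr.update {f : Fin k → A} (hf : ∀ j, S.Contr (f j)) {a : A} (ha : S.Contr a)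
    (m j : Fin k) : S.Contr (Function.update f m a j) := by
  rcases eq_or_ne j m with rfl | h
  · rwa [Function.update_self]
  · rw [Function.update_of_ne h]
    exact hf j

omit [StarRing A] [StarModule ℂ A] in
theorem avg_mul_left' {ι : Type*} (H : Finset ι) (c : A) (f : ι → A) :
    avg ℂ H (fun i => c * f i) = c * avg ℂ H f :=
  (map_avg (LinearMap.mulLeft ℂ c) H f).symm

/-- The dual function of the averages. -/
theorem HasWeakLimits.exists_dual (hS : S.HasWeakLimits) (U : Ultrafilter ℕ) (Φ : ℕ → Finset F)
    (a : F → F) {u : F → A} (hu : ∀ n, S.Contr (u n)) {g : ℕ → A} (hg : ∀ N, S.Contr (g N)) :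
    ∃ f₀, S.Contr f₀ ∧ ∀ x, Tendsto
      (fun N => avg ℂ (Φ N) fun n => S.Λ (g N * u n * S.τ (a n) x)) U (𝓝 (S.Λ (f₀ * x))) := by
  obtain ⟨f₀, h0, h1⟩ := hS U (fun N => avg ℂ (Φ N) fun n => S.τ (-a n) (g N * u n))
    fun N => Contr.avg _ fun n => ((hg N).mul (hu n)).τ _
  refine ⟨f₀, h0, fun x => (h1 x).congr fun N => ?_⟩
  rw [show S.Λ ((avg ℂ (Φ N) fun n => S.τ (-a n) (g N * u n)) * x)
    = (S.Λ ∘ₗ LinearMap.mulRight ℂ x) (avg ℂ (Φ N) fun n => S.τ (-a n) (g N * u n)) from rfl,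
    map_avg]
  refine avg_congr fun n _ => ?_
  rw [LinearMap.comp_apply, LinearMap.mulRight_apply, ← S.Λ_τ (a n), map_mul, S.τ_τ_neg]

variable [DecidableEq F] [CharZero F] {Eig : A → Prop}

/-- If all the seminorms of the function at the polynomial of highest degree vanish, then the
averages vanish in the limit. -/
theorem tendsto_multiAvg_zero_of_G_eq_zero (hΦ : IsFolnerSequence Φ) (hp : IndependentPolynomials p)
    (hEig : S.IsEigenClass Eig) {T : Finset (Fin k)} {f : Fin k → A} (hf : ∀ j, S.Contr (f j))
    (hfT : ∀ j ∉ T, Eig (f j)) {m : Fin k} (hm : m ∈ T)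
    (hmax : ∀ j ∈ T, (p j).natDegree ≤ (p m).natDegree) (hG : ∀ s, S.G s (f m) = 0) :
    Tendsto (fun N => S.ι (S.multiAvg p (Φ N) f)) atTop (𝓝 0) := by
  have hz : ∀ j, ∃ z : AddChar F ℂ, (∀ g, ‖z g‖ = 1) ∧
      (j ∉ T → ∀ g b, S.ι (S.τ g (f j) * b) = z g • S.ι (f j * b)) := by
    intro j
    by_cases hj : j ∈ T
    · exact ⟨1, fun g => by simp, fun h => absurd hj h⟩
    · obtain ⟨z, h1, h2, -⟩ := hEig.exists_addChar (hfT j hj)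
      exact ⟨z, h1, fun _ => h2⟩
  choose z hz1 hz using hz
  let L : Multiset (F[X] × A) := (T.erase m).val.map fun j => (p j, f j)
  have hL : PolyFamily (p m) L := by
    refine ⟨hp.natDegree_pos m, ?_, ?_, ?_⟩ <;> intro q hq <;>
      obtain ⟨j, hj, rfl⟩ := Multiset.mem_map.1 hq <;> have hj' := Finset.mem_erase.1 hj
    · exact hp.natDegree_pos j
    · exact hmax j hj'.2
    · exact hp.natDegree_sub_pos hj'.1.symm
  have hML : ∀ q ∈ (p m, f m) ::ₘ L, S.Contr q.2 := by
    intro q hq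
    rcases Multiset.mem_cons.1 hq with rfl | hq
    · exact hf m
    · obtain ⟨j, -, rfl⟩ := Multiset.mem_map.1 hq
      exact hf j
  -- Each eigenfunction slot splits into a unimodular weight depending on `n` and a fixed function;
  -- the weights enter polynomial exhaustion and the functions are removed as the contraction `c`.
  let w : F → ℂ := fun n => ∏ j ∈ Finset.univ \ T, z j ((p j).eval n)
  have hw : ∀ n, ‖w n‖ ≤ 1 := fun n => by
    rw [norm_prod]
    exact (Finset.prod_eq_one fun j _ => hz1 j _).le
  have hPET := S.tendsto_avg_polyProd hΦ hL hML hG hw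
  let c : A := ∏ j ∈ Finset.univ \ T, f j
  have hc : S.Contr c := Contr.prod fun j _ => hf j
  have hprod : ∀ n, S.polyProd ((p m, f m) ::ₘ L) n = ∏ j ∈ T, S.τ ((p j).eval n) (f j) := by
    intro n
    rw [polyProd_cons, polyProd, Multiset.map_map, ← Finset.mul_prod_erase _ _ hm]
    rfl
  have hι : ∀ N, S.ι (S.multiAvg p (Φ N) f)
      = S.ι (c * avg ℂ (Φ N) fun n => w n • S.polyProd ((p m, f m) ::ₘ L) n) := by
    intro N
    rw [multiAvg, ← avg_mul_left', map_avg, map_avg]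
    refine avg_congr fun n _ => ?_
    rw [hprod, mul_smul_comm, map_smul, ← Finset.prod_sdiff (Finset.subset_univ T),
      ι_prod_τ_mul _ fun j hj => hz j (Finset.mem_sdiff.1 hj).2]
  refine squeeze_zero_norm (fun N => ?_) hPET
  rw [hι]
  refine (hc _).trans (le_of_eq ?_)
  rw [map_avg]
  simp only [map_smul]

/-- The inductive step when the functions which are not eigenfunctions have integral zero. -/
theorem multiConv_of_Λ_eq_zero (hΦ : IsFolnerSequence Φ) (hp : IndependentPolynomials p)
    (hS : S.HasWeakLimits) (hEig : S.IsEigenClass Eig) {T : Finset (Fin k)} {m : Fin k} (hm : m ∈ T)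
    (hmax : ∀ j ∈ T, (p j).natDegree ≤ (p m).natDegree)
    (ih : ∀ f : Fin k → A, (∀ j, S.Contr (f j)) → (∀ j ∉ T.erase m, Eig (f j)) →
      S.MultiConv p Φ f)
    {f : Fin k → A} (hf : ∀ j, S.Contr (f j)) (hfT : ∀ j ∉ T, Eig (f j))
    (hf0 : ∀ j ∈ T, S.Λ (f j) = 0) : S.MultiConv p Φ f := by
  by_contra hcon
  unfold MultiConv at hcon
  rw [Finset.prod_eq_zero (f := fun j => S.Λ (f j)) (Finset.mem_univ m) (hf0 m hm), zero_smul,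
    tendsto_zero_iff_norm_tendsto_zero, Metric.tendsto_atTop] at hcon
  push Not at hcon
  obtain ⟨δ, hδ, hfreq⟩ := hcon
  let V : ℕ → A := fun N => S.multiAvg p (Φ N) f
  have hV : ∀ N, S.Contr (V N) := fun N => contr_multiAvg hf _
  obtain ⟨U, hU, hUδ⟩ : ∃ U : Ultrafilter ℕ, (U : Filter ℕ) ≤ atTop ∧
      ∀ᶠ N in (U : Filter ℕ), δ ≤ ‖S.ι (V N)‖ := by
    have h1 : ∃ᶠ N in atTop, δ ≤ ‖S.ι (V N)‖ := by
      refine frequently_atTop.2 fun N => ?_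
      obtain ⟨M, hM, hM'⟩ := hfreq N
      refine ⟨M, hM, ?_⟩
      simpa using hM'
    have : (atTop ⊓ 𝓟 {N | δ ≤ ‖S.ι (V N)‖}).NeBot := frequently_mem_iff_neBot.1 h1
    exact ⟨Ultrafilter.of _, (Ultrafilter.of_le _).trans inf_le_left,
      (Ultrafilter.of_le _).trans inf_le_right (mem_principal_self _)⟩
  let a : F → F := fun n => (p m).eval n
  let u : F → A := fun n => ∏ j ∈ Finset.univ.erase m, S.τ ((p j).eval n) (f j)
  have hu : ∀ n, S.Contr (u n) := fun n => Contr.prod fun j _ => (hf j).τ _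
  let g : ℕ → A := fun N => star (V N)
  have hg : ∀ N, S.Contr (g N) := fun N => (hV N).star
  -- The dual function: pairing it with `x` gives the limit of `V N` tested against the averages
  -- with `x` in slot `m`.
  obtain ⟨f₀, hf₀, hdual⟩ := hS.exists_dual U Φ a hu hg
  have hdual' : ∀ x, Tendsto (fun N => S.Λ (g N * S.multiAvg p (Φ N) (Function.update f m x))) U
      (𝓝 (S.Λ (f₀ * x))) := by
    intro x
    refine (hdual x).congr fun N => ?_
    rw [multiAvg_update, ← avg_mul_left', map_avg]
    simp only [mul_assoc]
    rfl
  have hne : S.Λ (f₀ * star f₀) ≠ 0 := by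
    have h1 : δ ^ 2 ≤ ‖S.Λ (f₀ * f m)‖ := by
      have h2 := hdual' (f m)
      rw [Function.update_eq_self] at h2
      refine ge_of_tendsto h2.norm (hUδ.mono fun N hN => ?_)
      change δ ^ 2 ≤ ‖S.Λ (star (V N) * V N)‖
      rw [← S.norm_ι_sq, norm_pow, Complex.norm_real, norm_norm]
      exact pow_le_pow_left₀ hδ.le hN 2
    have h3 : 0 < ‖S.ι f₀‖ := by
      rw [mul_comm] at h1
      exact (by positivity : 0 < δ ^ 2).trans_le (h1.trans ((hf m).norm_Λ_mul_le f₀))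
    rw [mul_comm, ← S.norm_ι_sq]
    exact_mod_cast (pow_pos h3 2).ne'
  obtain ⟨s, hs⟩ : ∃ s, S.G s f₀ ≠ 0 := by
    by_contra! hG
    refine hne (tendsto_nhds_unique (hdual' (star f₀)) ?_)
    have h1 := tendsto_multiAvg_zero_of_G_eq_zero hΦ hp hEig (T := T)
      (f := Function.update f m (star f₀)) (Contr.update hf hf₀.star m) (fun j hj => ?_) hm hmax
      (fun s => by rw [Function.update_self, S.G_star, hG])
    · refine squeeze_zero_norm (fun N => (hg N).norm_Λ_mul_le _) ?_
      simpa using (h1.mono_left hU).norm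
    · rw [Function.update_of_ne (by rintro rfl; exact hj hm)]
      exact hfT j hj
  -- Degree lowering gives `Λ f₀ ≠ 0`. It remains to supply its equidistribution hypothesis and to
  -- show `Λ f₀ = 0`.
  refine G_zero_ne_zero_of_G_ne_zero hEig hΦ hu hg hf₀ hdual ?_ hs ?_
  · intro t t' _ g' hg' χ hχ hχ0
    -- Cube products commute with the product over slots and with the action. The eigenfunction `χ`
    -- now occupies slot `m`, so the induction hypothesis applies, with limit zero because `Λ χ =
    -- 0`.
    let f' : Fin k → A := Function.update (fun j => cubeProd t t' fun s => S.τ s.sum (f j)) m χ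
    have h1 : S.MultiConv p Φ f' := by
      refine ih f' (Contr.update (fun j =>
        S.isStarMultiplicative_contr.cubeProd (fun s => (hf j).τ _) _ _) (hEig.contr hχ) m)
        fun j hj => ?_
      simp only [f']
      rcases eq_or_ne j m with rfl | hjm
      · rwa [Function.update_self]
      · rw [Function.update_of_ne hjm]
        exact hEig.isStarMultiplicative.cubeProd (fun s => hEig.map_τ
          (hfT j fun h => hj (Finset.mem_erase.2 ⟨hjm, h⟩)) _) _ _
    unfold MultiConv at h1
    rw [prod_Λ_update, hχ0, mul_zero, zero_smul] at h1
    refine squeeze_zero_norm (fun N => ?_) (by simpa using (h1.mono_left hU).norm)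
    refine le_trans (le_of_eq ?_) ((hg' N).norm_Λ_mul_le _)
    rw [multiAvg_update, ← avg_mul_left', map_avg]
    congr 1
    refine avg_congr fun n _ => ?_
    rw [mul_assoc]
    congr 3
    simp only [u, map_prod, cubeProd_prod, map_cubeProd, S.τ_comm]
  · have h1 : S.MultiConv p Φ (Function.update f m 1) := by
      refine ih _ (Contr.update hf Contr.one m) fun j hj => ?_
      rcases eq_or_ne j m with rfl | hjm
      · rw [Function.update_self]
        exact hEig.isStarMultiplicative.one
      · rw [Function.update_of_ne hjm]
        exact hfT j fun h => hj (Finset.mem_erase.2 ⟨hjm, h⟩)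
    unfold MultiConv at h1
    set c := ∏ j, S.Λ (Function.update f m 1 j) with hc
    -- If `c ≠ 0`, every slot other than `m` has nonzero integral and thus lies outside `T`; there
    -- the function is an eigenfunction acting as a scalar, so `Λ (V N)` is a multiple of `Λ (f m) =
    -- 0`.
    have h2 : ∀ N, c * S.Λ (g N) = 0 := by
      intro N
      by_cases hc0 : c = 0
      · rw [hc0, zero_mul]
      · rw [hc, prod_Λ_update, S.Λ_one, mul_one, ← ne_eq, Finset.prod_ne_zero_iff] at hc0
        have hΛ : ∀ j ∈ Finset.univ.erase m, Eig (f j) := fun j hj =>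
          hfT j fun hjT => hc0 j hj (hf0 j hjT)
        have h3 : S.Λ (V N) = 0 := by
          simp only [V, multiAvg]
          rw [map_avg]
          refine (avg_congr fun n _ => ?_).trans (avg_const (hΦ.nonempty N) 0)
          rw [← Finset.prod_erase_mul _ _ (Finset.mem_univ m), Λ_eq_inner,
            hEig.ι_prod_mul_of_Λ_ne_zero _ (fun j hj => hEig.map_τ (hΛ j hj) _)
              (fun j hj => by rw [S.Λ_τ]; exact hc0 j hj), inner_smul_right, ← Λ_eq_inner, S.Λ_τ,
            hf0 m hm, mul_zero]
        rw [S.Λ_star, h3, star_zero, mul_zero]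
    have h4 : Tendsto (fun N => S.Λ (g N * S.multiAvg p (Φ N) (Function.update f m 1))) U (𝓝 0) := by
      have h5 := (tendsto_iff_norm_sub_tendsto_zero.1 h1).mono_left hU
      refine squeeze_zero_norm (fun N => ?_) h5
      have h6 : S.Λ (g N * S.multiAvg p (Φ N) (Function.update f m 1))
          = S.Λ (g N * (S.multiAvg p (Φ N) (Function.update f m 1) - c • 1)) := by
        rw [mul_sub, map_sub, mul_smul_comm, map_smul, mul_one, smul_eq_mul, h2, sub_zero]
      rw [h6]
      refine ((hg N).norm_Λ_mul_le _).trans_eq ?_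
      rw [map_sub, map_smul]
    have h7 := tendsto_nhds_unique (hdual' 1) h4
    rwa [mul_one] at h7

/-- The averages of contractions converge to the product of the integrals. -/
theorem multiConv_of_contr (hΦ : IsFolnerSequence Φ) (hp : IndependentPolynomials p)
    (hS : S.HasWeakLimits) (hEig : S.IsEigenClass Eig) (T : Finset (Fin k)) {f : Fin k → A}
    (hf : ∀ j, S.Contr (f j)) (hfT : ∀ j ∉ T, Eig (f j)) : S.MultiConv p Φ f := by
  induction T using Finset.strongInduction generalizing f with
  | H T ih =>
    rcases T.eq_empty_or_nonempty with rfl | hT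
    · exact multiConv_of_eig hΦ hp hEig fun j => hfT j (by simp)
    obtain ⟨m, hm, hmax⟩ := T.exists_max_image (fun j => (p j).natDegree) hT
    -- `R` collects the slots whose functions have not yet been assumed to have integral zero.
    have key : ∀ (R : Finset (Fin k)) (f : Fin k → A), (∀ j, S.Contr (f j)) →
        (∀ j ∉ T, Eig (f j)) → (∀ j ∈ T \ R, S.Λ (f j) = 0) → S.MultiConv p Φ f := by
      intro R
      induction R using Finset.induction_on with
      | empty =>
        intro f hf hfT hf0
        exact multiConv_of_Λ_eq_zero hΦ hp hS hEig hm hmax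
          (fun f hf hfT => ih _ (Finset.erase_ssubset hm) hf hfT) hf hfT (by simpa using hf0)
      | insert i R hi ihR =>
        intro f hf hfT hf0
        by_cases hiT : i ∈ T
        · have hc : ‖S.Λ (f i)‖ ≤ 1 := (hf i).norm_Λ_le
          -- The mean-zero part, halved to remain a contraction. The complementary part is a
          -- multiple of `1`, an eigenfunction, so it falls under the induction hypothesis for a
          -- smaller `T`.
          let b : A := (2⁻¹ : ℂ) • (f i - S.Λ (f i) • 1)
          have hb : S.Contr b := (hf i).half_sub (Contr.one.smul hc)
          refine MultiConv.of_update (m := i) (a := 1) (b := b) (c := S.Λ (f i)) (d := 2) ?_ ?_ ?_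
          · refine ih _ (Finset.erase_ssubset hiT) (Contr.update hf Contr.one i) fun j hj => ?_
            rcases eq_or_ne j i with rfl | hji
            · rw [Function.update_self]
              exact hEig.isStarMultiplicative.one
            · rw [Function.update_of_ne hji]
              exact hfT j fun h => hj (Finset.mem_erase.2 ⟨hji, h⟩)
          · refine ihR _ (Contr.update hf hb i) (fun j hj => ?_) fun j hj => ?_
            · rw [Function.update_of_ne (by rintro rfl; exact hj hiT)]
              exact hfT j hj
            · rcases eq_or_ne j i with rfl | hji
              · rw [Function.update_self]
                simp [b, S.Λ_one]
              · rw [Function.update_of_ne hji]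
                rw [Finset.mem_sdiff] at hj
                exact hf0 j (by simp [hj, hji])
          · simp [b]
        · exact ihR f hf hfT fun j hj => by
            rw [Finset.mem_sdiff] at hj
            exact hf0 j (by
              simp only [Finset.mem_sdiff, Finset.mem_insert, hj, true_and, or_false]
              rintro rfl
              exact hiT hj.1)
    exact key Finset.univ f hf hfT (by simp)

end KoopmanSystem

/-! ### From bounded representatives to `L^∞` functions -/

section

variable {X : Type*} [MeasurableSpace X] {μ : Measure X} [IsProbabilityMeasure μ]

omit [IsProbabilityMeasure μ] in
/-- An essentially bounded function is a multiple of a measurable function bounded by one, up to a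
null set. -/
theorem MeasureTheory.MemLp.exists_boundedMeasurable {f : X → ℂ} (hf : MemLp f ⊤ μ) :
    ∃ (a : boundedMeasurable X) (c : ℂ), (∀ x, ‖a.1 x‖ ≤ 1) ∧ f =ᵐ[μ] fun x => c * a.1 x := by
  obtain ⟨C, hC0, hC⟩ : ∃ C : ℝ, 0 < C ∧ ∀ᵐ x ∂μ, ‖f x‖ ≤ C := by
    have h1 : eLpNormEssSup f μ < ⊤ := by simpa using hf.eLpNorm_lt_top
    refine ⟨(eLpNormEssSup f μ).toReal + 1, by positivity, ?_⟩
    filter_upwards [ae_le_eLpNormEssSup (f := f) (μ := μ)] with x hx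
    have h2 := ENNReal.toReal_mono h1.ne hx
    rw [toReal_enorm] at h2
    linarith
  obtain ⟨g, hg, hfg⟩ := hf.1
  have hgm := hg.measurable
  have hset : MeasurableSet {x | ‖g x‖ ≤ C} := measurableSet_le hgm.norm measurable_const
  have hb : ∀ x, ‖{x | ‖g x‖ ≤ C}.indicator (fun x => (C : ℂ)⁻¹ * g x) x‖ ≤ 1 := by
    intro x
    by_cases hx : ‖g x‖ ≤ C
    · rw [Set.indicator_of_mem (show x ∈ {x | ‖g x‖ ≤ C} from hx), norm_mul, norm_inv,
        Complex.norm_real, Real.norm_of_nonneg hC0.le, inv_mul_le_iff₀ hC0, mul_one]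
      exact hx
    · rw [Set.indicator_of_notMem (show x ∉ {x | ‖g x‖ ≤ C} from hx), norm_zero]
      exact zero_le_one
  refine ⟨⟨{x | ‖g x‖ ≤ C}.indicator fun x => (C : ℂ)⁻¹ * g x, (hgm.const_mul _).indicator hset,
    1, hb⟩, C, hb, ?_⟩
  filter_upwards [hfg, hC] with x hx hx'
  have hC0' : (C : ℂ) ≠ 0 := by exact_mod_cast hC0.ne'
  rw [hx] at hx' ⊢
  change g x = C * {x | ‖g x‖ ≤ C}.indicator (fun x => (C : ℂ)⁻¹ * g x) x
  rw [Set.indicator_of_mem (show x ∈ {x | ‖g x‖ ≤ C} from hx'), mul_inv_cancel_left₀ hC0']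

end

namespace KoopmanSystem

variable {F A E : Type*} [Field F] [CommRing A] [StarRing A]
    [Algebra ℂ A] [StarModule ℂ A] [NormedAddCommGroup E] [InnerProductSpace ℂ E]
    {S : KoopmanSystem F A E} {Φ : ℕ → Finset F} {k : ℕ} {p : Fin k → Polynomial F}

theorem MultiConv.smul {f : Fin k → A} (h : S.MultiConv p Φ f) (c : Fin k → ℂ) :
    S.MultiConv p Φ fun j => c j • f j := by
  unfold MultiConv at *
  simp only [map_smul, smul_eq_mul, Finset.prod_mul_distrib, mul_smul]
  refine (h.const_smul (∏ j, c j)).congr fun N => ?_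
  rw [← map_smul, multiAvg, ← avg_smul]
  congr 1
  refine avg_congr fun n _ => ?_
  simp only [map_smul, Finset.prod_smul]

end KoopmanSystem

theorem theorem1p2 {F : Type*} [Field F] [CharZero F] [Countable F] [DecidableEq F]
    {X : Type*} [MeasurableSpace X] (μ : MeasureTheory.Measure X)
    [MeasureTheory.IsProbabilityMeasure μ]
    [AddAction F X] [MeasurableConstVAdd F X] [ErgodicVAdd F X μ]
    (Φ : ℕ → Finset F) (hΦ : IsFolnerSequence Φ)
    (k : ℕ) (p : Fin k → Polynomial F) (hp : IndependentPolynomials p)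
    (f : Fin k → X → ℂ) (hf : ∀ j, MeasureTheory.MemLp (f j) ⊤ μ) :
    Filter.Tendsto
      (fun N : ℕ =>
        MeasureTheory.eLpNorm
          (fun x : X =>
            (((Φ N).card : ℂ)⁻¹ * ∑ n ∈ Φ N, ∏ j, f j ((p j).eval n +ᵥ x))
              - ∏ j, ∫ y, f j y ∂μ)
          2 μ)
      Filter.atTop (nhds 0) := by
  choose a c ha hc using fun j => (hf j).exists_boundedMeasurable
  set S := koopmanSystem μ F
  let b : Fin k → boundedMeasurable X := fun j => c j • a j
  have hb : ∀ j, f j =ᵐ[μ] (b j).1 := hc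
  have hconv : S.MultiConv p Φ b :=
    (KoopmanSystem.multiConv_of_contr hΦ hp (exists_weak_limit μ)
      (isEigenClass_koopmanSystem μ hΦ) Finset.univ
      (fun j => contr_koopmanSystem μ (ha j)) (by simp)).smul c
  have hint : ∏ j, ∫ y, f j y ∂μ = ∏ j, S.Λ (b j) :=
    Finset.prod_congr rfl fun j _ => integral_congr_ae (hb j)
  -- Countability of `F` gives one null set outside which all translates agree with their bounded
  -- representatives.
  have hae : ∀ᵐ x ∂μ, ∀ (n : F) (j : Fin k), f j ((p j).eval n +ᵥ x) = (b j).1 ((p j).eval n +ᵥ x) :=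
    ae_all_iff.2 fun n => ae_all_iff.2 fun j =>
      (measurePreserving_vadd ((p j).eval n) μ).quasiMeasurePreserving.ae_eq_comp (hb j)
  have heq : ∀ N, eLpNorm (fun x : X => (((Φ N).card : ℂ)⁻¹ * ∑ n ∈ Φ N,
      ∏ j, f j ((p j).eval n +ᵥ x)) - ∏ j, ∫ y, f j y ∂μ) 2 μ
      = ENNReal.ofReal ‖S.ι (S.multiAvg p (Φ N) b) - (∏ j, S.Λ (b j)) • S.ι 1‖ := by
    intro N
    rw [← map_smul, ← map_sub, koopmanSystem_ι, Lp.norm_toLp,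
      ENNReal.ofReal_toReal (boundedMeasurable.memLp μ _ 2).2.ne]
    refine eLpNorm_congr_ae ?_
    filter_upwards [hae] with x hx
    rw [hint]
    change _ = (S.multiAvg p (Φ N) b).1 x - (∏ j, S.Λ (b j)) * 1
    rw [mul_one]
    congr 1
    -- Evaluation at a point is an algebra homomorphism, so it commutes with the averages and
    -- products formed in `boundedMeasurable X`.
    let ev : boundedMeasurable X →ₐ[ℂ] ℂ :=
      (Pi.evalAlgHom ℂ (fun _ : X => ℂ) x).comp (boundedMeasurable X).toSubalgebra.val
    have h1 : (S.multiAvg p (Φ N) b).1 x = ev (S.multiAvg p (Φ N) b) := rfl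
    rw [h1, KoopmanSystem.multiAvg, map_avg, avg, smul_eq_mul]
    congr 1
    refine Finset.sum_congr rfl fun n _ => ?_
    rw [map_prod]
    exact Finset.prod_congr rfl fun j _ => hx n j
  simp only [heq]
  rw [← ENNReal.ofReal_zero]
  exact ENNReal.tendsto_ofReal (tendsto_iff_norm_sub_tendsto_zero.1 hconv)
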